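/- Let $(X,\omega,J)$ be a Kähler manifold of real dimension $2n$ with metric $g=\omega(\cdot,J\cdot)$ and canonical (= Levi-Civita) connection $\nabla$, and let $i:Y\hookrightarrow X$ be a coisotropic embedding of a manifold of dimension $n+k$, i.e. a smooth embedding with $(TY)^\omega\subset TY$. Let $T\mathcal F=(TY)^\omega$ be the tangent bundle of the null foliation $\mathcal F$ (of rank $n-k$), let $\mathcal E=T\mathcal F\oplus J\,T\mathcal F\subset TX|_Y$, let $\mathcal E^{1,0}\subset\mathcal E\otimes\mathbb C$ be the $\sqrt{-1}$-eigenbundle of $J$, and let $\det\mathcal E^{1,0}=\Lambda^{n-k}\mathcal E^{1,0}$. Equip $\mathcal E^{1,0}$ with the connection induced from $\nabla$ (the pulled back connection on $i^*TX\otimes\mathbb C$ followed by the orthogonal projection onto $\mathcal E^{1,0}$) and $\det\mathcal E^{1,0}$ with the connection, again denoted $\nabla$, induced by it; let $\nabla^\omega$ be its restriction to directions in $T\mathcal F$. Let $S$ be the second fundamental form of $Y\subset(X,g)$, let $\vec H^\parallel=\sum_\beta S(e_\beta,e_\beta)$ be its trace over $T\mathcal F$ ($e_\beta$ an orthonormal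 basis of $T\mathcal F$), and let $\alpha_Y^\parallel=(\vec H^\parallel\rfloor\omega)|_{TY}$, also regarded as a leafwise one-form. Let $\{e_1,\dots,e_n,f_1,\dots,f_n\}$, $f_j=Je_j$, be a smooth orthonormal frame of $TX$ on an open set $U\subset X$ such that on $Y\cap U$ the vectors $e_1,\dots,e_n,f_1,\dots,f_k$ span $TY$ and $e_{k+1},\dots,e_n$ span $T\mathcal F$. Put $u_j=\tfrac12(e_j-\sqrt{-1}f_j)$ and let $\omega^i_j$ be the connection forms, $\nabla u_j=\sum_i\omega^i_j\otimes u_i$. Write $\omega^\alpha_\alpha=\sum_{\alpha=k+1}^n\omega^\alpha_\alpha$. Then on $i^{-1}(U)$ $$\nabla(u_{k+1}\wedge\cdots\wedge u_n)=i^*(\omega^\alpha_\alpha)\cdot(u_{k+1}\wedge\cdots\wedge u_n),\qquad \nabla^\omega(u_{k+1}\wedge\cdots\wedge u_n)=-\sqrt{-1}\,\alpha_Y^\parallel\cdot(u_{k+1}\wedge\cdots\wedge u_n).$$ Moreover the curvature of $(\det\mathcal E^{1,0},\nabla)$ is, on $i^{-1}(U)$, $$\mathrm{curv}(\det\mathcal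 E^{1,0})=i^*(d\omega^\alpha_\alpha),$$ and on all of $Y$ the leafwise curvature (the curvature of $\nabla^\omega$) is $${}^E\mathrm{curv}(\det\mathcal E^{1,0})=-\sqrt{-1}\,d_{\mathcal F}\alpha_Y^\parallel,$$ where $d_{\mathcal F}$ is the exterior derivative along $\mathcal F$, and $d\eta(V,W)=V\eta(W)-W\eta(V)-\eta([V,W])$ for one-forms. -/

import Mathlib

open scoped Manifold ContDiff TensorProduct Topology

noncomputable section

namespace CoisotropicKaehler

/-! ### Linear algebra -/

section LinearAlgebra

variable {V : Type*} [AddCommGroup V] [Module ℝ V]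

/-- Real part of a vector of the complexification `ℂ ⊗ V`. -/
def reV : ℂ ⊗[ℝ] V →ₗ[ℝ] V :=
  (TensorProduct.lid ℝ V).toLinearMap ∘ₗ LinearMap.rTensor V Complex.reLm

/-- Imaginary part of a vector of the complexification `ℂ ⊗ V`. -/
def imV : ℂ ⊗[ℝ] V →ₗ[ℝ] V :=
  (TensorProduct.lid ℝ V).toLinearMap ∘ₗ LinearMap.rTensor V Complex.imLm

/-- Complexification of a real-linear map `A` into `V`: `A + √-1 B`, as a map into `ℂ ⊗ V`. -/
def complexCombine {T : Type*} [AddCommGroup T] [Module ℝ T] (A B : T →ₗ[ℝ] V) :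
    T →ₗ[ℝ] ℂ ⊗[ℝ] V :=
  TensorProduct.mk ℝ ℂ V 1 ∘ₗ A + TensorProduct.mk ℝ ℂ V Complex.I ∘ₗ B

/-- Complex-linear extension `ℂ ⊗ V → ℂ` of a real covector. -/
def extendCovector (φ : V →ₗ[ℝ] ℝ) : ℂ ⊗[ℝ] V →ₗ[ℝ] ℂ :=
  Complex.ofRealLI.toLinearMap ∘ₗ φ ∘ₗ reV +
    Complex.I • (Complex.ofRealLI.toLinearMap ∘ₗ φ ∘ₗ imV)

/-- The orthogonal complement of a subspace for a positive definite form is a complement. -/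
theorem isCompl_orthogonal [FiniteDimensional ℝ V] (B : LinearMap.BilinForm ℝ V)
    (hs : ∀ v w, B v w = B w v) (hp : ∀ v, v ≠ 0 → 0 < B v v) (W : Submodule ℝ V) :
    IsCompl W (B.orthogonal W) := by
  have hrefl : B.IsRefl := fun v w h => by rw [hs, h]
  refine B.isCompl_orthogonal_of_restrict_nondegenerate hrefl ?_
  refine ⟨fun w hw => ?_, fun w hw => ?_⟩
  · by_contra h
    have h1 := hp (w : V) (by simpa using h)
    have h2 : B w w = 0 := hw w
    linarith
  · by_contra h
    have h1 := hp (w : V) (by simpa using h)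
    have h2 : B w w = 0 := hw w
    linarith

end LinearAlgebra

/-! ### Kähler manifolds -/

section Kaehler

variable (E : Type*) [NormedAddCommGroup E] [NormedSpace ℝ E] [FiniteDimensional ℝ E]
  [CompleteSpace E]
  (X : Type*) [TopologicalSpace X] [ChartedSpace E X] [IsManifold 𝓘(ℝ, E) ∞ X]

/-- A Kähler structure: a non-degenerate two-form `ω`, a compatible almost complex structure `J`
(so that `g = ω(·, J ·)` is a Riemannian metric), and the canonical connection `∇`, which preserves
`ω` and `J` and which, the structure being Kähler, has vanishing torsion (thus `∇` is the
Levi-Civita connection of `g`). Closedness of `ω` and integrability of `J` are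
consequences of `∇ ω = 0`, `∇ J = 0` and the vanishing of the torsion. -/
structure KaehlerStructure where
  /-- the symplectic form -/
  om : ∀ x : X, TangentSpace 𝓘(ℝ, E) x →L[ℝ] TangentSpace 𝓘(ℝ, E) x →L[ℝ] ℝ
  /-- the complex structure -/
  J : ∀ x : X, TangentSpace 𝓘(ℝ, E) x →L[ℝ] TangentSpace 𝓘(ℝ, E) x
  /-- the canonical connection; `conn σ x v` is `∇_v σ` at `x` -/
  conn : CovariantDerivative 𝓘(ℝ, E) E (TangentSpace 𝓘(ℝ, E) : X → Type _)
  smooth_om : ContMDiff 𝓘(ℝ, E) (𝓘(ℝ, E).prod 𝓘(ℝ, E →L[ℝ] E →L[ℝ] ℝ)) ∞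
    (fun x ↦ Bundle.TotalSpace.mk' (E →L[ℝ] E →L[ℝ] ℝ)
      (E := fun x : X ↦ TangentSpace 𝓘(ℝ, E) x →L[ℝ] TangentSpace 𝓘(ℝ, E) x →L[ℝ] ℝ) x (om x))
  smooth_J : ContMDiff 𝓘(ℝ, E) (𝓘(ℝ, E).prod 𝓘(ℝ, E →L[ℝ] E)) ∞
    (fun x ↦ Bundle.TotalSpace.mk' (E →L[ℝ] E)
      (E := fun x : X ↦ TangentSpace 𝓘(ℝ, E) x →L[ℝ] TangentSpace 𝓘(ℝ, E) x) x (J x))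
  smooth_conn : CovariantDerivative.ContMDiffCovariantDerivative conn ∞
  alt : ∀ x v, om x v v = 0
  J_sq : ∀ x v, J x (J x v) = -v
  symm : ∀ x v w, om x v (J x w) = om x w (J x v)
  pos : ∀ x v, v ≠ 0 → 0 < om x v (J x v)
  parallel_om : ∀ (σ τ : ∀ x : X, TangentSpace 𝓘(ℝ, E) x) (x : X) (v : TangentSpace 𝓘(ℝ, E) x),
    MDifferentiableAt 𝓘(ℝ, E) (𝓘(ℝ, E).prod 𝓘(ℝ, E))
      (fun x ↦ (⟨x, σ x⟩ : TangentBundle 𝓘(ℝ, E) X)) x →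
    MDifferentiableAt 𝓘(ℝ, E) (𝓘(ℝ, E).prod 𝓘(ℝ, E))
      (fun x ↦ (⟨x, τ x⟩ : TangentBundle 𝓘(ℝ, E) X)) x →
    mvfderiv 𝓘(ℝ, E) (fun x ↦ om x (σ x) (τ x)) x v =
      om x (conn σ x v) (τ x) + om x (σ x) (conn τ x v)
  parallel_J : ∀ (σ : ∀ x : X, TangentSpace 𝓘(ℝ, E) x) (x : X) (v : TangentSpace 𝓘(ℝ, E) x),
    MDifferentiableAt 𝓘(ℝ, E) (𝓘(ℝ, E).prod 𝓘(ℝ, E))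
      (fun x ↦ (⟨x, σ x⟩ : TangentBundle 𝓘(ℝ, E) X)) x →
    conn (fun x ↦ J x (σ x)) x v = J x (conn σ x v)
  torsion_eq_zero : conn.torsion = 0

variable {E X}

instance (x : X) : FiniteDimensional ℝ (TangentSpace 𝓘(ℝ, E) x) :=
  inferInstanceAs (FiniteDimensional ℝ E)

namespace KaehlerStructure

variable (K : KaehlerStructure E X)

/-- The Kähler metric `g = ω(·, J ·)`. -/
def g (x : X) : LinearMap.BilinForm ℝ (TangentSpace 𝓘(ℝ, E) x) :=
  LinearMap.mk₂ ℝ (fun v w ↦ K.om x v (K.J x w)) (by simp) (by simp) (by simp) (by simp)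

theorem isCompl (x : X) (W : Submodule ℝ (TangentSpace 𝓘(ℝ, E) x)) :
    IsCompl W ((K.g x).orthogonal W) :=
  isCompl_orthogonal (K.g x) (K.symm x) (K.pos x) W

/-- `g`-orthogonal projection of `T_x X` onto a subspace. -/
def orthProj (x : X) (W : Submodule ℝ (TangentSpace 𝓘(ℝ, E) x)) :
    TangentSpace 𝓘(ℝ, E) x →ₗ[ℝ] W :=
  Submodule.projectionOnto W ((K.g x).orthogonal W) (K.isCompl x W)

/-- The connection on `TX ⊗ ℂ`, by complex-linear extension. -/
def connC (Z : ∀ x : X, ℂ ⊗[ℝ] TangentSpace 𝓘(ℝ, E) x) (x : X) :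
    TangentSpace 𝓘(ℝ, E) x →ₗ[ℝ] ℂ ⊗[ℝ] TangentSpace 𝓘(ℝ, E) x :=
  complexCombine (K.conn (fun x ↦ reV (Z x)) x : TangentSpace 𝓘(ℝ, E) x →ₗ[ℝ] _)
    (K.conn (fun x ↦ imV (Z x)) x : TangentSpace 𝓘(ℝ, E) x →ₗ[ℝ] _)

/-! A real frame `e_j` (with `f_j = J e_j`), its unitary frame, coframe and connection forms. -/

variable {ι : Type*} (e : ι → ∀ x : X, TangentSpace 𝓘(ℝ, E) x)

/-- `u_j = (e_j - √-1 f_j) / 2`, where `f_j = J e_j`. -/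
def u (j : ι) (x : X) : ℂ ⊗[ℝ] TangentSpace 𝓘(ℝ, E) x :=
  (1 / 2 : ℂ) ⊗ₜ[ℝ] e j x - (Complex.I / 2) ⊗ₜ[ℝ] K.J x (e j x)

/-- `θ^j = e_j^* + √-1 f_j^*`; as the frame is orthonormal, `e_j^* = g(e_j, ·)` and
`f_j^* = g(f_j, ·)`. -/
def coframe (j : ι) (x : X) : ℂ ⊗[ℝ] TangentSpace 𝓘(ℝ, E) x →ₗ[ℝ] ℂ :=
  extendCovector (K.g x (e j x)) + Complex.I • extendCovector (K.g x (K.J x (e j x)))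

/-- The connection one-forms `ω^i_j`: the components of `∇ u_j = ∑ ω^i_j ⊗ u_i`. -/
def connForm (a b : ι) (x : X) : TangentSpace 𝓘(ℝ, E) x →ₗ[ℝ] ℂ :=
  K.coframe e a x ∘ₗ K.connC (K.u e b) x

end KaehlerStructure

/-- Exterior derivative of a complex one-form `η` at `x`, by the invariant formula
`dη(v, w) = v(η(W)) - w(η(V)) - η([V, W])` with `V`, `W` extending `v`, `w`. -/
def dOneForm (η : ∀ x : X, TangentSpace 𝓘(ℝ, E) x →ₗ[ℝ] ℂ) (x : X)
    (v w : TangentSpace 𝓘(ℝ, E) x) : ℂ :=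
  mvfderiv 𝓘(ℝ, E) (fun x' ↦ η x' (FiberBundle.extend E w x')) x v
    - mvfderiv 𝓘(ℝ, E) (fun x' ↦ η x' (FiberBundle.extend E v x')) x w
    - η x (VectorField.mlieBracket 𝓘(ℝ, E) (FiberBundle.extend E v) (FiberBundle.extend E w) x)

end Kaehler

/-! ### Coisotropic submanifolds -/

section Coisotropic

variable {E : Type*} [NormedAddCommGroup E] [NormedSpace ℝ E] [FiniteDimensional ℝ E]
  [CompleteSpace E]
  {X : Type*} [TopologicalSpace X] [ChartedSpace E X] [IsManifold 𝓘(ℝ, E) ∞ X]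
  {F : Type*} [NormedAddCommGroup F] [NormedSpace ℝ F] [FiniteDimensional ℝ F]
  {Y : Type*} [TopologicalSpace Y] [ChartedSpace F Y] [IsManifold 𝓘(ℝ, F) ∞ Y]
  {K : KaehlerStructure E X}

variable (F Y K) in
/-- A coisotropic embedding `i : Y ↪ X`: a smooth embedding with `(TY)^ω ⊆ TY`. -/
structure CoisotropicEmbedding where
  /-- the underlying map -/
  i : Y → X
  embedding : Manifold.IsSmoothEmbedding 𝓘(ℝ, F) 𝓘(ℝ, E) ∞ i
  coisotropic : ∀ (y : Y) (w : TangentSpace 𝓘(ℝ, E) (i y)),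
    (∀ v, K.om (i y) (mfderiv 𝓘(ℝ, F) 𝓘(ℝ, E) i y v) w = 0) →
      ∃ v, mfderiv 𝓘(ℝ, F) 𝓘(ℝ, E) i y v = w

variable (C : CoisotropicEmbedding F Y K)

/-- The differential `di_y : T_y Y → T_{i(y)} X`. -/
def di (y : Y) : TangentSpace 𝓘(ℝ, F) y →ₗ[ℝ] TangentSpace 𝓘(ℝ, E) (C.i y) :=
  (mfderiv 𝓘(ℝ, F) 𝓘(ℝ, E) C.i y : TangentSpace 𝓘(ℝ, F) y →ₗ[ℝ] _)

/-- The tangent space `E_y = T_y𝓕` of the null foliation: `(T_yY)^ω`, as a subspace of `T_y Y`. -/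
def nullSpace (y : Y) : Submodule ℝ (TangentSpace 𝓘(ℝ, F) y) where
  carrier := {v | ∀ w, K.om (C.i y) (di C y w) (di C y v) = 0}
  add_mem' hv hw z := by simp [hv z, hw z]
  zero_mem' z := by simp
  smul_mem' c v hv z := by simp [hv z]

/-- `𝓔_y = T_y𝓕 ⊕ J T_y𝓕 = T_y𝓕 ⊕ (N_J Y)_y` inside `T_{i(y)} X`. -/
def calE (y : Y) : Submodule ℝ (TangentSpace 𝓘(ℝ, E) (C.i y)) :=
  (nullSpace C y).map (di C y) ⊔
    ((nullSpace C y).map (di C y)).map (K.J (C.i y) : TangentSpace 𝓘(ℝ, E) (C.i y) →ₗ[ℝ] _)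

/-- `𝓔^{1,0}`: the `√-1`-eigenspace of `J` on `𝓔 ⊗ ℂ`. -/
def E10 (y : Y) : Submodule ℂ (ℂ ⊗[ℝ] TangentSpace 𝓘(ℝ, E) (C.i y)) :=
  (calE C y).baseChange ℂ ⊓
    Module.End.eigenspace
      ((K.J (C.i y) : TangentSpace 𝓘(ℝ, E) (C.i y) →ₗ[ℝ] TangentSpace 𝓘(ℝ, E) (C.i y)).baseChange ℂ)
      Complex.I

/-- The fibre at `y` of the complex line bundle `det 𝓔^{1,0}`, where `m` is the rank
of `𝓔^{1,0}`. -/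
abbrev detE10 (m : ℕ) (y : Y) : Type _ := ⋀[ℂ]^m (E10 C y)

theorem J_mem_calE (y : Y) {v : TangentSpace 𝓘(ℝ, E) (C.i y)} (hv : v ∈ calE C y) :
    K.J (C.i y) v ∈ calE C y := by
  obtain ⟨a, ha, b, hb, rfl⟩ := Submodule.mem_sup.1 hv
  obtain ⟨c, hc, rfl⟩ := hb
  rw [map_add]
  refine add_mem (Submodule.mem_sup_right ⟨a, ha, rfl⟩) (Submodule.mem_sup_left ?_)
  simpa [K.J_sq] using hc

/-! #### The induced connection on `𝓔^{1,0}` -/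

/-- The connection on `i^*TX` pulled back from `TX`: for a section `s` of `i^*TX`, in the
coordinate frame `∂_j` around `i(y)`, `∇_v (∑ s^j ∂_j) = ∑ v(s^j) ∂_j + s^j ∇_{di(v)} ∂_j`. -/
def pullConn (s : ∀ y : Y, TangentSpace 𝓘(ℝ, E) (C.i y)) (y : Y) :
    TangentSpace 𝓘(ℝ, F) y →ₗ[ℝ] TangentSpace 𝓘(ℝ, E) (C.i y) :=
  ((trivializationAt E (TangentSpace 𝓘(ℝ, E)) (C.i y)).symmL ℝ (C.i y) : E →ₗ[ℝ] _) ∘ₗ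
      (mvfderiv 𝓘(ℝ, F) (fun y' ↦
        (trivializationAt E (TangentSpace 𝓘(ℝ, E)) (C.i y)
          (⟨C.i y', s y'⟩ : TangentBundle 𝓘(ℝ, E) X)).2) y : TangentSpace 𝓘(ℝ, F) y →ₗ[ℝ] E)
    + (K.conn (FiberBundle.extend E (s y)) (C.i y) : TangentSpace 𝓘(ℝ, E) (C.i y) →ₗ[ℝ] _) ∘ₗ di C y

/-- The pulled back connection on `i^*TX ⊗ ℂ`. -/
def pullConnC (s : ∀ y : Y, ℂ ⊗[ℝ] TangentSpace 𝓘(ℝ, E) (C.i y)) (y : Y) :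
    TangentSpace 𝓘(ℝ, F) y →ₗ[ℝ] ℂ ⊗[ℝ] TangentSpace 𝓘(ℝ, E) (C.i y) :=
  complexCombine (pullConn C (fun y ↦ reV (s y)) y) (pullConn C (fun y ↦ imV (s y)) y)

/-- The projection `(1 - √-1 J) / 2 ∘ pr` of `TX ⊗ ℂ` onto `𝓔^{1,0}`, where `pr` is the (complexified)
orthogonal projection onto `𝓔`; this is the Hermitian orthogonal projection onto `𝓔^{1,0}`. -/
def projE10 (y : Y) : ℂ ⊗[ℝ] TangentSpace 𝓘(ℝ, E) (C.i y) →ₗ[ℂ] E10 C y :=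
  let JC := (K.J (C.i y) : TangentSpace 𝓘(ℝ, E) (C.i y) →ₗ[ℝ]
    TangentSpace 𝓘(ℝ, E) (C.i y)).baseChange ℂ
  LinearMap.codRestrict (E10 C y)
    ((1 / 2 : ℂ) • (LinearMap.id - Complex.I • JC) ∘ₗ
      ((calE C y).subtype ∘ₗ K.orthProj (C.i y) (calE C y)).baseChange ℂ)
    (by
      intro z
      induction z using TensorProduct.induction_on with
      | zero => simp
      | add a b ha hb => rw [map_add]; exact add_mem ha hb
      | tmul c v =>
        set w := K.orthProj (C.i y) (calE C y) v
        have h1 : c ⊗ₜ[ℝ] (w : TangentSpace 𝓘(ℝ, E) (C.i y)) ∈ (calE C y).baseChange ℂ :=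
          Submodule.tmul_mem_baseChange_of_mem c w.2
        have h2 : c ⊗ₜ[ℝ] (K.J (C.i y) w) ∈ (calE C y).baseChange ℂ :=
          Submodule.tmul_mem_baseChange_of_mem c (J_mem_calE C y w.2)
        refine ⟨?_, ?_⟩
        · have : ((1 / 2 : ℂ) • (LinearMap.id - Complex.I • JC) ∘ₗ
              ((calE C y).subtype ∘ₗ K.orthProj (C.i y) (calE C y)).baseChange ℂ) (c ⊗ₜ[ℝ] v)
              = (1 / 2 : ℂ) • (c ⊗ₜ[ℝ] (w : TangentSpace 𝓘(ℝ, E) (C.i y))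
                - Complex.I • (c ⊗ₜ[ℝ] (K.J (C.i y) w))) := by
            simp [JC, w]
          rw [this]
          exact Submodule.smul_mem _ _ (sub_mem h1 (Submodule.smul_mem _ _ h2))
        · have hJ : JC (c ⊗ₜ[ℝ] (w : TangentSpace 𝓘(ℝ, E) (C.i y))) = c ⊗ₜ[ℝ] K.J (C.i y) w := by
            simp [JC]
          have hJJ : JC (c ⊗ₜ[ℝ] (K.J (C.i y) w)) =
              -(c ⊗ₜ[ℝ] (w : TangentSpace 𝓘(ℝ, E) (C.i y))) := by
            simp [JC, K.J_sq, TensorProduct.tmul_neg]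
          have : ((1 / 2 : ℂ) • (LinearMap.id - Complex.I • JC) ∘ₗ
              ((calE C y).subtype ∘ₗ K.orthProj (C.i y) (calE C y)).baseChange ℂ) (c ⊗ₜ[ℝ] v)
              = (1 / 2 : ℂ) • (c ⊗ₜ[ℝ] (w : TangentSpace 𝓘(ℝ, E) (C.i y))
                - Complex.I • (c ⊗ₜ[ℝ] (K.J (C.i y) w))) := by
            simp [JC, w]
          rw [this]
          refine Module.End.mem_eigenspace_iff.2 ?_
          change JC _ = _
          rw [map_smul, map_sub, map_smul, hJ, hJJ, smul_comm Complex.I (1 / 2 : ℂ), smul_sub Complex.I, smul_smul Complex.I,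
            Complex.I_mul_I]
          simp only [smul_neg, neg_smul, one_smul, sub_neg_eq_add]
          rw [add_comm])

/-- The connection on `𝓔^{1,0}` induced from that of `TX` along `Y`: the covariant derivative in
`i^*TX ⊗ ℂ`, followed by the orthogonal projection onto `𝓔^{1,0}`. -/
def connE10 (s : ∀ y : Y, E10 C y) (y : Y) : TangentSpace 𝓘(ℝ, F) y →ₗ[ℝ] E10 C y :=
  (projE10 C y).restrictScalars ℝ ∘ₗ
    pullConnC C (fun y ↦ (s y : ℂ ⊗[ℝ] TangentSpace 𝓘(ℝ, E) (C.i y))) y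

/-! #### The induced connection on `det 𝓔^{1,0}` -/

/-- `s` is a smooth frame of `𝓔^{1,0}` over the open set `N`. -/
structure IsFrameE10 {m : ℕ} (N : Set Y) (s : Fin m → ∀ y : Y, E10 C y) : Prop where
  isOpen : IsOpen N
  smooth_re : ∀ j, ContMDiffOn 𝓘(ℝ, F) (𝓘(ℝ, E).prod 𝓘(ℝ, E)) ∞
    (fun y ↦ (⟨C.i y, reV (s j y : ℂ ⊗[ℝ] TangentSpace 𝓘(ℝ, E) (C.i y))⟩ : TangentBundle 𝓘(ℝ, E) X)) N
  smooth_im : ∀ j, ContMDiffOn 𝓘(ℝ, F) (𝓘(ℝ, E).prod 𝓘(ℝ, E)) ∞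
    (fun y ↦ (⟨C.i y, imV (s j y : ℂ ⊗[ℝ] TangentSpace 𝓘(ℝ, E) (C.i y))⟩ : TangentBundle 𝓘(ℝ, E) X)) N
  linearIndependent : ∀ y ∈ N, LinearIndependent ℂ (fun j ↦ s j y)
  span : ∀ y ∈ N, Submodule.span ℂ (Set.range fun j ↦ s j y) = ⊤

/-- The section `s_1 ∧ ⋯ ∧ s_m` of `det 𝓔^{1,0}`. -/
def wedge {m : ℕ} (s : Fin m → ∀ y : Y, E10 C y) (y : Y) : detE10 C m y :=
  exteriorPower.ιMulti ℂ m (fun j ↦ s j y)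

/-- The section `σ` of `det 𝓔^{1,0}` is smooth near `y`. -/
def SmoothDetSectionNear {m : ℕ} (σ : ∀ y : Y, detE10 C m y) (y : Y) : Prop :=
  ∃ (N : Set Y) (s : Fin m → ∀ y : Y, E10 C y) (h : Y → ℂ),
    y ∈ N ∧ IsFrameE10 C N s ∧ ContMDiffOn 𝓘(ℝ, F) 𝓘(ℝ, ℂ) ∞ h N ∧
    ∀ y' ∈ N, σ y' = h y' • wedge C s y'

/-- `τ` is the covariant derivative `∇_v σ` at `y` for the connection on `det 𝓔^{1,0}`
induced by the one on `𝓔^{1,0}`: if `σ = h · s_1 ∧ ⋯ ∧ s_m` near `y` for a local frame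
`s` of `𝓔^{1,0}`, then
`∇_v σ = dh(v) · s_1 ∧ ⋯ ∧ s_m + h · ∑_j s_1 ∧ ⋯ ∧ ∇_v s_j ∧ ⋯ ∧ s_m`. -/
def HasDetCovDerivAt {m : ℕ} (σ : ∀ y : Y, detE10 C m y) (y : Y)
    (v : TangentSpace 𝓘(ℝ, F) y) (τ : detE10 C m y) : Prop :=
  ∃ (N : Set Y) (s : Fin m → ∀ y : Y, E10 C y) (h : Y → ℂ),
    y ∈ N ∧ IsFrameE10 C N s ∧ MDifferentiableAt 𝓘(ℝ, F) 𝓘(ℝ, ℂ) h y ∧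
    (∀ y' ∈ N, σ y' = h y' • wedge C s y') ∧
    τ = mvfderiv 𝓘(ℝ, F) h y v • wedge C s y +
      h y • ∑ j, exteriorPower.ιMulti ℂ m
        (Function.update (fun l ↦ s l y) j (connE10 C (s j) y v))

open Classical in
/-- The induced connection on `det 𝓔^{1,0}`: `detConn σ y v = ∇_v σ` at `y`
(`0` if `σ` is not differentiable at `y`). -/
def detConn {m : ℕ} (σ : ∀ y : Y, detE10 C m y) (y : Y) (v : TangentSpace 𝓘(ℝ, F) y) :
    detE10 C m y :=
  if h : ∃ τ, HasDetCovDerivAt C σ y v τ then h.choose else 0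

/-- The leafwise connection `∇^ω` on `det 𝓔^{1,0}`: the restriction of `∇` to `T𝓕`. -/
def leafConn {m : ℕ} (σ : ∀ y : Y, detE10 C m y) (y : Y) (v : nullSpace C y) :
    detE10 C m y :=
  detConn C σ y v

/-- The curvature `R(V, W) σ = ∇_V ∇_W σ - ∇_W ∇_V σ - ∇_{[V, W]} σ` of `det 𝓔^{1,0}`. -/
def detCurv {m : ℕ} (V W : ∀ y : Y, TangentSpace 𝓘(ℝ, F) y) (σ : ∀ y : Y, detE10 C m y)
    (y : Y) : detE10 C m y :=
  detConn C (fun y ↦ detConn C σ y (W y)) y (V y)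
    - detConn C (fun y ↦ detConn C σ y (V y)) y (W y)
    - detConn C σ y (VectorField.mlieBracket 𝓘(ℝ, F) V W y)

/-! #### The Lie algebroid `E = T𝓕` -/

open Classical in
/-- The Lie bracket on sections of `T𝓕`, which is the one of vector fields on `Y`. As `T𝓕` is
integrable, the bracket of smooth sections is again in `T𝓕`, and the first case applies. -/
def leafBracket (V W : ∀ y : Y, nullSpace C y) (y : Y) : nullSpace C y :=
  if h : VectorField.mlieBracket 𝓘(ℝ, F) (fun y ↦ (V y : TangentSpace 𝓘(ℝ, F) y))
      (fun y ↦ (W y : TangentSpace 𝓘(ℝ, F) y)) y ∈ nullSpace C y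
  then ⟨_, h⟩ else 0

/-- The leafwise curvature of `det 𝓔^{1,0}`. -/
def leafCurv {m : ℕ} (V W : ∀ y : Y, nullSpace C y) (σ : ∀ y : Y, detE10 C m y) (y : Y) :
    detE10 C m y :=
  leafConn C (fun y ↦ leafConn C σ y (W y)) y (V y)
    - leafConn C (fun y ↦ leafConn C σ y (V y)) y (W y)
    - leafConn C σ y (leafBracket C V W y)

/-- The leafwise differential `d_𝓕` of a leafwise one-form:
`d_𝓕 η (V, W) = V(η(W)) - W(η(V)) - η([V, W])`. -/
def dLeaf (η : ∀ y : Y, nullSpace C y →ₗ[ℝ] ℝ) (V W : ∀ y : Y, nullSpace C y) (y : Y) : ℝ :=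
  mvfderiv 𝓘(ℝ, F) (fun y' ↦ η y' (W y')) y (V y : TangentSpace 𝓘(ℝ, F) y)
    - mvfderiv 𝓘(ℝ, F) (fun y' ↦ η y' (V y')) y (W y : TangentSpace 𝓘(ℝ, F) y)
    - η y (leafBracket C V W y)

/-! #### Leafwise mean curvature -/

/-- The second fundamental form `S(v, w) = (∇_v W)^⊥` of `Y`, where `W` is a vector field on `Y`
extending `w`. -/
def secondFF (y : Y) (v w : TangentSpace 𝓘(ℝ, F) y) : TangentSpace 𝓘(ℝ, E) (C.i y) :=
  let D := pullConn C (fun y' ↦ di C y' (FiberBundle.extend F w y')) y v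
  D - K.orthProj (C.i y) (LinearMap.range (di C y)) D

/-- The leafwise mean curvature vector: the trace of `S` over `T𝓕` with respect to the metric.
In a basis `b_p` of `T_y𝓕` with Gram matrix `G` this is `∑ (G⁻¹)_{pq} S(b_p, b_q)`, so
`∑ S(e_β, e_β)` for an orthonormal basis. -/
def leafMeanCurvVector (y : Y) : TangentSpace 𝓘(ℝ, E) (C.i y) :=
  let b := Module.finBasis ℝ (nullSpace C y)
  let G : Matrix (Fin (Module.finrank ℝ (nullSpace C y)))
      (Fin (Module.finrank ℝ (nullSpace C y))) ℝ :=
    Matrix.of fun p q ↦ K.g (C.i y) (di C y (b p)) (di C y (b q))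
  ∑ p, ∑ q, G⁻¹ p q • secondFF C y (b p) (b q)

/-- The leafwise mean curvature one-form `α = (H ⌟ ω)|_{TY}`. -/
def meanCurvForm (y : Y) : TangentSpace 𝓘(ℝ, F) y →ₗ[ℝ] ℝ :=
  (K.om (C.i y) (leafMeanCurvVector C y) : TangentSpace 𝓘(ℝ, E) (C.i y) →ₗ[ℝ] ℝ) ∘ₗ di C y

/-- The leafwise mean curvature one-form as a leafwise form, i.e. as a section of `T^*𝓕`. -/
def leafMeanCurvForm (y : Y) : nullSpace C y →ₗ[ℝ] ℝ :=
  (meanCurvForm C y).domRestrict (nullSpace C y)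

/-! #### Adapted frames -/

/-- An adapted frame on the open set `U ⊆ X`: `e_1, …, e_k` (indexed by `Fin k`) and
`e_{k+1}, …, e_n` (indexed by `Fin m`) are smooth, `{e_j, f_j}` with `f_j = J e_j` is an orthonormal
frame of `TX`, and at the points of `Y` the vectors `e_1, …, e_n, f_1, …, f_k` span `TY` and
`e_{k+1}, …, e_n` span `T𝓕`. -/
structure IsAdaptedFrame {k m : ℕ} (U : Set X)
    (e : Fin k ⊕ Fin m → ∀ x : X, TangentSpace 𝓘(ℝ, E) x) : Prop where
  isOpen : IsOpen U
  smooth : ∀ j, ContMDiffOn 𝓘(ℝ, E) (𝓘(ℝ, E).prod 𝓘(ℝ, E)) ∞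
    (fun x ↦ (⟨x, e j x⟩ : TangentBundle 𝓘(ℝ, E) X)) U
  orthonormal_e : ∀ x ∈ U, ∀ j l, K.g x (e j x) (e l x) = if j = l then 1 else 0
  orthogonal_f : ∀ x ∈ U, ∀ j l, K.g x (e j x) (K.J x (e l x)) = 0
  complete : ∀ x ∈ U, Submodule.span ℝ
    (Set.range (fun j ↦ e j x) ∪ Set.range (fun j ↦ K.J x (e j x))) = ⊤
  span_TY : ∀ y, C.i y ∈ U → Submodule.span ℝ
    (Set.range (fun j ↦ e j (C.i y)) ∪ Set.range (fun a ↦ K.J (C.i y) (e (Sum.inl a) (C.i y)))) =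
      LinearMap.range (di C y)
  span_null : ∀ y, C.i y ∈ U → Submodule.span ℝ (Set.range (fun α ↦ e (Sum.inr α) (C.i y))) =
    (nullSpace C y).map (di C y)

variable {C} in
theorem IsAdaptedFrame.u_mem {k m : ℕ} {U : Set X}
    {e : Fin k ⊕ Fin m → ∀ x : X, TangentSpace 𝓘(ℝ, E) x} (he : IsAdaptedFrame C U e)
    {y : Y} (hy : C.i y ∈ U) (α : Fin m) : K.u e (Sum.inr α) (C.i y) ∈ E10 C y := by
  have h0 : e (Sum.inr α) (C.i y) ∈ (nullSpace C y).map (di C y) := by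
    rw [← he.span_null y hy]
    exact Submodule.subset_span ⟨α, rfl⟩
  have h1 : e (Sum.inr α) (C.i y) ∈ calE C y := Submodule.mem_sup_left h0
  refine ⟨sub_mem (Submodule.tmul_mem_baseChange_of_mem _ h1)
    (Submodule.tmul_mem_baseChange_of_mem _ (J_mem_calE C y h1)), ?_⟩
  refine Module.End.mem_eigenspace_iff.2 ?_
  simp only [KaehlerStructure.u, map_sub, LinearMap.baseChange_tmul, smul_sub,
    TensorProduct.smul_tmul', smul_eq_mul, ContinuousLinearMap.coe_coe, K.J_sq,
    TensorProduct.tmul_neg]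
  rw [show Complex.I * (Complex.I / 2) = -(1 / 2 : ℂ) by
    rw [← mul_div_assoc, Complex.I_mul_I]; ring, TensorProduct.neg_tmul,
    show Complex.I * (1 / 2) = Complex.I / 2 by ring]
  abel

open Classical in
variable {C} in
/-- The section `u_α` of `𝓔^{1,0}` over `i⁻¹(U)` (extended by `0`), for `α = k+1, …, n`. -/
def IsAdaptedFrame.uSection {k m : ℕ} {U : Set X}
    {e : Fin k ⊕ Fin m → ∀ x : X, TangentSpace 𝓘(ℝ, E) x} (he : IsAdaptedFrame C U e)
    (α : Fin m) (y : Y) : E10 C y :=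
  if hy : C.i y ∈ U then ⟨K.u e (Sum.inr α) (C.i y), he.u_mem hy α⟩ else 0

variable (K) in
/-- The trace `ω^α_α`, summed over `α = k+1, …, n`, a one-form on `X`. -/
def connTrace {k m : ℕ} (e : Fin k ⊕ Fin m → ∀ x : X, TangentSpace 𝓘(ℝ, E) x) (x : X) :
    TangentSpace 𝓘(ℝ, E) x →ₗ[ℝ] ℂ :=
  ∑ α : Fin m, K.connForm e (Sum.inr α) (Sum.inr α) x

/-- The vector field `V` on `Y` is smooth near `y`. -/
def SmoothVectorFieldNear (V : ∀ y : Y, TangentSpace 𝓘(ℝ, F) y) (y : Y) : Prop :=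
  ∀ᶠ y' in 𝓝 y, ContMDiffAt 𝓘(ℝ, F) (𝓘(ℝ, F).prod 𝓘(ℝ, F)) ∞
    (fun y ↦ (⟨y, V y⟩ : TangentBundle 𝓘(ℝ, F) Y)) y'

end Coisotropic

end CoisotropicKaehler

end

open CoisotropicKaehler

/-!
All objects of the theorem live on `Y`, so the proof is carried out with sections of `i^*TX`. The
pulled back connection satisfies the Leibniz rule, preserves `ω` (`mvfderiv_om`) and `J`
(`pullConn_J`), and has no torsion: `∇_V di(W) - ∇_W di(V) = di([V, W])` (`pullConn_di_sub`). The
first two facts follow from those on `X`, because sections of `i^*TX` are locally combinations of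
restricted vector fields (`along_induction`); the last one follows in a chart from the identity
`V(df(W)) - W(df(V)) = df([V, W])` (`mvfderiv_mvfderiv_apply_sub`), which also yields the
curvature of a line bundle and the naturality of `d`.

Let `s_1, …, s_m` be a local orthonormal frame of `T𝓕`. Since `T𝓕` is isotropic, the vectors
`s_a, J s_a` are orthonormal, so `u_a = (s_a - √-1 J s_a) / 2` is a frame of `𝓔^{1,0}` and the
projection onto `𝓔^{1,0}` is `z ↦ ∑ h_a(z) u_a`, where `h_a` is the complex covector
`g(s_a, ·) + √-1 g(J s_a, ·)` (`IsLeafBasis.projE10_eq`). Hence the connection on `det 𝓔^{1,0}`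
is `d + η` in the frame `u_1 ∧ ⋯ ∧ u_m`, with
`η = ∑ h_a(∇u_a) = ∑ (g(s_a, ∇s_a) + √-1 ω(s_a, ∇s_a))`. As the connection is defined through
arbitrary frames of `𝓔^{1,0}`, this needs Jacobi's formula for the derivative of the transition
determinant (`IsLeafFrame.detConn_eq`). The curvature of a line bundle with connection `d + η` is
`dη` (`IsLeafFrame.detCurv_eq`).

The heart of the matter is that `η = -√-1 α` on `T𝓕` (`IsLeafFrame.frameForm_eq_meanCurvForm`). The
real part of `η` vanishes because `g(s_a, s_a) = 1`. For the imaginary part let `t` be a section of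
`T𝓕`. Then `∇_t s_a - ∇_{s_a} t = [t, s_a]` is tangent to `Y`, hence `ω`-orthogonal to `s_a`, and
differentiating `ω(s_a, t) = 0` along `s_a` gives
`ω(s_a, ∇_t s_a) = ω(s_a, ∇_{s_a} t) = -ω(∇_{s_a} s_a, t)`. Tangential components do not contribute
to the right-hand side, so the sum over `a` is `-ω(H, t) = -α(t)`, with `H` the trace of the second
fundamental form over `T𝓕`; this trace may be taken in the frame `s_a` (`sum_gram_inv_smul`).

An adapted frame restricts to the leaf frame `e_{k+1}, …, e_n`, whose form `η` is the pull-back of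
`ω^α_α` (`IsAdaptedFrame.frameForm_eq`); this gives the two formulas for the connection, and, as `d`
commutes with pull-back (`dOneForm_di`), the curvature. The leafwise curvature is computed near any
point of `Y` in a leaf frame, with no adapted frame on `X`. Such a leaf frame exists because `T𝓕` is
`J` applied to the normal bundle of `Y`, which has a smooth orthonormal frame by the Gram-Schmidt
process (`exists_isLeafFrame`); and `T𝓕` is involutive (`mlieBracket_mem_nullSpace`), so that the
leafwise bracket is the Lie bracket.
-/

noncomputable section

set_option linter.unusedSectionVars false

namespace CoisotropicKaehler

/-! ### Derivatives along vector fields and the Lie bracket -/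

section Bracket

variable {F : Type*} [NormedAddCommGroup F] [NormedSpace ℝ F] [FiniteDimensional ℝ F]
  [CompleteSpace F]
  {Y : Type*} [TopologicalSpace Y] [ChartedSpace F Y] [IsManifold 𝓘(ℝ, F) ∞ Y]
  {E : Type*} [NormedAddCommGroup E] [NormedSpace ℝ E]
  {X : Type*} [TopologicalSpace X] [ChartedSpace E X] [IsManifold 𝓘(ℝ, E) ∞ X]
  {G : Type*} [NormedAddCommGroup G] [NormedSpace ℝ G]

theorem contMDiffAt_mfderiv_apply {f : Y → X} {V : ∀ y : Y, TangentSpace 𝓘(ℝ, F) y} {y : Y}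
    (hf : ContMDiffAt 𝓘(ℝ, F) 𝓘(ℝ, E) ∞ f y)
    (hV : ContMDiffAt 𝓘(ℝ, F) (𝓘(ℝ, F).prod 𝓘(ℝ, F)) ∞
      (fun y ↦ (⟨y, V y⟩ : TangentBundle 𝓘(ℝ, F) Y)) y) :
    ContMDiffAt 𝓘(ℝ, F) (𝓘(ℝ, E).prod 𝓘(ℝ, E)) ∞
      (fun y' ↦ (⟨f y', mfderiv 𝓘(ℝ, F) 𝓘(ℝ, E) f y' (V y')⟩ : TangentBundle 𝓘(ℝ, E) X)) y := by
  have h := hf.mfderiv_const (m := ∞) le_rfl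
  exact ContMDiffAt.clm_apply_of_inCoordinates (b₁ := id) (b₂ := f) h hV hf

theorem contMDiffAt_mvfderiv_apply {f : Y → G} {V : ∀ y : Y, TangentSpace 𝓘(ℝ, F) y} {y : Y}
    (hf : ContMDiffAt 𝓘(ℝ, F) 𝓘(ℝ, G) ∞ f y)
    (hV : ContMDiffAt 𝓘(ℝ, F) (𝓘(ℝ, F).prod 𝓘(ℝ, F)) ∞
      (fun y ↦ (⟨y, V y⟩ : TangentBundle 𝓘(ℝ, F) Y)) y) :
    ContMDiffAt 𝓘(ℝ, F) 𝓘(ℝ, G) ∞ (fun y' ↦ mvfderiv 𝓘(ℝ, F) f y' (V y')) y :=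
  (contMDiff_snd_tangentBundle_modelSpace G 𝓘(ℝ, G)).contMDiffAt.comp y
    (contMDiffAt_mfderiv_apply hf hV)

/-- The case of a vector space: the second derivatives of `f` cancel by symmetry. -/
theorem fderiv_fderiv_apply_sub {f : F → G} {V W : F → F} {p : F} (hf : ContDiffAt ℝ ∞ f p)
    (hV : DifferentiableAt ℝ V p) (hW : DifferentiableAt ℝ W p) :
    fderiv ℝ (fun z ↦ fderiv ℝ f z (W z)) p (V p) - fderiv ℝ (fun z ↦ fderiv ℝ f z (V z)) p (W p) =
      fderiv ℝ f p (VectorField.lieBracket ℝ V W p) := by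
  have hd : DifferentiableAt ℝ (fderiv ℝ f) p :=
    (hf.fderiv_right (m := 1) (by norm_cast)).differentiableAt (by norm_num)
  have hs : IsSymmSndFDerivAt ℝ f p := hf.isSymmSndFDerivAt (by simp; norm_cast)
  rw [fderiv_clm_apply hd hW, fderiv_clm_apply hd hV, VectorField.lieBracket]
  simp [hs.eq (V p) (W p)]

/-- Along a smooth map `f` into a vector space, `V(df(W)) - W(df(V)) = df([V, W])`. This single
identity is behind the vanishing of the torsion along a submanifold, the invariance
of the exterior derivative under pull-back and the flatness of the trivial connection. -/
theorem mvfderiv_mvfderiv_apply_sub {f : Y → G} {V W : ∀ y : Y, TangentSpace 𝓘(ℝ, F) y} {y : Y}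
    (hf : ContMDiffAt 𝓘(ℝ, F) 𝓘(ℝ, G) ∞ f y)
    (hV : ContMDiffAt 𝓘(ℝ, F) (𝓘(ℝ, F).prod 𝓘(ℝ, F)) ∞
      (fun y ↦ (⟨y, V y⟩ : TangentBundle 𝓘(ℝ, F) Y)) y)
    (hW : ContMDiffAt 𝓘(ℝ, F) (𝓘(ℝ, F).prod 𝓘(ℝ, F)) ∞
      (fun y ↦ (⟨y, W y⟩ : TangentBundle 𝓘(ℝ, F) Y)) y) :
    mvfderiv 𝓘(ℝ, F) (fun y' ↦ mvfderiv 𝓘(ℝ, F) f y' (W y')) y (V y) -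
      mvfderiv 𝓘(ℝ, F) (fun y' ↦ mvfderiv 𝓘(ℝ, F) f y' (V y')) y (W y) =
      mvfderiv 𝓘(ℝ, F) f y (VectorField.mlieBracket 𝓘(ℝ, F) V W y) := by
  have : IsManifold 𝓘(ℝ, F) 2 Y := .of_le (n := ∞) (by norm_cast)
  have hr : Set.range 𝓘(ℝ, F) = Set.univ := 𝓘(ℝ, F).range_eq_univ
  set φ := extChartAt 𝓘(ℝ, F) y with hφ
  set p := φ y with hp
  set f' : F → G := f ∘ φ.symm with hf'
  let tl (Z : ∀ y : Y, TangentSpace 𝓘(ℝ, F) y) : F → F :=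
    VectorField.mpullbackWithin 𝓘(ℝ, F) 𝓘(ℝ, F) φ.symm Z (Set.range 𝓘(ℝ, F))
  have hpy : φ.symm p = y := extChartAt_to_inv y
  have htl0 (Z : ∀ y : Y, TangentSpace 𝓘(ℝ, F) y) : tl Z p = Z y := by
    have h := mfderivWithin_extChartAt_symm_inverse_apply (I := 𝓘(ℝ, F)) (x := y) (Z (φ.symm p))
    refine Eq.trans h ?_
    rw [hpy]
  have hdiff {Z : ∀ y : Y, TangentSpace 𝓘(ℝ, F) y} (hZ : ContMDiffAt 𝓘(ℝ, F) (𝓘(ℝ, F).prod 𝓘(ℝ, F)) ∞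
      (fun y ↦ (⟨y, Z y⟩ : TangentBundle 𝓘(ℝ, F) Y)) y) : DifferentiableAt ℝ (tl Z) p := by
    have h := (hZ.mdifferentiableAt (by simp)).mdifferentiableWithinAt (s := Set.univ)
      |>.differentiableWithinAt_mpullbackWithin_vectorField
    rw [Set.preimage_univ, Set.univ_inter] at h
    exact (h : DifferentiableWithinAt ℝ (tl Z) (Set.range 𝓘(ℝ, F)) p).differentiableAt
      (by rw [hr]; exact Filter.univ_mem)
  have hfs : ContDiffAt ℝ ∞ f' p := by
    have := (contMDiffAt_iff.1 hf).2
    rwa [hr, contDiffWithinAt_univ] at this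
  -- in the chart, `df(Z)` is the derivative of `f'` along the chart expression of `Z`
  have hev (Z : ∀ y : Y, TangentSpace 𝓘(ℝ, F) y) :
      (fun z ↦ mvfderiv 𝓘(ℝ, F) f (φ.symm z) (Z (φ.symm z))) =ᶠ[𝓝 p]
        fun z ↦ fderiv ℝ f' z (tl Z z) := by
    have h1 : ∀ᶠ y' in 𝓝 y, MDifferentiableAt 𝓘(ℝ, F) 𝓘(ℝ, G) f y' := by
      have := (contMDiffAt_iff_contMDiffAt_nhds (n := 1) (by simp)).1 (hf.of_le (by norm_cast))
      filter_upwards [this] with y' h using h.mdifferentiableAt (by simp)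
    have hc : Filter.Tendsto φ.symm (𝓝 p) (𝓝 y) := by
      have := continuousAt_extChartAt_symm (I := 𝓘(ℝ, F)) y
      rw [ContinuousAt] at this
      rwa [← hφ, ← hp, hpy] at this
    filter_upwards [hc.eventually h1, extChartAt_target_mem_nhds (I := 𝓘(ℝ, F)) y] with z hz hzt
    have hsymm : MDifferentiableAt 𝓘(ℝ, F) 𝓘(ℝ, F) φ.symm z := by
      have := mdifferentiableWithinAt_extChartAt_symm (I := 𝓘(ℝ, F)) hzt
      rwa [hr, mdifferentiableWithinAt_univ] at this
    have hinv : (mfderiv 𝓘(ℝ, F) 𝓘(ℝ, F) φ.symm z).IsInvertible := by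
      have := isInvertible_mfderivWithin_extChartAt_symm (I := 𝓘(ℝ, F)) hzt
      rwa [hr, mfderivWithin_univ] at this
    have hcomp := mfderiv_comp_apply z hz hsymm (tl Z z)
    have htz : mfderiv 𝓘(ℝ, F) 𝓘(ℝ, F) φ.symm z (tl Z z) = Z (φ.symm z) := by
      have : tl Z z = (mfderiv 𝓘(ℝ, F) 𝓘(ℝ, F) φ.symm z).inverse (Z (φ.symm z)) := by
        simp only [tl, hr, VectorField.mpullbackWithin_apply, mfderivWithin_univ]
        rfl
      rw [this]
      exact hinv.self_apply_inverse _
    rw [htz, mfderiv_eq_fderiv] at hcomp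
    exact hcomp.symm
  have hD {Z Z' : ∀ y : Y, TangentSpace 𝓘(ℝ, F) y} (hZ : ContMDiffAt 𝓘(ℝ, F) (𝓘(ℝ, F).prod 𝓘(ℝ, F)) ∞
      (fun y ↦ (⟨y, Z y⟩ : TangentBundle 𝓘(ℝ, F) Y)) y) :
      mvfderiv 𝓘(ℝ, F) (fun y' ↦ mvfderiv 𝓘(ℝ, F) f y' (Z y')) y (Z' y) =
        fderiv ℝ (fun z ↦ fderiv ℝ f' z (tl Z z)) p (tl Z' p) := by
    rw [((contMDiffAt_mvfderiv_apply hf hZ).mdifferentiableAt (by simp)).mvfderiv, htl0]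
    simp only [modelWithCornersSelf_coe, Set.range_id, fderivWithin_univ]
    rw [← (hev Z).fderiv_eq]
    rfl
  rw [hD hW, hD hV, fderiv_fderiv_apply_sub hfs (hdiff hV) (hdiff hW)]
  have hb : VectorField.mlieBracket 𝓘(ℝ, F) V W y = VectorField.lieBracket ℝ (tl V) (tl W) p := by
    rw [← VectorField.mlieBracketWithin_univ, VectorField.mlieBracketWithin_apply,
      mfderiv_extChartAt_self, Set.preimage_univ, Set.univ_inter]
    refine (congrArg (fun A : F →L[ℝ] F ↦ A (VectorField.lieBracketWithin ℝ (tl V) (tl W)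
      (Set.range 𝓘(ℝ, F)) p)) (ContinuousLinearMap.inverse_id (R := ℝ) (M := F))).trans ?_
    rw [hr, VectorField.lieBracketWithin_univ]
    rfl
  rw [hb, (hf.mdifferentiableAt (by simp)).mvfderiv]
  simp only [modelWithCornersSelf_coe, Set.range_id, fderivWithin_univ]
  rfl

end Bracket

/-! ### Tangent vectors and the connection in a trivialization -/

section Calculus

variable {E : Type*} [NormedAddCommGroup E] [NormedSpace ℝ E] [FiniteDimensional ℝ E]
  [CompleteSpace E]
  {X : Type*} [TopologicalSpace X] [ChartedSpace E X] [IsManifold 𝓘(ℝ, E) ∞ X]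
  {F : Type*} [NormedAddCommGroup F] [NormedSpace ℝ F] [FiniteDimensional ℝ F]
  {Y : Type*} [TopologicalSpace Y] [ChartedSpace F Y] [IsManifold 𝓘(ℝ, F) ∞ Y]
  {G : Type*} [NormedAddCommGroup G] [NormedSpace ℝ G]
  {K : KaehlerStructure E X} (C : CoisotropicEmbedding F Y K)

theorem mvfderiv_congr {f f' : Y → G} {y : Y} (h : f =ᶠ[𝓝 y] f') :
    mvfderiv 𝓘(ℝ, F) f y = mvfderiv 𝓘(ℝ, F) f' y := by
  ext v
  exact congrArg (fun A : F →L[ℝ] G ↦ A v) (h.mfderiv_eq (I := 𝓘(ℝ, F)) (I' := 𝓘(ℝ, G)))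

theorem mvfderiv_clm_comp {G' : Type*} [NormedAddCommGroup G'] [NormedSpace ℝ G'] (A : G →L[ℝ] G')
    {f : Y → G} {y : Y} (hf : MDifferentiableAt 𝓘(ℝ, F) 𝓘(ℝ, G) f y) (v : TangentSpace 𝓘(ℝ, F) y) :
    mvfderiv 𝓘(ℝ, F) (fun y' ↦ A (f y')) y v = A (mvfderiv 𝓘(ℝ, F) f y v) := by
  have h := mfderiv_comp_apply (I := 𝓘(ℝ, F)) (I' := 𝓘(ℝ, G)) (I'' := 𝓘(ℝ, G')) y
    (A.differentiableAt.mdifferentiableAt (x := f y)) hf v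
  rw [mfderiv_eq_fderiv, A.fderiv] at h
  exact h

theorem mvfderiv_comp_apply' {f : X → G} {b : Y → X} {y : Y}
    (hf : MDifferentiableAt 𝓘(ℝ, E) 𝓘(ℝ, G) f (b y))
    (hb : MDifferentiableAt 𝓘(ℝ, F) 𝓘(ℝ, E) b y) (v : TangentSpace 𝓘(ℝ, F) y) :
    mvfderiv 𝓘(ℝ, F) (fun y' ↦ f (b y')) y v =
      mvfderiv 𝓘(ℝ, E) f (b y) (mfderiv 𝓘(ℝ, F) 𝓘(ℝ, E) b y v) :=
  mfderiv_comp_apply y hf hb v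

theorem trivializationAt_snd_add (x₀ : X) {x : X}
    (hx : x ∈ (trivializationAt E (TangentSpace 𝓘(ℝ, E)) x₀).baseSet)
    (v w : TangentSpace 𝓘(ℝ, E) x) :
    (trivializationAt E (TangentSpace 𝓘(ℝ, E)) x₀ (⟨x, v + w⟩ : TangentBundle 𝓘(ℝ, E) X)).2 =
      (trivializationAt E (TangentSpace 𝓘(ℝ, E)) x₀ (⟨x, v⟩ : TangentBundle 𝓘(ℝ, E) X)).2 +
      (trivializationAt E (TangentSpace 𝓘(ℝ, E)) x₀ (⟨x, w⟩ : TangentBundle 𝓘(ℝ, E) X)).2 :=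
  ((trivializationAt E (TangentSpace 𝓘(ℝ, E)) x₀).linear ℝ hx).map_add v w

theorem trivializationAt_snd_smul (x₀ : X) {x : X}
    (hx : x ∈ (trivializationAt E (TangentSpace 𝓘(ℝ, E)) x₀).baseSet)
    (c : ℝ) (v : TangentSpace 𝓘(ℝ, E) x) :
    (trivializationAt E (TangentSpace 𝓘(ℝ, E)) x₀ (⟨x, c • v⟩ : TangentBundle 𝓘(ℝ, E) X)).2 =
      c • (trivializationAt E (TangentSpace 𝓘(ℝ, E)) x₀ (⟨x, v⟩ : TangentBundle 𝓘(ℝ, E) X)).2 :=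
  ((trivializationAt E (TangentSpace 𝓘(ℝ, E)) x₀).linear ℝ hx).map_smul c v

theorem symmL_trivializationAt_snd (x : X) (v : TangentSpace 𝓘(ℝ, E) x) :
    (trivializationAt E (TangentSpace 𝓘(ℝ, E)) x).symmL ℝ x
      (trivializationAt E (TangentSpace 𝓘(ℝ, E)) x (⟨x, v⟩ : TangentBundle 𝓘(ℝ, E) X)).2 = v := by
  have hx := FiberBundle.mem_baseSet_trivializationAt E (TangentSpace 𝓘(ℝ, E)) x
  have := (trivializationAt E (TangentSpace 𝓘(ℝ, E)) x).symmL_continuousLinearMapAt (R := ℝ) hx v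
  rwa [Bundle.Trivialization.continuousLinearMapAt_apply, Bundle.Trivialization.linearMapAt_apply,
    if_pos hx] at this

theorem extend_add (x : X) (v w : TangentSpace 𝓘(ℝ, E) x) : ∀ᶠ x' in 𝓝 x,
    FiberBundle.extend E (v + w) x' = FiberBundle.extend E v x' + FiberBundle.extend E w x' := by
  have hx := FiberBundle.mem_baseSet_trivializationAt E (TangentSpace 𝓘(ℝ, E)) x
  filter_upwards [(trivializationAt E (TangentSpace 𝓘(ℝ, E)) x).open_baseSet.mem_nhds hx] with x' hx'
  simp only [FiberBundle.extend]
  rw [trivializationAt_snd_add _ hx, ← Bundle.Trivialization.symmL_apply (R := ℝ) _ hx', map_add,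
    Bundle.Trivialization.symmL_apply _ hx', Bundle.Trivialization.symmL_apply _ hx']

theorem extend_smul (x : X) (c : ℝ) (v : TangentSpace 𝓘(ℝ, E) x) : ∀ᶠ x' in 𝓝 x,
    FiberBundle.extend E (c • v) x' = c • FiberBundle.extend E v x' := by
  have hx := FiberBundle.mem_baseSet_trivializationAt E (TangentSpace 𝓘(ℝ, E)) x
  filter_upwards [(trivializationAt E (TangentSpace 𝓘(ℝ, E)) x).open_baseSet.mem_nhds hx] with x' hx'
  simp only [FiberBundle.extend]
  rw [trivializationAt_snd_smul _ hx, ← Bundle.Trivialization.symmL_apply (R := ℝ) _ hx', map_smul,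
    Bundle.Trivialization.symmL_apply _ hx']

theorem trivializationAt_snd_extend (x : X) (v : TangentSpace 𝓘(ℝ, E) x) :
    ∀ᶠ x' in 𝓝 x, (trivializationAt E (TangentSpace 𝓘(ℝ, E)) x
      (⟨x', FiberBundle.extend E v x'⟩ : TangentBundle 𝓘(ℝ, E) X)).2 =
      (trivializationAt E (TangentSpace 𝓘(ℝ, E)) x (⟨x, v⟩ : TangentBundle 𝓘(ℝ, E) X)).2 := by
  filter_upwards [(trivializationAt E (TangentSpace 𝓘(ℝ, E)) x).open_baseSet.mem_nhds
    (FiberBundle.mem_baseSet_trivializationAt E _ x)] with x' hx'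
  simp only [FiberBundle.extend]
  rw [Bundle.Trivialization.apply_mk_symm _ hx']

theorem mdifferentiableAt_trivializationAt_snd {x : X} {Z : ∀ x : X, TangentSpace 𝓘(ℝ, E) x}
    (hZ : MDifferentiableAt 𝓘(ℝ, E) (𝓘(ℝ, E).prod 𝓘(ℝ, E))
      (fun x ↦ (⟨x, Z x⟩ : TangentBundle 𝓘(ℝ, E) X)) x) :
    MDifferentiableAt 𝓘(ℝ, E) 𝓘(ℝ, E) (fun x' ↦ (trivializationAt E (TangentSpace 𝓘(ℝ, E)) x
      (⟨x', Z x'⟩ : TangentBundle 𝓘(ℝ, E) X)).2) x :=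
  ((mdifferentiableAt_totalSpace 𝓘(ℝ, E) _).1 hZ).2

/-- `∇Z` in the coordinate frame around `x`: the flat derivative of the coordinates of `Z`, plus the
covariant derivative of the field with the constant coordinates of `Z x`. The difference of `∇` and
the flat derivative is tensorial, so it depends on `Z` through `Z x` only. This is the formula by
which `pullConn` is defined on sections along `i`. -/
theorem conn_eq_coord [T2Space X] (K : KaehlerStructure E X) {x : X} {Z : ∀ x : X, TangentSpace 𝓘(ℝ, E) x}
    (hZ : MDifferentiableAt 𝓘(ℝ, E) (𝓘(ℝ, E).prod 𝓘(ℝ, E))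
      (fun x ↦ (⟨x, Z x⟩ : TangentBundle 𝓘(ℝ, E) X)) x) (w : TangentSpace 𝓘(ℝ, E) x) :
    K.conn Z x w = (trivializationAt E (TangentSpace 𝓘(ℝ, E)) x).symmL ℝ x
      (mvfderiv 𝓘(ℝ, E) (fun x' ↦ (trivializationAt E (TangentSpace 𝓘(ℝ, E)) x
        (⟨x', Z x'⟩ : TangentBundle 𝓘(ℝ, E) X)).2) x w) + K.conn (FiberBundle.extend E (Z x)) x w := by
  have hb : ∀ᶠ x' in 𝓝 x, x' ∈ (trivializationAt E (TangentSpace 𝓘(ℝ, E)) x).baseSet :=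
    (trivializationAt E (TangentSpace 𝓘(ℝ, E)) x).open_baseSet.mem_nhds
      (FiberBundle.mem_baseSet_trivializationAt E _ x)
  let Φ : (∀ x : X, TangentSpace 𝓘(ℝ, E) x) → TangentSpace 𝓘(ℝ, E) x := fun Z ↦
    K.conn Z x w - (trivializationAt E (TangentSpace 𝓘(ℝ, E)) x).symmL ℝ x
      (mvfderiv 𝓘(ℝ, E) (fun x' ↦ (trivializationAt E (TangentSpace 𝓘(ℝ, E)) x
        (⟨x', Z x'⟩ : TangentBundle 𝓘(ℝ, E) X)).2) x w)
  have hΦ : TensorialAt 𝓘(ℝ, E) E Φ x := by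
    refine ⟨fun {f σ} hf hσ ↦ ?_, fun {σ σ'} hσ hσ' ↦ ?_⟩
    · have h1 : (fun x' ↦ (trivializationAt E (TangentSpace 𝓘(ℝ, E)) x
          (⟨x', (f • σ) x'⟩ : TangentBundle 𝓘(ℝ, E) X)).2) =ᶠ[𝓝 x]
          fun x' ↦ f x' • (trivializationAt E (TangentSpace 𝓘(ℝ, E)) x
            (⟨x', σ x'⟩ : TangentBundle 𝓘(ℝ, E) X)).2 := by
        filter_upwards [hb] with x' hx'
        exact trivializationAt_snd_smul x hx' _ _
      simp only [Φ]
      rw [mvfderiv_congr h1, K.conn.isCovariantDerivativeOnUniv.leibniz hσ hf,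
        mvfderiv_fun_smul hf (mdifferentiableAt_trivializationAt_snd hσ)]
      simp only [add_apply, smul_apply,
        ContinuousLinearMap.smulRight_apply, map_add, map_smul, symmL_trivializationAt_snd]
      module
    · have h1 : (fun x' ↦ (trivializationAt E (TangentSpace 𝓘(ℝ, E)) x
          (⟨x', (σ + σ') x'⟩ : TangentBundle 𝓘(ℝ, E) X)).2) =ᶠ[𝓝 x]
          fun x' ↦ (trivializationAt E (TangentSpace 𝓘(ℝ, E)) x
            (⟨x', σ x'⟩ : TangentBundle 𝓘(ℝ, E) X)).2 + (trivializationAt E (TangentSpace 𝓘(ℝ, E)) x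
            (⟨x', σ' x'⟩ : TangentBundle 𝓘(ℝ, E) X)).2 := by
        filter_upwards [hb] with x' hx'
        exact trivializationAt_snd_add x hx' _ _
      simp only [Φ]
      rw [mvfderiv_congr h1, K.conn.isCovariantDerivativeOnUniv.add hσ hσ',
        mvfderiv_fun_add (mdifferentiableAt_trivializationAt_snd hσ)
          (mdifferentiableAt_trivializationAt_snd hσ')]
      simp only [add_apply, map_add]
      module
  have h := hΦ.pointwise hZ (FiberBundle.mdifferentiableAt_extend 𝓘(ℝ, E) E (Z x))
    (FiberBundle.extend_apply_self E (Z x)).symm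
  simp only [Φ] at h
  rw [mvfderiv_congr (trivializationAt_snd_extend x (Z x)), mvfderiv_const] at h
  simp only [zero_apply, map_zero, sub_zero] at h
  rw [← h]
  abel

/-! ### Sections of `i^*TX` -/

/-- The section `s` of `i^*TX` is differentiable at `y`. -/
def DiffAlongAt (s : ∀ y : Y, TangentSpace 𝓘(ℝ, E) (C.i y)) (y : Y) : Prop :=
  MDifferentiableAt 𝓘(ℝ, F) (𝓘(ℝ, E).prod 𝓘(ℝ, E))
    (fun y ↦ (⟨C.i y, s y⟩ : TangentBundle 𝓘(ℝ, E) X)) y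

/-- The section `s` of `i^*TX` is smooth at `y`. -/
def SmoothAlongAt (s : ∀ y : Y, TangentSpace 𝓘(ℝ, E) (C.i y)) (y : Y) : Prop :=
  ContMDiffAt 𝓘(ℝ, F) (𝓘(ℝ, E).prod 𝓘(ℝ, E)) ∞
    (fun y ↦ (⟨C.i y, s y⟩ : TangentBundle 𝓘(ℝ, E) X)) y

theorem contMDiff_i : ContMDiff 𝓘(ℝ, F) 𝓘(ℝ, E) ∞ C.i := C.embedding.contMDiff

theorem mdifferentiableAt_i (y : Y) : MDifferentiableAt 𝓘(ℝ, F) 𝓘(ℝ, E) C.i y :=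
  (contMDiff_i C).contMDiffAt.mdifferentiableAt (by simp)

theorem eventually_mem_baseSet (y : Y) : ∀ᶠ y' in 𝓝 y,
    C.i y' ∈ (trivializationAt E (TangentSpace 𝓘(ℝ, E)) (C.i y)).baseSet :=
  (contMDiff_i C).continuous.continuousAt.eventually
    ((trivializationAt E (TangentSpace 𝓘(ℝ, E)) (C.i y)).open_baseSet.mem_nhds
      (FiberBundle.mem_baseSet_trivializationAt E _ _))

variable {C}

theorem diffAlongAt_iff {s : ∀ y : Y, TangentSpace 𝓘(ℝ, E) (C.i y)} {y : Y} :
    DiffAlongAt C s y ↔ MDifferentiableAt 𝓘(ℝ, F) 𝓘(ℝ, E) (fun y' ↦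
      (trivializationAt E (TangentSpace 𝓘(ℝ, E)) (C.i y)
        (⟨C.i y', s y'⟩ : TangentBundle 𝓘(ℝ, E) X)).2) y := by
  rw [DiffAlongAt, mdifferentiableAt_totalSpace]
  exact and_iff_right (mdifferentiableAt_i C y)

theorem smoothAlongAt_iff {s : ∀ y : Y, TangentSpace 𝓘(ℝ, E) (C.i y)} {y : Y} :
    SmoothAlongAt C s y ↔ ContMDiffAt 𝓘(ℝ, F) 𝓘(ℝ, E) ∞ (fun y' ↦
      (trivializationAt E (TangentSpace 𝓘(ℝ, E)) (C.i y)
        (⟨C.i y', s y'⟩ : TangentBundle 𝓘(ℝ, E) X)).2) y := by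
  rw [SmoothAlongAt, Bundle.contMDiffAt_totalSpace]
  exact and_iff_right (contMDiff_i C).contMDiffAt

theorem SmoothAlongAt.diffAlongAt {s : ∀ y : Y, TangentSpace 𝓘(ℝ, E) (C.i y)} {y : Y}
    (h : SmoothAlongAt C s y) : DiffAlongAt C s y :=
  ContMDiffAt.mdifferentiableAt h (by simp)

theorem SmoothAlongAt.congr {s s' : ∀ y : Y, TangentSpace 𝓘(ℝ, E) (C.i y)} {y : Y}
    (hs : SmoothAlongAt C s y) (h : ∀ᶠ y' in 𝓝 y, s y' = s' y') : SmoothAlongAt C s' y := by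
  refine ContMDiffAt.congr_of_eventuallyEq hs ?_
  filter_upwards [h] with y' h
  rw [h]

theorem SmoothAlongAt.add {s s' : ∀ y : Y, TangentSpace 𝓘(ℝ, E) (C.i y)} {y : Y}
    (hs : SmoothAlongAt C s y) (hs' : SmoothAlongAt C s' y) :
    SmoothAlongAt C (fun y ↦ s y + s' y) y := by
  rw [smoothAlongAt_iff] at *
  refine (ContMDiffAt.add hs hs').congr_of_eventuallyEq ?_
  filter_upwards [eventually_mem_baseSet C y] with y' h
  exact trivializationAt_snd_add _ h _ _

theorem SmoothAlongAt.smul {f : Y → ℝ} {s : ∀ y : Y, TangentSpace 𝓘(ℝ, E) (C.i y)} {y : Y}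
    (hf : ContMDiffAt 𝓘(ℝ, F) 𝓘(ℝ, ℝ) ∞ f y) (hs : SmoothAlongAt C s y) :
    SmoothAlongAt C (fun y ↦ f y • s y) y := by
  rw [smoothAlongAt_iff] at *
  refine (ContMDiffAt.smul hf hs).congr_of_eventuallyEq ?_
  filter_upwards [eventually_mem_baseSet C y] with y' h
  exact trivializationAt_snd_smul _ h _ _

theorem DiffAlongAt.add {s s' : ∀ y : Y, TangentSpace 𝓘(ℝ, E) (C.i y)} {y : Y}
    (hs : DiffAlongAt C s y) (hs' : DiffAlongAt C s' y) :
    DiffAlongAt C (fun y ↦ s y + s' y) y := by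
  rw [diffAlongAt_iff] at *
  refine (MDifferentiableAt.add hs hs').congr_of_eventuallyEq ?_
  filter_upwards [eventually_mem_baseSet C y] with y' h
  exact trivializationAt_snd_add _ h _ _

theorem DiffAlongAt.smul {f : Y → ℝ} {s : ∀ y : Y, TangentSpace 𝓘(ℝ, E) (C.i y)} {y : Y}
    (hf : MDifferentiableAt 𝓘(ℝ, F) 𝓘(ℝ, ℝ) f y) (hs : DiffAlongAt C s y) :
    DiffAlongAt C (fun y ↦ f y • s y) y := by
  rw [diffAlongAt_iff] at *
  refine (MDifferentiableAt.smul hf hs).congr_of_eventuallyEq ?_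
  filter_upwards [eventually_mem_baseSet C y] with y' h
  exact trivializationAt_snd_smul _ h _ _

theorem smoothAlongAt_zero (y : Y) : SmoothAlongAt C (fun _ ↦ 0) y := by
  have h := Bundle.contMDiff_zeroSection ℝ (F := E) (IB := 𝓘(ℝ, E)) (n := ∞)
    (TangentSpace 𝓘(ℝ, E) : X → Type _)
  exact h.contMDiffAt.comp y (contMDiff_i C).contMDiffAt

theorem SmoothAlongAt.sum {ι : Type*} {t : Finset ι}
    {s : ι → ∀ y : Y, TangentSpace 𝓘(ℝ, E) (C.i y)} {y : Y}
    (hs : ∀ j ∈ t, SmoothAlongAt C (s j) y) : SmoothAlongAt C (fun y ↦ ∑ j ∈ t, s j y) y := by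
  classical
  induction t using Finset.induction_on with
  | empty => simpa using smoothAlongAt_zero y
  | insert a t ha ih =>
    simp only [Finset.sum_insert ha]
    exact (hs a (by simp)).add (ih fun j hj ↦ hs j (by simp [hj]))

theorem DiffAlongAt.sum {ι : Type*} {t : Finset ι}
    {s : ι → ∀ y : Y, TangentSpace 𝓘(ℝ, E) (C.i y)} {y : Y}
    (hs : ∀ j ∈ t, DiffAlongAt C (s j) y) : DiffAlongAt C (fun y ↦ ∑ j ∈ t, s j y) y := by
  classical
  induction t using Finset.induction_on with
  | empty => simpa using (smoothAlongAt_zero y).diffAlongAt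
  | insert a t ha ih =>
    simp only [Finset.sum_insert ha]
    exact (hs a (by simp)).add (ih fun j hj ↦ hs j (by simp [hj]))

theorem smoothAlongAt_comp {Z : ∀ x : X, TangentSpace 𝓘(ℝ, E) x} {y : Y}
    (hZ : ContMDiffAt 𝓘(ℝ, E) (𝓘(ℝ, E).prod 𝓘(ℝ, E)) ∞
      (fun x ↦ (⟨x, Z x⟩ : TangentBundle 𝓘(ℝ, E) X)) (C.i y)) :
    SmoothAlongAt C (fun y ↦ Z (C.i y)) y :=
  ContMDiffAt.comp y hZ (contMDiff_i C).contMDiffAt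

theorem smoothAlongAt_di {V : ∀ y : Y, TangentSpace 𝓘(ℝ, F) y} {y : Y}
    (hV : ContMDiffAt 𝓘(ℝ, F) (𝓘(ℝ, F).prod 𝓘(ℝ, F)) ∞
      (fun y ↦ (⟨y, V y⟩ : TangentBundle 𝓘(ℝ, F) Y)) y) :
    SmoothAlongAt C (fun y ↦ di C y (V y)) y :=
  contMDiffAt_mfderiv_apply (contMDiff_i C).contMDiffAt hV

theorem SmoothAlongAt.om {s s' : ∀ y : Y, TangentSpace 𝓘(ℝ, E) (C.i y)} {y : Y}
    (hs : SmoothAlongAt C s y) (hs' : SmoothAlongAt C s' y) :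
    ContMDiffAt 𝓘(ℝ, F) 𝓘(ℝ, ℝ) ∞ (fun y ↦ K.om (C.i y) (s y) (s' y)) y := by
  have h := ContMDiffAt.clm_bundle_apply₂ (E₁ := (TangentSpace 𝓘(ℝ, E) : X → Type _))
    (E₂ := (TangentSpace 𝓘(ℝ, E) : X → Type _)) (E₃ := Bundle.Trivial X ℝ)
    (b := C.i) (ψ := fun y ↦ K.om (C.i y)) (n := ∞) (IM := 𝓘(ℝ, F)) (IB := 𝓘(ℝ, E))
    ((K.smooth_om.contMDiffAt (x := C.i y)).comp y (contMDiff_i C).contMDiffAt) hs hs'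
  rw [Bundle.contMDiffAt_totalSpace] at h
  exact h.2

theorem SmoothAlongAt.J {s : ∀ y : Y, TangentSpace 𝓘(ℝ, E) (C.i y)} {y : Y}
    (hs : SmoothAlongAt C s y) : SmoothAlongAt C (fun y ↦ K.J (C.i y) (s y)) y :=
  ContMDiffAt.clm_bundle_apply (E₁ := (TangentSpace 𝓘(ℝ, E) : X → Type _))
    (E₂ := (TangentSpace 𝓘(ℝ, E) : X → Type _))
    (b := C.i) (ϕ := fun y ↦ K.J (C.i y)) (n := ∞) (IM := 𝓘(ℝ, F)) (IB := 𝓘(ℝ, E))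
    ((K.smooth_J.contMDiffAt (x := C.i y)).comp y (contMDiff_i C).contMDiffAt) hs

/-- Near `i(y)` there is a frame of `TX`, made of global vector fields, in which a section of
`i^*TX` has coefficients as smooth as the section. -/
theorem exists_expansion [T2Space X] (C : CoisotropicEmbedding F Y K) (y : Y) :
    ∃ (n : ℕ) (Z : Fin n → ∀ x : X, TangentSpace 𝓘(ℝ, E) x),
      (∀ j, ContMDiff 𝓘(ℝ, E) (𝓘(ℝ, E).prod 𝓘(ℝ, E)) ∞
        (fun x ↦ (⟨x, Z j x⟩ : TangentBundle 𝓘(ℝ, E) X))) ∧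
      ∀ s : ∀ y : Y, TangentSpace 𝓘(ℝ, E) (C.i y), ∃ c : Fin n → Y → ℝ,
        (∀ᶠ y' in 𝓝 y, s y' = ∑ j, c j y' • Z j (C.i y')) ∧
        (DiffAlongAt C s y → ∀ j, MDifferentiableAt 𝓘(ℝ, F) 𝓘(ℝ, ℝ) (c j) y) ∧
        (SmoothAlongAt C s y → ∀ j, ContMDiffAt 𝓘(ℝ, F) 𝓘(ℝ, ℝ) ∞ (c j) y) := by
  let b := Module.finBasis ℝ E
  let t := trivializationAt E (TangentSpace 𝓘(ℝ, E)) (C.i y)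
  have hx : C.i y ∈ t.baseSet := FiberBundle.mem_baseSet_trivializationAt E (TangentSpace 𝓘(ℝ, E)) _
  -- the cut-off function makes the coordinate frame global
  let ψ : SmoothBumpFunction 𝓘(ℝ, E) (C.i y) := Classical.arbitrary _
  have hψ : tsupport ψ ⊆ t.baseSet := ψ.tsupport_subset_chartAt_source
  refine ⟨_, fun j ↦ (ψ : X → ℝ) • t.localFrame b j, fun j ↦ ContMDiffOn.smul_section_of_tsupport
    ψ.contMDiff.contMDiffOn t.open_baseSet hψ (t.contMDiffOn_localFrame_baseSet ∞ b j), fun s ↦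
    ⟨fun j y' ↦ b.coord j (t (⟨C.i y', s y'⟩ : TangentBundle 𝓘(ℝ, E) X)).2, ?_, fun hs j ↦ ?_,
      fun hs j ↦ ?_⟩⟩
  · filter_upwards [eventually_mem_baseSet C y, (contMDiff_i C).continuous.continuousAt.eventually
      ψ.eventuallyEq_one] with y' hy' hψ
    have h1 : (t.continuousLinearMapAt ℝ (C.i y')) (s y') =
        (t (⟨C.i y', s y'⟩ : TangentBundle 𝓘(ℝ, E) X)).2 := by
      rw [Bundle.Trivialization.continuousLinearMapAt_apply,
        Bundle.Trivialization.linearMapAt_apply, if_pos hy']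
    have h2 : t.symmL ℝ (C.i y') (t (⟨C.i y', s y'⟩ : TangentBundle 𝓘(ℝ, E) X)).2 = s y' := by
      rw [← h1, Bundle.Trivialization.symmL_continuousLinearMapAt _ hy']
    conv_lhs => rw [← h2, ← b.sum_repr (t (⟨C.i y', s y'⟩ : TangentBundle 𝓘(ℝ, E) X)).2, map_sum]
    refine Finset.sum_congr rfl fun j _ ↦ ?_
    rw [map_smul, Pi.smul_apply', hψ, Pi.one_apply, one_smul,
      Bundle.Trivialization.localFrame_apply_of_mem_baseSet _ _ hy',
      Bundle.Trivialization.basisAt, Module.Basis.map_apply, Bundle.Trivialization.symmL_apply _ hy']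
    rfl
  · have := diffAlongAt_iff.1 hs
    exact ((b.coord j).toContinuousLinearMap.differentiableAt.mdifferentiableAt).comp y this
  · have := smoothAlongAt_iff.1 hs
    exact ((b.coord j).toContinuousLinearMap.contDiff.contDiffAt.contMDiffAt).comp y this

end Calculus

/-! ### The pulled back connection -/

section

variable {E : Type*} [NormedAddCommGroup E] [NormedSpace ℝ E] [FiniteDimensional ℝ E]
  [CompleteSpace E]
  {X : Type*} [TopologicalSpace X] [ChartedSpace E X] [IsManifold 𝓘(ℝ, E) ∞ X]
  {F : Type*} [NormedAddCommGroup F] [NormedSpace ℝ F] [FiniteDimensional ℝ F]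
  {Y : Type*} [TopologicalSpace Y] [ChartedSpace F Y] [IsManifold 𝓘(ℝ, F) ∞ Y]
  {G : Type*} [NormedAddCommGroup G] [NormedSpace ℝ G]
  {K : KaehlerStructure E X} (C : CoisotropicEmbedding F Y K)

theorem pullConn_congr {s s' : ∀ y : Y, TangentSpace 𝓘(ℝ, E) (C.i y)} {y : Y}
    (h : ∀ᶠ y' in 𝓝 y, s y' = s' y') : pullConn C s y = pullConn C s' y := by
  have h1 : (fun y' ↦ (trivializationAt E (TangentSpace 𝓘(ℝ, E)) (C.i y)
      (⟨C.i y', s y'⟩ : TangentBundle 𝓘(ℝ, E) X)).2) =ᶠ[𝓝 y] fun y' ↦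
      (trivializationAt E (TangentSpace 𝓘(ℝ, E)) (C.i y)
      (⟨C.i y', s' y'⟩ : TangentBundle 𝓘(ℝ, E) X)).2 := by
    filter_upwards [h] with y' h
    rw [h]
  simp only [pullConn, mvfderiv_congr h1, h.self_of_nhds]

theorem pullConn_apply (s : ∀ y : Y, TangentSpace 𝓘(ℝ, E) (C.i y)) (y : Y)
    (v : TangentSpace 𝓘(ℝ, F) y) : pullConn C s y v =
    (trivializationAt E (TangentSpace 𝓘(ℝ, E)) (C.i y)).symmL ℝ (C.i y)
      (mvfderiv 𝓘(ℝ, F) (fun y' ↦ (trivializationAt E (TangentSpace 𝓘(ℝ, E)) (C.i y)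
          (⟨C.i y', s y'⟩ : TangentBundle 𝓘(ℝ, E) X)).2) y v) +
    K.conn (FiberBundle.extend E (s y)) (C.i y) (di C y v) := rfl

variable {C} [T2Space X]

theorem pullConn_add {s s' : ∀ y : Y, TangentSpace 𝓘(ℝ, E) (C.i y)} {y : Y}
    (hs : DiffAlongAt C s y) (hs' : DiffAlongAt C s' y) (v : TangentSpace 𝓘(ℝ, F) y) :
    pullConn C (fun y ↦ s y + s' y) y v = pullConn C s y v + pullConn C s' y v := by
  have h1 : (fun y' ↦ (trivializationAt E (TangentSpace 𝓘(ℝ, E)) (C.i y)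
      (⟨C.i y', s y' + s' y'⟩ : TangentBundle 𝓘(ℝ, E) X)).2) =ᶠ[𝓝 y] fun y' ↦
      (trivializationAt E (TangentSpace 𝓘(ℝ, E)) (C.i y)
      (⟨C.i y', s y'⟩ : TangentBundle 𝓘(ℝ, E) X)).2 +
      (trivializationAt E (TangentSpace 𝓘(ℝ, E)) (C.i y)
      (⟨C.i y', s' y'⟩ : TangentBundle 𝓘(ℝ, E) X)).2 := by
    filter_upwards [eventually_mem_baseSet C y] with y' h
    exact trivializationAt_snd_add _ h _ _
  have h2 := FiberBundle.mdifferentiableAt_extend 𝓘(ℝ, E) E (s y)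
  have h3 := FiberBundle.mdifferentiableAt_extend 𝓘(ℝ, E) E (s' y)
  have h4 : K.conn (FiberBundle.extend E (s y + s' y)) (C.i y) =
      K.conn (FiberBundle.extend E (s y)) (C.i y) + K.conn (FiberBundle.extend E (s' y)) (C.i y) := by
    rw [← K.conn.isCovariantDerivativeOnUniv.add h2 h3]
    exact K.conn.isCovariantDerivativeOnUniv.congr_of_eventuallyEq
      (FiberBundle.mdifferentiableAt_extend 𝓘(ℝ, E) E _) (mdifferentiableAt_add_section h2 h3)
      Filter.univ_mem (extend_add _ _ _)
  rw [pullConn_apply, pullConn_apply, pullConn_apply, mvfderiv_congr h1, h4,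
    mvfderiv_fun_add (diffAlongAt_iff.1 hs) (diffAlongAt_iff.1 hs')]
  simp only [add_apply, map_add]
  abel

theorem pullConn_smul {f : Y → ℝ} {s : ∀ y : Y, TangentSpace 𝓘(ℝ, E) (C.i y)} {y : Y}
    (hf : MDifferentiableAt 𝓘(ℝ, F) 𝓘(ℝ, ℝ) f y)
    (hs : DiffAlongAt C s y) (v : TangentSpace 𝓘(ℝ, F) y) :
    pullConn C (fun y ↦ f y • s y) y v =
      mvfderiv 𝓘(ℝ, F) f y v • s y + f y • pullConn C s y v := by
  have h1 : (fun y' ↦ (trivializationAt E (TangentSpace 𝓘(ℝ, E)) (C.i y)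
      (⟨C.i y', f y' • s y'⟩ : TangentBundle 𝓘(ℝ, E) X)).2) =ᶠ[𝓝 y] fun y' ↦
      f y' • (trivializationAt E (TangentSpace 𝓘(ℝ, E)) (C.i y)
      (⟨C.i y', s y'⟩ : TangentBundle 𝓘(ℝ, E) X)).2 := by
    filter_upwards [eventually_mem_baseSet C y] with y' h
    exact trivializationAt_snd_smul _ h _ _
  have h2 := FiberBundle.mdifferentiableAt_extend 𝓘(ℝ, E) E (s y)
  have h4 : K.conn (FiberBundle.extend E (f y • s y)) (C.i y) =
      f y • K.conn (FiberBundle.extend E (s y)) (C.i y) := by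
    rw [← K.conn.isCovariantDerivativeOnUniv.smul_const (f y) h2]
    exact K.conn.isCovariantDerivativeOnUniv.congr_of_eventuallyEq
      (FiberBundle.mdifferentiableAt_extend 𝓘(ℝ, E) E _) (h2.smul_const_section)
      Filter.univ_mem (extend_smul _ _ _)
  rw [pullConn_apply, pullConn_apply, mvfderiv_congr h1, h4,
    mvfderiv_fun_smul hf (diffAlongAt_iff.1 hs)]
  simp only [add_apply, smul_apply, map_add, map_smul, ContinuousLinearMap.smulRight_apply,
    symmL_trivializationAt_snd]
  module

/-- On restrictions of vector fields of `X`, the pulled back connection is the connection of `X`. -/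
theorem pullConn_comp {Z : ∀ x : X, TangentSpace 𝓘(ℝ, E) x} {y : Y}
    (hZ : MDifferentiableAt 𝓘(ℝ, E) (𝓘(ℝ, E).prod 𝓘(ℝ, E))
      (fun x ↦ (⟨x, Z x⟩ : TangentBundle 𝓘(ℝ, E) X)) (C.i y)) (v : TangentSpace 𝓘(ℝ, F) y) :
    pullConn C (fun y ↦ Z (C.i y)) y v = K.conn Z (C.i y) (di C y v) := by
  rw [conn_eq_coord K hZ, pullConn_apply]
  congr 2
  exact mvfderiv_comp_apply' (mdifferentiableAt_trivializationAt_snd hZ) (mdifferentiableAt_i C y) v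

theorem pullConn_zero (y : Y) (v : TangentSpace 𝓘(ℝ, F) y) : pullConn C (fun _ ↦ 0) y v = 0 := by
  have h := pullConn_smul (f := fun _ ↦ (0 : ℝ)) (s := fun _ ↦ 0) mdifferentiableAt_const
    (smoothAlongAt_zero (C := C) y).diffAlongAt v
  simpa using h

theorem pullConn_sum {ι : Type*} (t : Finset ι)
    {s : ι → ∀ y : Y, TangentSpace 𝓘(ℝ, E) (C.i y)} {y : Y}
    (hs : ∀ j ∈ t, DiffAlongAt C (s j) y) (v : TangentSpace 𝓘(ℝ, F) y) :
    pullConn C (fun y ↦ ∑ j ∈ t, s j y) y v = ∑ j ∈ t, pullConn C (s j) y v := by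
  classical
  induction t using Finset.induction_on with
  | empty => simpa using pullConn_zero y v
  | insert a t ha ih =>
    simp only [Finset.sum_insert ha]
    rw [← ih fun j hj ↦ hs j (by simp [hj])]
    exact pullConn_add (hs a (by simp)) (DiffAlongAt.sum fun j hj ↦ hs j (by simp [hj])) v

/-- Induction principle for sections of `i^*TX`: locally they are
combinations, with functions on `Y` as coefficients, of restrictions of vector fields of `X`. -/
theorem along_induction {y : Y} {P : (∀ y : Y, TangentSpace 𝓘(ℝ, E) (C.i y)) → Prop}
    (congr : ∀ s s', (∀ᶠ y' in 𝓝 y, s y' = s' y') → P s → P s')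
    (zero : P fun _ ↦ 0)
    (add : ∀ s s', DiffAlongAt C s y → DiffAlongAt C s' y → P s → P s' → P fun y ↦ s y + s' y)
    (smul : ∀ (f : Y → ℝ) s, MDifferentiableAt 𝓘(ℝ, F) 𝓘(ℝ, ℝ) f y → DiffAlongAt C s y →
      P s → P fun y ↦ f y • s y)
    (comp : ∀ Z : ∀ x : X, TangentSpace 𝓘(ℝ, E) x,
      ContMDiffAt 𝓘(ℝ, E) (𝓘(ℝ, E).prod 𝓘(ℝ, E)) ∞
        (fun x ↦ (⟨x, Z x⟩ : TangentBundle 𝓘(ℝ, E) X)) (C.i y) → P fun y ↦ Z (C.i y))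
    {s : ∀ y : Y, TangentSpace 𝓘(ℝ, E) (C.i y)} (hs : DiffAlongAt C s y) : P s := by
  classical
  obtain ⟨n, Z, hZ, h⟩ := exists_expansion C y
  obtain ⟨c, h1, h2, -⟩ := h s
  refine congr _ _ (h1.mono fun y' h ↦ h.symm) ?_
  have key : ∀ t : Finset (Fin n), DiffAlongAt C (fun y' ↦ ∑ j ∈ t, c j y' • Z j (C.i y')) y ∧
      P fun y' ↦ ∑ j ∈ t, c j y' • Z j (C.i y') := by
    intro t
    induction t using Finset.induction_on with
    | empty => simpa using ⟨(smoothAlongAt_zero (C := C) y).diffAlongAt, zero⟩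
    | insert a t ha ih =>
      simp only [Finset.sum_insert ha]
      have ha := (smoothAlongAt_comp (C := C) (y := y) (hZ a).contMDiffAt).diffAlongAt
      exact ⟨(ha.smul (h2 hs a)).add ih.1, add _ _ (ha.smul (h2 hs a)) ih.1
        (smul _ _ (h2 hs a) ha (comp _ (hZ a).contMDiffAt)) ih.2⟩
  exact (key Finset.univ).2

theorem DiffAlongAt.om {s s' : ∀ y : Y, TangentSpace 𝓘(ℝ, E) (C.i y)} {y : Y}
    (hs : DiffAlongAt C s y) (hs' : DiffAlongAt C s' y) :
    MDifferentiableAt 𝓘(ℝ, F) 𝓘(ℝ, ℝ) (fun y ↦ K.om (C.i y) (s y) (s' y)) y := by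
  have h := MDifferentiableAt.clm_bundle_apply₂ (E₁ := (TangentSpace 𝓘(ℝ, E) : X → Type _))
    (E₂ := (TangentSpace 𝓘(ℝ, E) : X → Type _)) (E₃ := Bundle.Trivial X ℝ)
    (b := C.i) (ψ := fun y ↦ K.om (C.i y)) (IM := 𝓘(ℝ, F)) (IB := 𝓘(ℝ, E))
    (((K.smooth_om.contMDiffAt (x := C.i y)).comp y
      (contMDiff_i C).contMDiffAt).mdifferentiableAt (by simp)) hs hs'
  rw [mdifferentiableAt_totalSpace] at h
  exact h.2

theorem DiffAlongAt.J {s : ∀ y : Y, TangentSpace 𝓘(ℝ, E) (C.i y)} {y : Y}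
    (hs : DiffAlongAt C s y) : DiffAlongAt C (fun y ↦ K.J (C.i y) (s y)) y :=
  MDifferentiableAt.clm_bundle_apply (E₁ := (TangentSpace 𝓘(ℝ, E) : X → Type _))
    (E₂ := (TangentSpace 𝓘(ℝ, E) : X → Type _))
    (b := C.i) (ϕ := fun y ↦ K.J (C.i y)) (IM := 𝓘(ℝ, F)) (IB := 𝓘(ℝ, E))
    (((K.smooth_J.contMDiffAt (x := C.i y)).comp y
      (contMDiff_i C).contMDiffAt).mdifferentiableAt (by simp)) hs

/-- The pulled back connection preserves `ω`. -/
theorem mvfderiv_om {s s' : ∀ y : Y, TangentSpace 𝓘(ℝ, E) (C.i y)} {y : Y}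
    (hs : DiffAlongAt C s y) (hs' : DiffAlongAt C s' y) (v : TangentSpace 𝓘(ℝ, F) y) :
    mvfderiv 𝓘(ℝ, F) (fun y ↦ K.om (C.i y) (s y) (s' y)) y v =
      K.om (C.i y) (pullConn C s y v) (s' y) + K.om (C.i y) (s y) (pullConn C s' y v) := by
  have h0 : mvfderiv 𝓘(ℝ, F) (fun _ : Y ↦ (0 : ℝ)) y v = 0 := by
    rw [mvfderiv_const]; rfl
  refine along_induction (P := fun s ↦ ∀ s', DiffAlongAt C s' y →
    mvfderiv 𝓘(ℝ, F) (fun y ↦ K.om (C.i y) (s y) (s' y)) y v =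
      K.om (C.i y) (pullConn C s y v) (s' y) + K.om (C.i y) (s y) (pullConn C s' y v))
    ?_ ?_ ?_ ?_ ?_ hs s' hs'
  · intro s t h hs s' hs'
    rw [← pullConn_congr C h, ← h.self_of_nhds, ← hs s' hs',
      mvfderiv_congr (f' := fun y ↦ K.om (C.i y) (s y) (s' y)) (h.mono fun y' h ↦ by simp only [h])]
  · intro s' hs'
    simpa [pullConn_zero] using h0
  · intro s t hs ht h1 h2 s' hs'
    rw [pullConn_add hs ht]
    simp only [map_add, add_apply]
    rw [mvfderiv_fun_add (hs.om hs') (ht.om hs'), add_apply, h1 s' hs', h2 s' hs']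
    abel
  · intro f s hf hs h1 s' hs'
    rw [pullConn_smul hf hs]
    simp only [map_smul, map_add, add_apply, smul_apply]
    rw [mvfderiv_fun_smul hf (hs.om hs')]
    simp only [add_apply, smul_apply, ContinuousLinearMap.smulRight_apply]
    rw [h1 s' hs']
    simp only [smul_eq_mul]
    ring
  · intro Z hZ s' hs'
    have hZ' := smoothAlongAt_comp (C := C) hZ
    refine along_induction (P := fun s' ↦
      mvfderiv 𝓘(ℝ, F) (fun y ↦ K.om (C.i y) (Z (C.i y)) (s' y)) y v =
        K.om (C.i y) (pullConn C (fun y ↦ Z (C.i y)) y v) (s' y) +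
          K.om (C.i y) (Z (C.i y)) (pullConn C s' y v)) ?_ ?_ ?_ ?_ ?_ hs'
    · intro s t h hs
      rw [← pullConn_congr C h, ← h.self_of_nhds, ← hs,
        mvfderiv_congr (f' := fun y ↦ K.om (C.i y) (Z (C.i y)) (s y)) (h.mono fun y' h ↦ by simp only [h])]
    · simpa [pullConn_zero] using h0
    · intro s t hs ht h1 h2
      rw [pullConn_add hs ht]
      simp only [map_add]
      rw [mvfderiv_fun_add (hZ'.diffAlongAt.om hs) (hZ'.diffAlongAt.om ht), add_apply, h1, h2]
      abel
    · intro f s hf hs h1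
      rw [pullConn_smul hf hs]
      simp only [map_smul, map_add]
      rw [mvfderiv_fun_smul hf (hZ'.diffAlongAt.om hs)]
      simp only [add_apply, smul_apply, ContinuousLinearMap.smulRight_apply]
      rw [h1]
      simp only [smul_eq_mul]
      ring
    · intro Z' hZ'
      have h1 := hZ.mdifferentiableAt (by simp)
      have h2 := hZ'.mdifferentiableAt (by simp)
      rw [pullConn_comp h1, pullConn_comp h2, ← K.parallel_om Z Z' (C.i y) (di C y v) h1 h2]
      have h3 : MDifferentiableAt 𝓘(ℝ, E) 𝓘(ℝ, ℝ) (fun x ↦ K.om x (Z x) (Z' x)) (C.i y) := by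
        have h := MDifferentiableAt.clm_bundle_apply₂ (E₁ := (TangentSpace 𝓘(ℝ, E) : X → Type _))
          (E₂ := (TangentSpace 𝓘(ℝ, E) : X → Type _)) (E₃ := Bundle.Trivial X ℝ)
          (b := id) (ψ := fun y ↦ K.om y) (IM := 𝓘(ℝ, E)) (IB := 𝓘(ℝ, E))
          ((K.smooth_om.contMDiffAt (x := C.i y)).mdifferentiableAt (by simp)) h1 h2
        rw [mdifferentiableAt_totalSpace] at h
        exact h.2
      exact mvfderiv_comp_apply' h3 (mdifferentiableAt_i C y) v

/-- The pulled back connection commutes with `J`. -/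
theorem pullConn_J {s : ∀ y : Y, TangentSpace 𝓘(ℝ, E) (C.i y)} {y : Y}
    (hs : DiffAlongAt C s y) (v : TangentSpace 𝓘(ℝ, F) y) :
    pullConn C (fun y ↦ K.J (C.i y) (s y)) y v = K.J (C.i y) (pullConn C s y v) := by
  refine along_induction (P := fun s ↦
    pullConn C (fun y ↦ K.J (C.i y) (s y)) y v = K.J (C.i y) (pullConn C s y v))
    ?_ ?_ ?_ ?_ ?_ hs
  · intro s t h hs
    rw [← pullConn_congr C h, ← hs,
      pullConn_congr C (s' := fun y ↦ K.J (C.i y) (s y)) (h.mono fun y' h ↦ by rw [h])]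
  · simp [pullConn_zero]
  · intro s t hs ht h1 h2
    simp only [map_add]
    rw [pullConn_add hs ht, pullConn_add hs.J ht.J, h1, h2, map_add]
  · intro f s hf hs h1
    simp only [map_smul]
    rw [pullConn_smul hf hs, pullConn_smul hf hs.J, h1]
    simp only [map_add, map_smul]
  · intro Z hZ
    have h1 := hZ.mdifferentiableAt (by simp)
    have h2 : MDifferentiableAt 𝓘(ℝ, E) (𝓘(ℝ, E).prod 𝓘(ℝ, E))
      (fun x ↦ (⟨x, K.J x (Z x)⟩ : TangentBundle 𝓘(ℝ, E) X)) (C.i y) :=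
      MDifferentiableAt.clm_bundle_apply (E₁ := (TangentSpace 𝓘(ℝ, E) : X → Type _))
        (E₂ := (TangentSpace 𝓘(ℝ, E) : X → Type _))
        (b := id) (ϕ := fun y ↦ K.J y) (IM := 𝓘(ℝ, E)) (IB := 𝓘(ℝ, E))
        ((K.smooth_J.contMDiffAt (x := C.i y)).mdifferentiableAt (by simp)) h1
    rw [pullConn_comp h1, pullConn_comp (Z := fun x ↦ K.J x (Z x)) h2, K.parallel_J _ _ _ h1]

theorem SmoothAlongAt.pullConn {s : ∀ y : Y, TangentSpace 𝓘(ℝ, E) (C.i y)} {y : Y}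
    (hs : SmoothAlongAt C s y) {V : ∀ y : Y, TangentSpace 𝓘(ℝ, F) y}
    (hV : ContMDiffAt 𝓘(ℝ, F) (𝓘(ℝ, F).prod 𝓘(ℝ, F)) ∞
      (fun y ↦ (⟨y, V y⟩ : TangentBundle 𝓘(ℝ, F) Y)) y) :
    SmoothAlongAt C (fun y ↦ pullConn C s y (V y)) y := by
  obtain ⟨n, Z, hZ, h⟩ := exists_expansion C y
  obtain ⟨c, h1, -, h2⟩ := h s
  have h3 : ∀ᶠ y' in 𝓝 y, ∀ j, MDifferentiableAt 𝓘(ℝ, F) 𝓘(ℝ, ℝ) (c j) y' := by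
    rw [Filter.eventually_all]
    intro j
    have := (contMDiffAt_iff_contMDiffAt_nhds (n := 1) (by simp)).1
      (ContMDiffAt.of_le (h2 hs j) (m := 1) (by norm_cast))
    filter_upwards [this] with y' h' using h'.mdifferentiableAt (by simp)
  have hZd (j) (y' : Y) := (smoothAlongAt_comp (C := C) (y := y') (hZ j).contMDiffAt).diffAlongAt
  have key : ∀ᶠ y' in 𝓝 y, ∑ j, (mvfderiv 𝓘(ℝ, F) (c j) y' (V y') • Z j (C.i y') +
      c j y' • K.conn (Z j) (C.i y') (di C y' (V y'))) = CoisotropicKaehler.pullConn C s y' (V y') := by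
    filter_upwards [h1.eventually_nhds, h3] with y' h1 h3
    rw [pullConn_congr C h1, pullConn_sum _ fun j _ ↦ (hZd j y').smul (h3 j)]
    refine Finset.sum_congr rfl fun j _ ↦ ?_
    rw [pullConn_smul (h3 j) (hZd j y'), pullConn_comp ((hZ j).mdifferentiableAt (by simp))]
  refine SmoothAlongAt.congr (.sum fun j _ ↦ .add (.smul ?_ ?_) (.smul (h2 hs j) ?_)) key
  · exact contMDiffAt_mvfderiv_apply (h2 hs j) hV
  · exact smoothAlongAt_comp (hZ j).contMDiffAt
  · have h4 := (K.smooth_conn.contMDiff.contMDiff (hZ j).contMDiffOn).contMDiffAt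
      (x := C.i y) Filter.univ_mem
    exact ContMDiffAt.clm_bundle_apply (E₁ := (TangentSpace 𝓘(ℝ, E) : X → Type _))
      (E₂ := (TangentSpace 𝓘(ℝ, E) : X → Type _))
      (b := C.i) (ϕ := fun y ↦ K.conn (Z j) (C.i y)) (n := ∞) (IM := 𝓘(ℝ, F)) (IB := 𝓘(ℝ, E))
      (h4.comp y (contMDiff_i C).contMDiffAt) (smoothAlongAt_di hV)

end

section

variable {E : Type*} [NormedAddCommGroup E] [NormedSpace ℝ E] [FiniteDimensional ℝ E]
  [CompleteSpace E]
  {X : Type*} [TopologicalSpace X] [ChartedSpace E X] [IsManifold 𝓘(ℝ, E) ∞ X]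
  {F : Type*} [NormedAddCommGroup F] [NormedSpace ℝ F] [FiniteDimensional ℝ F]
  {Y : Type*} [TopologicalSpace Y] [ChartedSpace F Y] [IsManifold 𝓘(ℝ, F) ∞ Y]
  {G : Type*} [NormedAddCommGroup G] [NormedSpace ℝ G]
  {K : KaehlerStructure E X} {C : CoisotropicEmbedding F Y K}

/-! ### Torsion along `Y` -/

theorem contMDiffAt_extChartAt_self (x : X) :
    ContMDiffAt 𝓘(ℝ, E) 𝓘(ℝ, E) ∞ (extChartAt 𝓘(ℝ, E) x) x := contMDiffAt_extChartAt

theorem trivializationAt_snd_eq_mvfderiv {x x' : X} (hx : x' ∈ (chartAt E x).source)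
    (v : TangentSpace 𝓘(ℝ, E) x') :
    (trivializationAt E (TangentSpace 𝓘(ℝ, E)) x (⟨x', v⟩ : TangentBundle 𝓘(ℝ, E) X)).2 =
      mvfderiv 𝓘(ℝ, E) (extChartAt 𝓘(ℝ, E) x) x' v := by
  have h := TangentBundle.continuousLinearMapAt_trivializationAt (I := 𝓘(ℝ, E)) hx
  have hb : x' ∈ (trivializationAt E (TangentSpace 𝓘(ℝ, E)) x).baseSet := hx
  have h1 : (trivializationAt E (TangentSpace 𝓘(ℝ, E)) x).continuousLinearMapAt ℝ x' v =
      (trivializationAt E (TangentSpace 𝓘(ℝ, E)) x (⟨x', v⟩ : TangentBundle 𝓘(ℝ, E) X)).2 := by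
    rw [Bundle.Trivialization.continuousLinearMapAt_apply,
      Bundle.Trivialization.linearMapAt_apply, if_pos hb]
  rw [← h1, h]
  rfl

theorem mvfderiv_extChartAt_self (x : X) (v : TangentSpace 𝓘(ℝ, E) x) :
    mvfderiv 𝓘(ℝ, E) (extChartAt 𝓘(ℝ, E) x) x v = v := by
  have h := mfderiv_extChartAt_self (I := 𝓘(ℝ, E)) (x := x)
  exact congrArg (fun A : E →L[ℝ] E ↦ A v) h

/-- Coordinate vector fields commute. -/
theorem mlieBracket_extend (x : X) (v w : TangentSpace 𝓘(ℝ, E) x) :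
    VectorField.mlieBracket 𝓘(ℝ, E) (FiberBundle.extend E v) (FiberBundle.extend E w) x = 0 := by
  have hev (z : TangentSpace 𝓘(ℝ, E) x) :
      (fun x' ↦ mvfderiv 𝓘(ℝ, E) (extChartAt 𝓘(ℝ, E) x) x' (FiberBundle.extend E z x')) =ᶠ[𝓝 x]
      fun _ ↦ (trivializationAt E (TangentSpace 𝓘(ℝ, E)) x (⟨x, z⟩ : TangentBundle 𝓘(ℝ, E) X)).2 := by
    filter_upwards [trivializationAt_snd_extend x z, chart_source_mem_nhds E x] with x' h hx'
    rw [← h, trivializationAt_snd_eq_mvfderiv hx']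
  have h := mvfderiv_mvfderiv_apply_sub (contMDiffAt_extChartAt_self x)
    (FiberBundle.contMDiffAt_extend 𝓘(ℝ, E) E v) (FiberBundle.contMDiffAt_extend 𝓘(ℝ, E) E w)
  rw [mvfderiv_congr (hev v), mvfderiv_congr (hev w), mvfderiv_const, mvfderiv_const,
    mvfderiv_extChartAt_self] at h
  exact h.symm.trans (sub_self (0 : E))

variable (C) in
theorem trivializationAt_snd_di (y : Y) : ∀ᶠ y' in 𝓝 y, ∀ v : TangentSpace 𝓘(ℝ, F) y',
    (trivializationAt E (TangentSpace 𝓘(ℝ, E)) (C.i y)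
      (⟨C.i y', di C y' v⟩ : TangentBundle 𝓘(ℝ, E) X)).2 =
    mvfderiv 𝓘(ℝ, F) (extChartAt 𝓘(ℝ, E) (C.i y) ∘ C.i) y' v := by
  filter_upwards [(contMDiff_i C).continuous.continuousAt.eventually
    (chart_source_mem_nhds E (C.i y))] with y' hy' v
  rw [trivializationAt_snd_eq_mvfderiv hy']
  exact (mvfderiv_comp_apply' (mdifferentiableAt_extChartAt hy') (mdifferentiableAt_i C y') v).symm

theorem contMDiffAt_extChartAt_i (y : Y) :
    ContMDiffAt 𝓘(ℝ, F) 𝓘(ℝ, E) ∞ (extChartAt 𝓘(ℝ, E) (C.i y) ∘ C.i) y :=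
  (contMDiffAt_extChartAt_self (C.i y)).comp y (contMDiff_i C).contMDiffAt

/-- In the chart around `i(y)`, `V(di(W)) - W(di(V)) = di([V, W])`. -/
theorem mvfderiv_di_sub {V W : ∀ y : Y, TangentSpace 𝓘(ℝ, F) y} {y : Y}
    (hV : ContMDiffAt 𝓘(ℝ, F) (𝓘(ℝ, F).prod 𝓘(ℝ, F)) ∞
      (fun y ↦ (⟨y, V y⟩ : TangentBundle 𝓘(ℝ, F) Y)) y)
    (hW : ContMDiffAt 𝓘(ℝ, F) (𝓘(ℝ, F).prod 𝓘(ℝ, F)) ∞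
      (fun y ↦ (⟨y, W y⟩ : TangentBundle 𝓘(ℝ, F) Y)) y) :
    mvfderiv 𝓘(ℝ, F) (fun y' ↦ (trivializationAt E (TangentSpace 𝓘(ℝ, E)) (C.i y)
      (⟨C.i y', di C y' (W y')⟩ : TangentBundle 𝓘(ℝ, E) X)).2) y (V y) -
    mvfderiv 𝓘(ℝ, F) (fun y' ↦ (trivializationAt E (TangentSpace 𝓘(ℝ, E)) (C.i y)
      (⟨C.i y', di C y' (V y')⟩ : TangentBundle 𝓘(ℝ, E) X)).2) y (W y) =
    (trivializationAt E (TangentSpace 𝓘(ℝ, E)) (C.i y)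
      (⟨C.i y, di C y (VectorField.mlieBracket 𝓘(ℝ, F) V W y)⟩ : TangentBundle 𝓘(ℝ, E) X)).2 := by
  have h := trivializationAt_snd_di C y
  rw [h.self_of_nhds, ← mvfderiv_mvfderiv_apply_sub (contMDiffAt_extChartAt_i y) hV hW,
    mvfderiv_congr (h.mono fun y' h ↦ h (V y')), mvfderiv_congr (h.mono fun y' h ↦ h (W y'))]

/-- The pulled back connection has no torsion. -/
theorem pullConn_di_sub {V W : ∀ y : Y, TangentSpace 𝓘(ℝ, F) y} {y : Y}
    (hV : ContMDiffAt 𝓘(ℝ, F) (𝓘(ℝ, F).prod 𝓘(ℝ, F)) ∞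
      (fun y ↦ (⟨y, V y⟩ : TangentBundle 𝓘(ℝ, F) Y)) y)
    (hW : ContMDiffAt 𝓘(ℝ, F) (𝓘(ℝ, F).prod 𝓘(ℝ, F)) ∞
      (fun y ↦ (⟨y, W y⟩ : TangentBundle 𝓘(ℝ, F) Y)) y) :
    pullConn C (fun y ↦ di C y (W y)) y (V y) - pullConn C (fun y ↦ di C y (V y)) y (W y) =
      di C y (VectorField.mlieBracket 𝓘(ℝ, F) V W y) := by
  have ht : K.conn (FiberBundle.extend E (di C y (W y))) (C.i y) (di C y (V y)) =
      K.conn (FiberBundle.extend E (di C y (V y))) (C.i y) (di C y (W y)) := by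
    have h := K.conn.torsion_apply_eq_extend (di C y (V y)) (di C y (W y))
    rw [K.torsion_eq_zero, mlieBracket_extend, sub_zero, FiberBundle.extend_apply_self,
      FiberBundle.extend_apply_self] at h
    exact (sub_eq_zero.1 h.symm)
  rw [pullConn_apply, pullConn_apply, ht, add_sub_add_right_eq_sub, ← map_sub,
    mvfderiv_di_sub hV hW, symmL_trivializationAt_snd]

/-! ### The immersion -/

variable (C) in
/-- An immersion has a smooth local left inverse. -/
theorem exists_leftInverse (y : Y) : ∃ ρ : X → Y, ContMDiffAt 𝓘(ℝ, E) 𝓘(ℝ, F) ∞ ρ (C.i y) ∧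
    ∀ᶠ y' in 𝓝 y, ρ (C.i y') = y' := by
  have h := C.embedding.isImmersion.isImmersionAt y
  have hy := h.mem_domChart_source
  have key : ∀ y' ∈ h.domChart.source,
      h.equiv.symm (h.codChart (C.i y')) = (h.domChart y', 0) := by
    intro y' hy'
    have hm : h.domChart y' ∈ (h.domChart.extend 𝓘(ℝ, F)).target := by
      simpa using h.domChart.map_source hy'
    have h1 := h.writtenInCharts hm
    simp only [Function.comp_apply, OpenPartialHomeomorph.extend_coe, OpenPartialHomeomorph.extend_coe_symm,
      modelWithCornersSelf_coe, modelWithCornersSelf_coe_symm, id_eq] at h1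
    rw [h.domChart.left_inv hy'] at h1
    rw [h1]
    simp
  refine ⟨h.domChart.symm ∘ Prod.fst ∘ h.equiv.symm ∘ h.codChart, ?_, ?_⟩
  · have h2 : ContMDiffAt 𝓘(ℝ, E) 𝓘(ℝ, E) ∞ h.codChart (C.i y) :=
      contMDiffAt_of_mem_maximalAtlas h.codChart_mem_maximalAtlas h.mem_codChart_source
    have h3 : ContMDiffAt 𝓘(ℝ, E) 𝓘(ℝ, F) ∞ (Prod.fst ∘ h.equiv.symm) (h.codChart (C.i y)) :=
      (contDiff_fst.comp h.equiv.symm.contDiff).contMDiff.contMDiffAt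
    have h4 : ContMDiffAt 𝓘(ℝ, F) 𝓘(ℝ, F) ∞ h.domChart.symm
        ((Prod.fst ∘ h.equiv.symm) (h.codChart (C.i y))) := by
      refine contMDiffAt_symm_of_mem_maximalAtlas h.domChart_mem_maximalAtlas ?_
      simp only [Function.comp_apply, key y hy]
      exact h.domChart.map_source hy
    exact h4.comp (C.i y) (h3.comp (C.i y) h2)
  · filter_upwards [h.domChart.open_source.mem_nhds hy] with y' hy'
    simp only [Function.comp_apply, key y' hy']
    exact h.domChart.left_inv hy'

theorem mfderiv_leftInverse_di {ρ : X → Y} {y : Y}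
    (hρ : MDifferentiableAt 𝓘(ℝ, E) 𝓘(ℝ, F) ρ (C.i y)) (h : ∀ᶠ y' in 𝓝 y, ρ (C.i y') = y')
    (v : TangentSpace 𝓘(ℝ, F) y) :
    (mfderiv 𝓘(ℝ, E) 𝓘(ℝ, F) ρ (C.i y) (di C y v) : F) = v := by
  have h0 : ρ ∘ C.i =ᶠ[𝓝 y] id := h
  have h1 : (mfderiv 𝓘(ℝ, F) 𝓘(ℝ, F) (ρ ∘ C.i) y : F →L[ℝ] F) = .id ℝ F :=
    h0.mfderiv_eq.trans mfderiv_id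
  have h2 := mfderiv_comp_apply y hρ (mdifferentiableAt_i C y) v
  exact (Eq.symm h2).trans (congrArg (fun A : F →L[ℝ] F ↦ A v) h1)

variable (C) in
theorem di_injective (y : Y) : Function.Injective (di C y) := by
  obtain ⟨ρ, hρ, h⟩ := exists_leftInverse C y
  have h2 := fun v ↦ mfderiv_leftInverse_di (hρ.mdifferentiableAt (by simp)) h v
  intro v w hvw
  exact (h2 v).symm.trans ((congrArg _ hvw).trans (h2 w))

/-- A vector field on `Y` is smooth if it is smooth as a section of `i^*TX`. -/
theorem contMDiffAt_of_smoothAlongAt_di {V : ∀ y : Y, TangentSpace 𝓘(ℝ, F) y} {y : Y}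
    (hV : SmoothAlongAt C (fun y ↦ di C y (V y)) y) : ContMDiffAt 𝓘(ℝ, F) (𝓘(ℝ, F).prod 𝓘(ℝ, F)) ∞
      (fun y ↦ (⟨y, V y⟩ : TangentBundle 𝓘(ℝ, F) Y)) y := by
  obtain ⟨ρ, hρ, h⟩ := exists_leftInverse C y
  have h1 := (hρ.mfderiv_const (m := ∞) le_rfl).comp y (contMDiff_i C).contMDiffAt
  have h2 : ContMDiffAt 𝓘(ℝ, F) (𝓘(ℝ, F).prod 𝓘(ℝ, F)) ∞
      (fun y' ↦ (⟨ρ (C.i y'), mfderiv 𝓘(ℝ, E) 𝓘(ℝ, F) ρ (C.i y') (di C y' (V y'))⟩ :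
        TangentBundle 𝓘(ℝ, F) Y)) y :=
    ContMDiffAt.clm_apply_of_inCoordinates (b₁ := C.i) (b₂ := ρ ∘ C.i) h1 hV
      (hρ.comp y (contMDiff_i C).contMDiffAt)
  have h3 : ∀ᶠ y' in 𝓝 y, MDifferentiableAt 𝓘(ℝ, E) 𝓘(ℝ, F) ρ (C.i y') := by
    have := (contMDiffAt_iff_contMDiffAt_nhds (n := 1) (by simp)).1
      (hρ.of_le (m := 1) (by norm_cast))
    filter_upwards [(contMDiff_i C).continuous.continuousAt.eventually this] with y' h'
    exact h'.mdifferentiableAt (by simp)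
  refine h2.congr_of_eventuallyEq ?_
  filter_upwards [h3, h.eventually_nhds] with y' h3 h4
  have h5 := mfderiv_leftInverse_di h3 h4 (V y')
  have h6 : ρ (C.i y') = y' := h4.self_of_nhds
  have h7 (z : Y) (hz : z = y') (a b : F) (hab : a = b) :
      (⟨y', a⟩ : TangentBundle 𝓘(ℝ, F) Y) = ⟨z, b⟩ := by subst hz; rw [hab]
  exact h7 _ h6 _ _ h5.symm

end

/-! ### The complexified tangent space -/

section Complexification

variable {V : Type*} [AddCommGroup V] [Module ℝ V]

@[simp]
theorem reV_tmul (c : ℂ) (v : V) : reV (c ⊗ₜ[ℝ] v) = c.re • v := by simp [reV]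

@[simp]
theorem imV_tmul (c : ℂ) (v : V) : imV (c ⊗ₜ[ℝ] v) = c.im • v := by simp [imV]

theorem one_tmul_reV_add (z : ℂ ⊗[ℝ] V) : (1 : ℂ) ⊗ₜ[ℝ] reV z + Complex.I ⊗ₜ[ℝ] imV z = z := by
  induction z using TensorProduct.induction_on with
  | zero => simp
  | add a b ha hb =>
    rw [map_add, map_add, TensorProduct.tmul_add, TensorProduct.tmul_add, add_add_add_comm, ha, hb]
  | tmul c v =>
    rw [reV_tmul, imV_tmul, ← TensorProduct.smul_tmul, ← TensorProduct.smul_tmul,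
      ← TensorProduct.add_tmul]
    congr 1
    apply Complex.ext <;> simp

theorem reV_smul (c : ℂ) (z : ℂ ⊗[ℝ] V) : reV (c • z) = c.re • reV z + (-c.im) • imV z := by
  induction z using TensorProduct.induction_on with
  | zero => simp
  | add a b ha hb => rw [smul_add, map_add, ha, hb, map_add, map_add, smul_add, smul_add]; abel
  | tmul a v =>
    rw [TensorProduct.smul_tmul', reV_tmul, reV_tmul, imV_tmul, smul_smul, smul_smul, ← add_smul]
    simp [sub_eq_add_neg]

theorem imV_smul (c : ℂ) (z : ℂ ⊗[ℝ] V) : imV (c • z) = c.re • imV z + c.im • reV z := by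
  induction z using TensorProduct.induction_on with
  | zero => simp
  | add a b ha hb => rw [smul_add, map_add, ha, hb, map_add, map_add, smul_add, smul_add]; abel
  | tmul a v =>
    rw [TensorProduct.smul_tmul', imV_tmul, reV_tmul, imV_tmul, smul_smul, smul_smul, ← add_smul]
    simp

/-- The extension of a real covector to the complexification is complex-linear. -/
theorem extendCovector_smul (φ : V →ₗ[ℝ] ℝ) (c : ℂ) (z : ℂ ⊗[ℝ] V) :
    extendCovector φ (c • z) = c * extendCovector φ z := by
  simp only [extendCovector, LinearMap.add_apply, LinearMap.smul_apply, LinearMap.comp_apply,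
    reV_smul, imV_smul, map_add, map_smul, smul_eq_mul]
  apply Complex.ext <;> simp <;> ring

theorem extendCovector_tmul (φ : V →ₗ[ℝ] ℝ) (c : ℂ) (v : V) :
    extendCovector φ (c ⊗ₜ[ℝ] v) = c * (φ v : ℂ) := by
  simp only [extendCovector, LinearMap.add_apply, LinearMap.smul_apply, LinearMap.comp_apply,
    reV_tmul, imV_tmul, map_smul, smul_eq_mul]
  apply Complex.ext <;> simp

end Complexification

section

variable {E : Type*} [NormedAddCommGroup E] [NormedSpace ℝ E] [FiniteDimensional ℝ E]
  [CompleteSpace E]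
  {X : Type*} [TopologicalSpace X] [ChartedSpace E X] [IsManifold 𝓘(ℝ, E) ∞ X]
  {F : Type*} [NormedAddCommGroup F] [NormedSpace ℝ F] [FiniteDimensional ℝ F]
  {Y : Type*} [TopologicalSpace Y] [ChartedSpace F Y] [IsManifold 𝓘(ℝ, F) ∞ Y]
  {G : Type*} [NormedAddCommGroup G] [NormedSpace ℝ G]
  {K : KaehlerStructure E X} {C : CoisotropicEmbedding F Y K}

namespace KaehlerStructure

theorem g_apply (x : X) (v w : TangentSpace 𝓘(ℝ, E) x) : K.g x v w = K.om x v (K.J x w) := rfl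

theorem g_comm (x : X) (v w : TangentSpace 𝓘(ℝ, E) x) : K.g x v w = K.g x w v := K.symm x v w

theorem om_comm (x : X) (v w : TangentSpace 𝓘(ℝ, E) x) : K.om x v w = -K.om x w v := by
  have h := K.alt x (v + w)
  simp only [map_add, add_apply, K.alt] at h
  linarith

theorem om_J_J (x : X) (v w : TangentSpace 𝓘(ℝ, E) x) :
    K.om x (K.J x v) (K.J x w) = K.om x v w := by
  rw [K.symm, K.J_sq, map_neg, ← K.om_comm]

theorem g_J_J (x : X) (v w : TangentSpace 𝓘(ℝ, E) x) :
    K.g x (K.J x v) (K.J x w) = K.g x v w := K.om_J_J x v (K.J x w)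

theorem g_J_right (x : X) (v w : TangentSpace 𝓘(ℝ, E) x) : K.g x v (K.J x w) = -K.om x v w := by
  rw [g_apply, K.J_sq, map_neg]

theorem g_J_left (x : X) (v w : TangentSpace 𝓘(ℝ, E) x) : K.g x (K.J x v) w = K.om x v w := by
  rw [g_comm, g_J_right, ← om_comm]

variable (K) in
/-- The `(1,0)`-part `(v - √-1 J v) / 2` of a real tangent vector. -/
def holPart (x : X) : TangentSpace 𝓘(ℝ, E) x →ₗ[ℝ] ℂ ⊗[ℝ] TangentSpace 𝓘(ℝ, E) x :=
  TensorProduct.mk ℝ ℂ _ (1 / 2) - TensorProduct.mk ℝ ℂ _ (Complex.I / 2) ∘ₗ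
    (K.J x : TangentSpace 𝓘(ℝ, E) x →ₗ[ℝ] TangentSpace 𝓘(ℝ, E) x)

theorem holPart_apply (x : X) (v : TangentSpace 𝓘(ℝ, E) x) :
    K.holPart x v = (1 / 2 : ℂ) ⊗ₜ[ℝ] v - (Complex.I / 2) ⊗ₜ[ℝ] K.J x v := rfl

theorem reV_holPart (x : X) (v : TangentSpace 𝓘(ℝ, E) x) :
    reV (K.holPart x v) = (1 / 2 : ℝ) • v := by
  rw [holPart_apply, map_sub, reV_tmul, reV_tmul]
  simp

theorem imV_holPart (x : X) (v : TangentSpace 𝓘(ℝ, E) x) :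
    imV (K.holPart x v) = (-1 / 2 : ℝ) • K.J x v := by
  rw [holPart_apply, map_sub, imV_tmul, imV_tmul]
  simp [neg_div]

theorem holPart_J (x : X) (v : TangentSpace 𝓘(ℝ, E) x) :
    K.holPart x (K.J x v) = Complex.I • K.holPart x v := by
  rw [holPart_apply, holPart_apply, smul_sub, TensorProduct.smul_tmul', TensorProduct.smul_tmul',
    K.J_sq, TensorProduct.tmul_neg, smul_eq_mul, smul_eq_mul,
    show Complex.I * (Complex.I / 2) = -(1 / 2 : ℂ) by
      rw [← mul_div_assoc, Complex.I_mul_I]; ring, TensorProduct.neg_tmul,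
    show Complex.I * (1 / 2) = Complex.I / 2 by ring]
  abel

variable (K) in
/-- The complex covector `g(a, ·) + √-1 g(J a, ·)`; on `T^{1,0}` it is the Hermitian product with
`a - √-1 J a`. -/
def hermCovector (x : X) (a : TangentSpace 𝓘(ℝ, E) x) : ℂ ⊗[ℝ] TangentSpace 𝓘(ℝ, E) x →ₗ[ℂ] ℂ where
  toFun z := extendCovector (K.g x a) z + Complex.I * extendCovector (K.g x (K.J x a)) z
  map_add' z w := by
    rw [map_add, map_add]
    ring
  map_smul' c z := by
    rw [extendCovector_smul, extendCovector_smul, smul_eq_mul, RingHom.id_apply]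
    ring

theorem hermCovector_apply (x : X) (a : TangentSpace 𝓘(ℝ, E) x)
    (z : ℂ ⊗[ℝ] TangentSpace 𝓘(ℝ, E) x) : K.hermCovector x a z =
      (K.g x a (reV z) - K.g x (K.J x a) (imV z) : ℝ) +
        Complex.I * (K.g x a (imV z) + K.g x (K.J x a) (reV z) : ℝ) := by
  change extendCovector (K.g x a) z + Complex.I * extendCovector (K.g x (K.J x a)) z = _
  simp only [extendCovector, LinearMap.add_apply, LinearMap.smul_apply, LinearMap.comp_apply]
  apply Complex.ext <;> simp <;> ring

theorem hermCovector_tmul (x : X) (a : TangentSpace 𝓘(ℝ, E) x) (c : ℂ)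
    (v : TangentSpace 𝓘(ℝ, E) x) : K.hermCovector x a (c ⊗ₜ[ℝ] v) =
      c * (K.g x a v + Complex.I * K.g x (K.J x a) v) := by
  change extendCovector (K.g x a) (c ⊗ₜ[ℝ] v) + Complex.I * extendCovector (K.g x (K.J x a)) _ = _
  rw [extendCovector_tmul, extendCovector_tmul]
  ring

/-- On `(1,0)`-vectors the Hermitian product is `g + √-1 ω`. -/
theorem hermCovector_holPart (x : X) (a v : TangentSpace 𝓘(ℝ, E) x) :
    K.hermCovector x a (K.holPart x v) = K.g x a v + Complex.I * K.om x a v := by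
  rw [holPart_apply, map_sub, hermCovector_tmul, hermCovector_tmul, g_J_J, g_J_right, g_J_left]
  push_cast
  linear_combination (-(1/2 : ℂ) * K.g x a v) * Complex.I_mul_I

end KaehlerStructure

/-! ### The bundle `𝓔^{1,0}` -/

theorem om_di_di (y : Y) {v : TangentSpace 𝓘(ℝ, F) y} (hv : v ∈ nullSpace C y)
    (w : TangentSpace 𝓘(ℝ, F) y) : K.om (C.i y) (di C y w) (di C y v) = 0 := hv w

theorem om_eq_zero_of_mem (y : Y) {v w : TangentSpace 𝓘(ℝ, E) (C.i y)}
    (hv : v ∈ LinearMap.range (di C y)) (hw : w ∈ (nullSpace C y).map (di C y)) :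
    K.om (C.i y) v w = 0 := by
  obtain ⟨a, rfl⟩ := hv
  obtain ⟨b, hb, rfl⟩ := hw
  exact hb a

theorem mem_range_of_mem_map {y : Y} {v : TangentSpace 𝓘(ℝ, E) (C.i y)}
    (hv : v ∈ (nullSpace C y).map (di C y)) : v ∈ LinearMap.range (di C y) := by
  obtain ⟨a, -, rfl⟩ := hv
  exact ⟨a, rfl⟩

theorem holPart_mem_E10 {y : Y} {v : TangentSpace 𝓘(ℝ, E) (C.i y)}
    (hv : v ∈ calE C y) : K.holPart (C.i y) v ∈ E10 C y := by
  refine ⟨sub_mem (Submodule.tmul_mem_baseChange_of_mem _ hv)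
    (Submodule.tmul_mem_baseChange_of_mem _ (J_mem_calE C y hv)), ?_⟩
  refine Module.End.mem_eigenspace_iff.2 ?_
  rw [← KaehlerStructure.holPart_J]
  rfl

theorem projE10_tmul (y : Y) (c : ℂ) (v : TangentSpace 𝓘(ℝ, E) (C.i y)) :
    (projE10 C y (c ⊗ₜ[ℝ] v) : ℂ ⊗[ℝ] TangentSpace 𝓘(ℝ, E) (C.i y)) =
      c • K.holPart (C.i y) (K.orthProj (C.i y) (calE C y) v) := by
  set w : TangentSpace 𝓘(ℝ, E) (C.i y) := (K.orthProj (C.i y) (calE C y) v).1 with hw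
  have h : (projE10 C y (c ⊗ₜ[ℝ] v) : ℂ ⊗[ℝ] TangentSpace 𝓘(ℝ, E) (C.i y)) =
      (1 / 2 : ℂ) • (c ⊗ₜ[ℝ] w - Complex.I • (c ⊗ₜ[ℝ] (K.J (C.i y) w))) := by
    simp [projE10, hw]
  rw [h, KaehlerStructure.holPart_apply, smul_sub, smul_sub, TensorProduct.smul_tmul',
    TensorProduct.smul_tmul', TensorProduct.smul_tmul', TensorProduct.smul_tmul',
    TensorProduct.smul_tmul']
  simp only [smul_eq_mul]
  congr 2 <;> ring

theorem orthProj_of_mem (x : X) {W : Submodule ℝ (TangentSpace 𝓘(ℝ, E) x)}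
    {v : TangentSpace 𝓘(ℝ, E) x} (hv : v ∈ W) : (K.orthProj x W v : TangentSpace 𝓘(ℝ, E) x) = v := by
  have := Submodule.projectionOnto_apply_left (K.isCompl x W) ⟨v, hv⟩
  exact congrArg Subtype.val this

theorem orthProj_of_orthogonal (x : X) {W : Submodule ℝ (TangentSpace 𝓘(ℝ, E) x)}
    {v : TangentSpace 𝓘(ℝ, E) x} (hv : ∀ w ∈ W, K.g x w v = 0) :
    (K.orthProj x W v : TangentSpace 𝓘(ℝ, E) x) = 0 := by
  have : K.orthProj x W v = 0 :=
    (Submodule.projectionOnto_apply_eq_zero_iff (K.isCompl x W)).2 hv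
  rw [this]; rfl

theorem orthProj_eq (x : X) {W : Submodule ℝ (TangentSpace 𝓘(ℝ, E) x)}
    {v w : TangentSpace 𝓘(ℝ, E) x} (hw : w ∈ W) (h : ∀ a ∈ W, K.g x a (v - w) = 0) :
    (K.orthProj x W v : TangentSpace 𝓘(ℝ, E) x) = w := by
  have h1 := orthProj_of_orthogonal (K := K) x h
  rw [map_sub, Submodule.coe_sub, orthProj_of_mem x hw, sub_eq_zero] at h1
  exact h1

/-- `projE10` is the identity on `𝓔^{1,0}`. -/
theorem projE10_coe (y : Y) (z : E10 C y) : projE10 C y z = z := by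
  obtain ⟨z, hz, hz'⟩ := z
  have h0 : (((calE C y).subtype ∘ₗ K.orthProj (C.i y) (calE C y)).baseChange ℂ) z = z := by
    have h1 : (calE C y).baseChange ℂ ≤ LinearMap.eqLocus
        (((calE C y).subtype ∘ₗ K.orthProj (C.i y) (calE C y)).baseChange ℂ) LinearMap.id := by
      rw [Submodule.baseChange_eq_span, Submodule.span_le]
      rintro _ ⟨v, hv, rfl⟩
      have := orthProj_of_mem (K := K) (C.i y) hv
      simp [this]
    exact h1 hz
  have h2 := Module.End.mem_eigenspace_iff.1 hz'
  apply Subtype.ext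
  change ((1 / 2 : ℂ) • (LinearMap.id - Complex.I • _) ∘ₗ _) z = z
  rw [LinearMap.smul_apply, LinearMap.comp_apply, h0, LinearMap.sub_apply, LinearMap.smul_apply, h2,
    smul_smul, Complex.I_mul_I, LinearMap.id_apply, neg_one_smul, sub_neg_eq_add, ← two_smul ℂ z, smul_smul]
  norm_num

variable (C) in
/-- An orthonormal basis of the leaf direction `T_y𝓕`, as a subspace of `T_{i(y)} X`. -/
structure IsLeafBasis {m : ℕ} (y : Y) (s : Fin m → TangentSpace 𝓘(ℝ, E) (C.i y)) : Prop where
  orthonormal : ∀ a b, K.g (C.i y) (s a) (s b) = if a = b then 1 else 0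
  span : Submodule.span ℝ (Set.range s) = (nullSpace C y).map (di C y)

namespace IsLeafBasis

variable {m : ℕ} {y : Y} {s : Fin m → TangentSpace 𝓘(ℝ, E) (C.i y)} (hs : IsLeafBasis C y s)
include hs

theorem mem (a : Fin m) : s a ∈ (nullSpace C y).map (di C y) :=
  hs.span ▸ Submodule.subset_span ⟨a, rfl⟩

theorem mem_calE (a : Fin m) : s a ∈ calE C y := Submodule.mem_sup_left (hs.mem a)

theorem om_eq_zero (a b : Fin m) : K.om (C.i y) (s a) (s b) = 0 :=
  om_eq_zero_of_mem y (mem_range_of_mem_map (hs.mem a)) (hs.mem b)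

/-- The orthogonal projection onto `𝓔`. As `T𝓕` is isotropic, `s_a` and `J s_a` together form an
orthonormal basis of `𝓔`, and `g(J s_a, v) = ω(s_a, v)`. -/
theorem orthProj_calE (v : TangentSpace 𝓘(ℝ, E) (C.i y)) :
    (K.orthProj (C.i y) (calE C y) v : TangentSpace 𝓘(ℝ, E) (C.i y)) =
      ∑ a, (K.g (C.i y) (s a) v • s a + K.om (C.i y) (s a) v • K.J (C.i y) (s a)) := by
  refine orthProj_eq _ (sum_mem fun a _ ↦ add_mem (Submodule.smul_mem _ _ (hs.mem_calE a))
    (Submodule.smul_mem _ _ (J_mem_calE C y (hs.mem_calE a)))) ?_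
  have key : calE C y ≤ LinearMap.ker ((K.g (C.i y)).flip (v - ∑ a,
      (K.g (C.i y) (s a) v • s a + K.om (C.i y) (s a) v • K.J (C.i y) (s a)))) := by
    refine sup_le ?_ ?_
    · rw [← hs.span, Submodule.span_le]
      rintro _ ⟨b, rfl⟩
      simp [hs.orthonormal, KaehlerStructure.g_J_right, hs.om_eq_zero]
    · rw [← hs.span, Submodule.map_le_iff_le_comap, Submodule.span_le]
      rintro _ ⟨b, rfl⟩
      have h (a : Fin m) : K.om (C.i y) (s b) (K.J (C.i y) (s a)) = if b = a then 1 else 0 :=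
        hs.orthonormal b a
      simp [h, KaehlerStructure.g_J_left, hs.om_eq_zero]
  exact fun a ha ↦ key ha

theorem holPart_mem (a : Fin m) : K.holPart (C.i y) (s a) ∈ E10 C y :=
  holPart_mem_E10 (hs.mem_calE a)

theorem coe_projE10 (z : ℂ ⊗[ℝ] TangentSpace 𝓘(ℝ, E) (C.i y)) :
    (projE10 C y z : ℂ ⊗[ℝ] TangentSpace 𝓘(ℝ, E) (C.i y)) =
      ∑ a, K.hermCovector (C.i y) (s a) z • K.holPart (C.i y) (s a) := by
  induction z using TensorProduct.induction_on with
  | zero => simp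
  | add a b ha hb =>
    rw [map_add, Submodule.coe_add, ha, hb, ← Finset.sum_add_distrib]
    simp only [map_add, add_smul]
  | tmul c v =>
    rw [projE10_tmul, hs.orthProj_calE, map_sum, Finset.smul_sum]
    refine Finset.sum_congr rfl fun a _ ↦ ?_
    rw [map_add, map_smul, map_smul, KaehlerStructure.holPart_J, KaehlerStructure.hermCovector_tmul,
      KaehlerStructure.g_J_left, mul_smul, add_smul]
    congr 2
    rw [mul_comm, mul_smul]
    rfl

/-- The orthogonal projection onto `𝓔^{1,0}` in the unitary frame `u_a = (s_a - √-1 J s_a) / 2`. -/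
theorem projE10_eq (z : ℂ ⊗[ℝ] TangentSpace 𝓘(ℝ, E) (C.i y)) :
    projE10 C y z = ∑ a, K.hermCovector (C.i y) (s a) z •
      (⟨K.holPart (C.i y) (s a), hs.holPart_mem a⟩ : E10 C y) := by
  apply Subtype.ext
  rw [hs.coe_projE10]
  simp

theorem hermCovector_holPart (a b : Fin m) :
    K.hermCovector (C.i y) (s a) (K.holPart (C.i y) (s b)) = if a = b then 1 else 0 := by
  rw [KaehlerStructure.hermCovector_holPart, hs.orthonormal, hs.om_eq_zero]
  split_ifs <;> simp

end IsLeafBasis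

end

/-! ### Determinants -/

/-- Frame change in the top exterior power. -/
theorem ιMulti_sum_smul {R M : Type*} [CommRing R] [AddCommGroup M] [Module R M] {m : ℕ}
    (A : Matrix (Fin m) (Fin m) R) (w : Fin m → M) :
    exteriorPower.ιMulti R m (fun j ↦ ∑ a, A j a • w a) = A.det • exteriorPower.ιMulti R m w := by
  let f₁ : (Fin m → R) [⋀^Fin m]→ₗ[R] ⋀[R]^m M :=
    (exteriorPower.ιMulti R m).compLinearMap (Fintype.linearCombination R w)
  let f₂ : (Fin m → R) [⋀^Fin m]→ₗ[R] ⋀[R]^m M :=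
    (LinearMap.toSpanSingleton R _ (exteriorPower.ιMulti R m w)).compAlternatingMap
      Matrix.detRowAlternating
  have h : f₁ = f₂ := by
    refine (Pi.basisFun R (Fin m)).ext_alternating fun v hv ↦ ?_
    let p : Equiv.Perm (Fin m) := Equiv.ofBijective v (Finite.injective_iff_bijective.1 hv)
    have h1 := f₁.map_perm (fun i ↦ Pi.basisFun R (Fin m) i) p
    have h2 := f₂.map_perm (fun i ↦ Pi.basisFun R (Fin m) i) p
    have h3 : f₁ (fun i ↦ Pi.basisFun R (Fin m) i) = f₂ (fun i ↦ Pi.basisFun R (Fin m) i) := by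
      have h4 : Matrix.detRowAlternating (fun i ↦ Pi.basisFun R (Fin m) i) = (1 : R) := by
        have h5 : (fun i ↦ Pi.basisFun R (Fin m) i) = (1 : Matrix (Fin m) (Fin m) R) := by
          funext i j
          simp [Matrix.one_apply, Pi.single_apply, eq_comm]
        exact (congrArg Matrix.det h5).trans Matrix.det_one
      simp only [f₁, f₂, LinearMap.compAlternatingMap_apply, h4, AlternatingMap.compLinearMap_apply]
      simp [Fintype.linearCombination_apply_single]
    exact h1.trans ((congrArg _ h3).trans h2.symm)
  exact congrArg (fun f ↦ f A) h

/-- The derivative of `det` at `A` in the direction `A * M` is `tr M * det A`, also for singular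
`A`. -/
theorem sum_det_updateRow_mul {R : Type*} [CommRing R] {m : ℕ} (A M : Matrix (Fin m) (Fin m) R) :
    ∑ j, (A.updateRow j ((A * M) j)).det = M.trace * A.det := by
  have h (j : Fin m) : (A.updateRow j ((A * M) j)).det = (A * M * A.adjugate) j j := by
    rw [← Matrix.cramer_transpose_apply, Matrix.cramer_eq_adjugate_mulVec, ← Matrix.adjugate_transpose]
    simp only [Matrix.mulVec, dotProduct, Matrix.transpose_apply, Matrix.mul_apply (M := A * M)]
    exact Finset.sum_congr rfl fun k _ ↦ mul_comm _ _
  simp only [h]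
  change Matrix.trace (A * M * A.adjugate) = _
  rw [Matrix.mul_assoc, Matrix.trace_mul_comm, Matrix.mul_assoc, Matrix.adjugate_mul,
    Matrix.mul_smul, Matrix.mul_one, Matrix.trace_smul, smul_eq_mul, mul_comm]

section

variable {E : Type*} [NormedAddCommGroup E] [NormedSpace ℝ E] [FiniteDimensional ℝ E]
  [CompleteSpace E]
  {X : Type*} [TopologicalSpace X] [ChartedSpace E X] [IsManifold 𝓘(ℝ, E) ∞ X]
  {F : Type*} [NormedAddCommGroup F] [NormedSpace ℝ F] [FiniteDimensional ℝ F]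
  {Y : Type*} [TopologicalSpace Y] [ChartedSpace F Y] [IsManifold 𝓘(ℝ, F) ∞ Y]
  {G : Type*} [NormedAddCommGroup G] [NormedSpace ℝ G]
  {K : KaehlerStructure E X} {C : CoisotropicEmbedding F Y K}

theorem mdifferentiableAt_pi {ι : Type*} [Fintype ι] {f : Y → ι → G} {y : Y}
    (h : ∀ j, MDifferentiableAt 𝓘(ℝ, F) 𝓘(ℝ, G) (fun y ↦ f y j) y) :
    MDifferentiableAt 𝓘(ℝ, F) 𝓘(ℝ, ι → G) f y := by
  rw [mdifferentiableAt_iff]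
  refine ⟨continuousAt_pi.2 fun j ↦ (h j).continuousAt, ?_⟩
  exact differentiableWithinAt_pi.2 fun j ↦ ((mdifferentiableAt_iff _ _).1 (h j)).2

/-- Jacobi's formula, for a matrix-valued function on a manifold. -/
theorem mvfderiv_det {m : ℕ} {A : Y → Matrix (Fin m) (Fin m) ℂ} {y : Y}
    (h : ∀ j a, MDifferentiableAt 𝓘(ℝ, F) 𝓘(ℝ, ℂ) (fun y ↦ A y j a) y)
    (v : TangentSpace 𝓘(ℝ, F) y) :
    MDifferentiableAt 𝓘(ℝ, F) 𝓘(ℝ, ℂ) (fun y ↦ (A y).det) y ∧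
    mvfderiv 𝓘(ℝ, F) (fun y ↦ (A y).det) y v =
      ∑ j, ((A y).updateRow j (fun a ↦ mvfderiv 𝓘(ℝ, F) (fun y ↦ A y j a) y v)).det := by
  let D : ContinuousMultilinearMap ℂ (fun _ : Fin m ↦ (Fin m → ℂ)) ℂ :=
    { toMultilinearMap := (Matrix.detRowAlternating (n := Fin m) (R := ℂ)).toMultilinearMap
      cont := by
        change Continuous fun A : Matrix (Fin m) (Fin m) ℂ ↦ A.det
        exact continuous_id.matrix_det }
  let A' : Y → Fin m → Fin m → ℂ := A
  have hA : MDifferentiableAt 𝓘(ℝ, F) 𝓘(ℝ, Fin m → Fin m → ℂ) A' y :=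
    mdifferentiableAt_pi fun j ↦ mdifferentiableAt_pi fun a ↦ h j a
  have hD : HasFDerivAt (fun B : Fin m → Fin m → ℂ ↦ D B) _ (A' y) :=
    (D.hasFDerivAt (A' y)).restrictScalars ℝ
  have h1 : HasMFDerivAt 𝓘(ℝ, F) 𝓘(ℝ, ℂ) (fun y ↦ D (A' y)) y _ :=
    hD.hasMFDerivAt.comp y hA.hasMFDerivAt
  refine ⟨h1.mdifferentiableAt, ?_⟩
  have h2 : mvfderiv 𝓘(ℝ, F) (fun y ↦ (A y).det) y v =
      D.linearDeriv (A' y) (mvfderiv 𝓘(ℝ, F) A' y v) := by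
    exact congrArg (fun L : F →L[ℝ] ℂ ↦ L v) h1.mfderiv
  have h3 (j a : Fin m) : mvfderiv 𝓘(ℝ, F) A' y v j a = mvfderiv 𝓘(ℝ, F) (fun y ↦ A y j a) y v :=
    (mvfderiv_clm_comp ((ContinuousLinearMap.proj (R := ℝ) (φ := fun _ : Fin m ↦ ℂ) a).comp
      (ContinuousLinearMap.proj (R := ℝ) (φ := fun _ : Fin m ↦ Fin m → ℂ) j)) hA v).symm
  rw [h2, ContinuousMultilinearMap.linearDeriv_apply]
  refine Finset.sum_congr rfl fun j _ ↦ ?_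
  change Matrix.det (Function.update (A y) j _) = _
  rw [Matrix.updateRow]
  congr 2
  funext a
  exact h3 j a

/-! ### The connection on the complexified pull-back -/

variable (C) in
/-- The section `Z` of `i^*TX ⊗ ℂ` is differentiable at `y`. -/
def DiffAlongAtC (Z : ∀ y : Y, ℂ ⊗[ℝ] TangentSpace 𝓘(ℝ, E) (C.i y)) (y : Y) : Prop :=
  DiffAlongAt C (fun y ↦ reV (Z y)) y ∧ DiffAlongAt C (fun y ↦ imV (Z y)) y

variable (C) in
theorem pullConnC_apply (Z : ∀ y : Y, ℂ ⊗[ℝ] TangentSpace 𝓘(ℝ, E) (C.i y)) (y : Y)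
    (v : TangentSpace 𝓘(ℝ, F) y) : pullConnC C Z y v =
      (1 : ℂ) ⊗ₜ[ℝ] pullConn C (fun y ↦ reV (Z y)) y v +
        Complex.I ⊗ₜ[ℝ] pullConn C (fun y ↦ imV (Z y)) y v := rfl

variable (C) in
theorem pullConnC_congr {Z Z' : ∀ y : Y, ℂ ⊗[ℝ] TangentSpace 𝓘(ℝ, E) (C.i y)} {y : Y}
    (h : ∀ᶠ y' in 𝓝 y, Z y' = Z' y') : pullConnC C Z y = pullConnC C Z' y := by
  rw [pullConnC, pullConnC, pullConn_congr C (h.mono fun y' h ↦ by rw [h]),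
    pullConn_congr C (s := fun y ↦ imV (Z y)) (h.mono fun y' h ↦ by rw [h])]

theorem mdifferentiableAt_re {f : Y → ℂ} {y : Y} (hf : MDifferentiableAt 𝓘(ℝ, F) 𝓘(ℝ, ℂ) f y) :
    MDifferentiableAt 𝓘(ℝ, F) 𝓘(ℝ, ℝ) (fun y ↦ (f y).re) y :=
  Complex.reCLM.mdifferentiableAt.comp y hf

theorem mdifferentiableAt_im {f : Y → ℂ} {y : Y} (hf : MDifferentiableAt 𝓘(ℝ, F) 𝓘(ℝ, ℂ) f y) :
    MDifferentiableAt 𝓘(ℝ, F) 𝓘(ℝ, ℝ) (fun y ↦ (f y).im) y :=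
  Complex.imCLM.mdifferentiableAt.comp y hf

theorem mvfderiv_re {f : Y → ℂ} {y : Y} (hf : MDifferentiableAt 𝓘(ℝ, F) 𝓘(ℝ, ℂ) f y)
    (v : TangentSpace 𝓘(ℝ, F) y) : mvfderiv 𝓘(ℝ, F) (fun y ↦ (f y).re) y v =
      (mvfderiv 𝓘(ℝ, F) f y v).re := mvfderiv_clm_comp Complex.reCLM hf v

theorem mvfderiv_im {f : Y → ℂ} {y : Y} (hf : MDifferentiableAt 𝓘(ℝ, F) 𝓘(ℝ, ℂ) f y)
    (v : TangentSpace 𝓘(ℝ, F) y) : mvfderiv 𝓘(ℝ, F) (fun y ↦ (f y).im) y v =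
      (mvfderiv 𝓘(ℝ, F) f y v).im := mvfderiv_clm_comp Complex.imCLM hf v

theorem mdifferentiableAt_neg_im {f : Y → ℂ} {y : Y}
    (hf : MDifferentiableAt 𝓘(ℝ, F) 𝓘(ℝ, ℂ) f y) :
    MDifferentiableAt 𝓘(ℝ, F) 𝓘(ℝ, ℝ) (fun y ↦ -(f y).im) y :=
  (-Complex.imCLM).mdifferentiableAt.comp y hf

theorem mvfderiv_neg_im {f : Y → ℂ} {y : Y} (hf : MDifferentiableAt 𝓘(ℝ, F) 𝓘(ℝ, ℂ) f y)
    (v : TangentSpace 𝓘(ℝ, F) y) : mvfderiv 𝓘(ℝ, F) (fun y ↦ -(f y).im) y v =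
      -(mvfderiv 𝓘(ℝ, F) f y v).im := mvfderiv_clm_comp (-Complex.imCLM) hf v

theorem mvfderiv_mul_complex {f f' : Y → ℂ} {y : Y} (hf : MDifferentiableAt 𝓘(ℝ, F) 𝓘(ℝ, ℂ) f y)
    (hf' : MDifferentiableAt 𝓘(ℝ, F) 𝓘(ℝ, ℂ) f' y) (v : TangentSpace 𝓘(ℝ, F) y) :
    mvfderiv 𝓘(ℝ, F) (fun y ↦ f y * f' y) y v =
      f y * mvfderiv 𝓘(ℝ, F) f' y v + mvfderiv 𝓘(ℝ, F) f y v * f' y :=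
  congrArg (fun A : F →L[ℝ] ℂ ↦ A v) (hf.hasMFDerivAt.mul' hf'.hasMFDerivAt).mfderiv

theorem DiffAlongAtC.smul {f : Y → ℂ} {Z : ∀ y : Y, ℂ ⊗[ℝ] TangentSpace 𝓘(ℝ, E) (C.i y)} {y : Y}
    (hf : MDifferentiableAt 𝓘(ℝ, F) 𝓘(ℝ, ℂ) f y) (hZ : DiffAlongAtC C Z y) :
    DiffAlongAtC C (fun y ↦ f y • Z y) y := by
  constructor
  · simp only [reV_smul]
    exact (hZ.1.smul (mdifferentiableAt_re hf)).add (hZ.2.smul (mdifferentiableAt_neg_im hf))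
  · simp only [imV_smul]
    exact (hZ.2.smul (mdifferentiableAt_re hf)).add (hZ.1.smul (mdifferentiableAt_im hf))

section T2

variable [T2Space X]

theorem pullConnC_smul {f : Y → ℂ} {Z : ∀ y : Y, ℂ ⊗[ℝ] TangentSpace 𝓘(ℝ, E) (C.i y)} {y : Y}
    (hf : MDifferentiableAt 𝓘(ℝ, F) 𝓘(ℝ, ℂ) f y) (hZ : DiffAlongAtC C Z y)
    (v : TangentSpace 𝓘(ℝ, F) y) : pullConnC C (fun y ↦ f y • Z y) y v =
      mvfderiv 𝓘(ℝ, F) f y v • Z y + f y • pullConnC C Z y v := by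
  rw [pullConnC_apply]
  simp only [reV_smul, imV_smul]
  rw [pullConn_add (hZ.1.smul (mdifferentiableAt_re hf)) (hZ.2.smul (mdifferentiableAt_neg_im hf)),
    pullConn_add (hZ.2.smul (mdifferentiableAt_re hf)) (hZ.1.smul (mdifferentiableAt_im hf)),
    pullConn_smul (mdifferentiableAt_re hf) hZ.1, pullConn_smul (mdifferentiableAt_neg_im hf) hZ.2,
    pullConn_smul (mdifferentiableAt_re hf) hZ.2, pullConn_smul (mdifferentiableAt_im hf) hZ.1,
    mvfderiv_re hf, mvfderiv_im hf, mvfderiv_neg_im hf]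
  set D := mvfderiv 𝓘(ℝ, F) f y v
  rw [← one_tmul_reV_add (D • Z y + f y • pullConnC C Z y v)]
  simp only [map_add, reV_smul, imV_smul, pullConnC_apply, reV_tmul, imV_tmul]
  simp only [Complex.one_re, Complex.one_im, Complex.I_re, Complex.I_im, one_smul, zero_smul,
    add_zero, zero_add]
  congr 2 <;> abel

theorem pullConnC_sum {ι : Type*} (t : Finset ι)
    {Z : ι → ∀ y : Y, ℂ ⊗[ℝ] TangentSpace 𝓘(ℝ, E) (C.i y)} {y : Y}
    (hZ : ∀ j ∈ t, DiffAlongAtC C (Z j) y) (v : TangentSpace 𝓘(ℝ, F) y) :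
    pullConnC C (fun y ↦ ∑ j ∈ t, Z j y) y v = ∑ j ∈ t, pullConnC C (Z j) y v := by
  simp only [pullConnC_apply, map_sum]
  rw [pullConn_sum t fun j hj ↦ (hZ j hj).1, pullConn_sum t fun j hj ↦ (hZ j hj).2,
    TensorProduct.tmul_sum, TensorProduct.tmul_sum, Finset.sum_add_distrib]

end T2

/-! ### Smoothness of the Hermitian product -/

theorem mdifferentiableAt_ofReal_add {a b : Y → ℝ} {y : Y}
    (ha : MDifferentiableAt 𝓘(ℝ, F) 𝓘(ℝ, ℝ) a y) (hb : MDifferentiableAt 𝓘(ℝ, F) 𝓘(ℝ, ℝ) b y) :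
    MDifferentiableAt 𝓘(ℝ, F) 𝓘(ℝ, ℂ) (fun y ↦ (a y : ℂ) + Complex.I * (b y : ℂ)) y :=
  (Complex.ofRealCLM.mdifferentiableAt.comp y ha).add
    ((Complex.I • Complex.ofRealCLM).mdifferentiableAt.comp y hb)

theorem contMDiffAt_ofReal_add {a b : Y → ℝ} {y : Y}
    (ha : ContMDiffAt 𝓘(ℝ, F) 𝓘(ℝ, ℝ) ∞ a y) (hb : ContMDiffAt 𝓘(ℝ, F) 𝓘(ℝ, ℝ) ∞ b y) :
    ContMDiffAt 𝓘(ℝ, F) 𝓘(ℝ, ℂ) ∞ (fun y ↦ (a y : ℂ) + Complex.I * (b y : ℂ)) y :=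
  (Complex.ofRealCLM.contMDiff.contMDiffAt.comp y ha).add
    ((Complex.I • Complex.ofRealCLM).contMDiff.contMDiffAt.comp y hb)

theorem mdifferentiableAt_hermCovector {s : ∀ y : Y, TangentSpace 𝓘(ℝ, E) (C.i y)}
    {Z : ∀ y : Y, ℂ ⊗[ℝ] TangentSpace 𝓘(ℝ, E) (C.i y)} {y : Y} [T2Space X]
    (hs : DiffAlongAt C s y) (hZ : DiffAlongAtC C Z y) :
    MDifferentiableAt 𝓘(ℝ, F) 𝓘(ℝ, ℂ) (fun y ↦ K.hermCovector (C.i y) (s y) (Z y)) y := by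
  simp only [KaehlerStructure.hermCovector_apply, KaehlerStructure.g_apply]
  exact mdifferentiableAt_ofReal_add ((hs.om hZ.1.J).sub (hs.J.om hZ.2.J))
    ((hs.om hZ.2.J).add (hs.J.om hZ.1.J))

theorem contMDiffAt_hermCovector {s : ∀ y : Y, TangentSpace 𝓘(ℝ, E) (C.i y)}
    {Z : ∀ y : Y, ℂ ⊗[ℝ] TangentSpace 𝓘(ℝ, E) (C.i y)} {y : Y}
    (hs : SmoothAlongAt C s y) (hr : SmoothAlongAt C (fun y ↦ reV (Z y)) y)
    (hi : SmoothAlongAt C (fun y ↦ imV (Z y)) y) :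
    ContMDiffAt 𝓘(ℝ, F) 𝓘(ℝ, ℂ) ∞ (fun y ↦ K.hermCovector (C.i y) (s y) (Z y)) y := by
  simp only [KaehlerStructure.hermCovector_apply, KaehlerStructure.g_apply]
  exact contMDiffAt_ofReal_add ((hs.om hr.J).sub (hs.J.om hi.J)) ((hs.om hi.J).add (hs.J.om hr.J))

end

section

variable {E : Type*} [NormedAddCommGroup E] [NormedSpace ℝ E] [FiniteDimensional ℝ E]
  [CompleteSpace E]
  {X : Type*} [TopologicalSpace X] [ChartedSpace E X] [IsManifold 𝓘(ℝ, E) ∞ X]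
  {F : Type*} [NormedAddCommGroup F] [NormedSpace ℝ F] [FiniteDimensional ℝ F]
  {Y : Type*} [TopologicalSpace Y] [ChartedSpace F Y] [IsManifold 𝓘(ℝ, F) ∞ Y]
  {G : Type*} [NormedAddCommGroup G] [NormedSpace ℝ G]
  {K : KaehlerStructure E X} {C : CoisotropicEmbedding F Y K}

/-! ### Leaf frames and the connection on `det 𝓔^{1,0}` -/

variable (C) in
/-- A leaf frame over the open set `N ⊆ Y`: smooth sections `s_1, …, s_m` of `i^*TX` forming an
orthonormal basis of `T𝓕`, together with the frame `u_a = (s_a - √-1 J s_a) / 2` of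
`𝓔^{1,0}` (whose values off `N` are arbitrary). -/
structure IsLeafFrame {m : ℕ} (N : Set Y) (s : Fin m → ∀ y : Y, TangentSpace 𝓘(ℝ, E) (C.i y))
    (u : Fin m → ∀ y : Y, E10 C y) : Prop where
  isOpen : IsOpen N
  smooth : ∀ y ∈ N, ∀ a, SmoothAlongAt C (s a) y
  basis : ∀ y ∈ N, IsLeafBasis C y (fun a ↦ s a y)
  coe_u : ∀ y ∈ N, ∀ a, (u a y : ℂ ⊗[ℝ] TangentSpace 𝓘(ℝ, E) (C.i y)) = K.holPart (C.i y) (s a y)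

variable (C) in
/-- The connection form `η = ∑ ω^a_a` on `Y` of the frame `u_1 ∧ ⋯ ∧ u_m`. -/
def frameForm {m : ℕ} (s : Fin m → ∀ y : Y, TangentSpace 𝓘(ℝ, E) (C.i y)) (y : Y) :
    TangentSpace 𝓘(ℝ, F) y →ₗ[ℝ] ℂ :=
  ∑ a, ((K.hermCovector (C.i y) (s a y)).restrictScalars ℝ) ∘ₗ
    pullConnC C (fun y ↦ K.holPart (C.i y) (s a y)) y

theorem SmoothAlongAt.reV_holPart {s : ∀ y : Y, TangentSpace 𝓘(ℝ, E) (C.i y)} {y : Y}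
    (h : SmoothAlongAt C s y) : SmoothAlongAt C (fun y ↦ reV (K.holPart (C.i y) (s y))) y := by
  simp only [KaehlerStructure.reV_holPart]
  exact h.smul contMDiffAt_const

theorem SmoothAlongAt.imV_holPart {s : ∀ y : Y, TangentSpace 𝓘(ℝ, E) (C.i y)} {y : Y}
    (h : SmoothAlongAt C s y) : SmoothAlongAt C (fun y ↦ imV (K.holPart (C.i y) (s y))) y := by
  simp only [KaehlerStructure.imV_holPart]
  exact h.J.smul contMDiffAt_const

theorem DiffAlongAt.holPart [T2Space X] {s : ∀ y : Y, TangentSpace 𝓘(ℝ, E) (C.i y)} {y : Y}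
    (h : DiffAlongAt C s y) : DiffAlongAtC C (fun y ↦ K.holPart (C.i y) (s y)) y := by
  constructor
  · simp only [KaehlerStructure.reV_holPart]
    exact h.smul mdifferentiableAt_const
  · simp only [KaehlerStructure.imV_holPart]
    exact h.J.smul mdifferentiableAt_const

theorem pullConnC_holPart [T2Space X] {s : ∀ y : Y, TangentSpace 𝓘(ℝ, E) (C.i y)} {y : Y}
    (h : DiffAlongAt C s y) (v : TangentSpace 𝓘(ℝ, F) y) :
    pullConnC C (fun y ↦ K.holPart (C.i y) (s y)) y v = K.holPart (C.i y) (pullConn C s y v) := by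
  have h0 (c : ℝ) : mvfderiv 𝓘(ℝ, F) (fun _ : Y ↦ c) y v = 0 := by
    rw [mvfderiv_const]; rfl
  rw [pullConnC_apply]
  simp only [KaehlerStructure.reV_holPart, KaehlerStructure.imV_holPart]
  rw [pullConn_smul (f := fun _ ↦ (1 / 2 : ℝ)) mdifferentiableAt_const h,
    pullConn_smul (f := fun _ ↦ (-1 / 2 : ℝ)) mdifferentiableAt_const h.J, pullConn_J h, h0, h0,
    zero_smul, zero_smul, zero_add, zero_add, ← KaehlerStructure.reV_holPart,
    ← KaehlerStructure.imV_holPart, one_tmul_reV_add]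

namespace IsLeafFrame

variable {m : ℕ} {N : Set Y} {s : Fin m → ∀ y : Y, TangentSpace 𝓘(ℝ, E) (C.i y)}
    {u : Fin m → ∀ y : Y, E10 C y} (hs : IsLeafFrame C N s u)
include hs

theorem mono {N' : Set Y} (h : N' ⊆ N) (hN : IsOpen N') : IsLeafFrame C N' s u :=
  ⟨hN, fun y hy ↦ hs.smooth y (h hy), fun y hy ↦ hs.basis y (h hy), fun y hy ↦ hs.coe_u y (h hy)⟩

theorem u_eq {y : Y} (hy : y ∈ N) (a : Fin m) :
    u a y = ⟨K.holPart (C.i y) (s a y), (hs.basis y hy).holPart_mem a⟩ :=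
  Subtype.ext (hs.coe_u y hy a)

theorem projE10_eq {y : Y} (hy : y ∈ N) (z : ℂ ⊗[ℝ] TangentSpace 𝓘(ℝ, E) (C.i y)) :
    projE10 C y z = ∑ a, K.hermCovector (C.i y) (s a y) z • u a y := by
  rw [(hs.basis y hy).projE10_eq]
  simp only [hs.u_eq hy]

theorem eq_sum {y : Y} (hy : y ∈ N) (z : E10 C y) :
    z = ∑ a, K.hermCovector (C.i y) (s a y) z • u a y := by
  rw [← hs.projE10_eq hy, projE10_coe]

theorem hermCovector_u {y : Y} (hy : y ∈ N) (a b : Fin m) :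
    K.hermCovector (C.i y) (s a y) (u b y) = if a = b then 1 else 0 := by
  rw [hs.coe_u y hy]
  exact (hs.basis y hy).hermCovector_holPart a b

theorem isFrameE10 : IsFrameE10 C N u where
  isOpen := hs.isOpen
  smooth_re j y hy := by
    refine ContMDiffAt.contMDiffWithinAt (SmoothAlongAt.congr (hs.smooth y hy j).reV_holPart ?_)
    filter_upwards [hs.isOpen.mem_nhds hy] with y' hy'
    rw [hs.coe_u y' hy']
  smooth_im j y hy := by
    refine ContMDiffAt.contMDiffWithinAt (SmoothAlongAt.congr (hs.smooth y hy j).imV_holPart ?_)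
    filter_upwards [hs.isOpen.mem_nhds hy] with y' hy'
    rw [hs.coe_u y' hy']
  linearIndependent y hy := by
    refine Fintype.linearIndependent_iff.2 fun c hc a ↦ ?_
    have h := congrArg (fun z : E10 C y ↦ K.hermCovector (C.i y) (s a y) z) hc
    simpa [hs.hermCovector_u hy] using h
  span y hy := by
    refine eq_top_iff.2 fun z _ ↦ ?_
    rw [hs.eq_sum hy z]
    exact sum_mem fun a _ ↦ Submodule.smul_mem _ _ (Submodule.subset_span ⟨a, rfl⟩)

/-- Any other family of sections differs from `u_1 ∧ ⋯ ∧ u_m` by the determinant of its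
coefficients. -/
theorem wedge_eq {y : Y} (hy : y ∈ N) (s' : Fin m → ∀ y : Y, E10 C y) :
    wedge C s' y = (Matrix.of fun j a ↦ K.hermCovector (C.i y) (s a y) (s' j y)).det • wedge C u y := by
  rw [wedge, wedge, ← ιMulti_sum_smul]
  congr 1
  funext j
  exact hs.eq_sum hy _

/-- `u_1 ∧ ⋯ ∧ u_m` does not vanish. -/
theorem smul_wedge_injective {y : Y} (hy : y ∈ N) {c d : ℂ}
    (h : c • wedge C u y = d • wedge C u y) : c = d := by
  let φ : E10 C y →ₗ[ℂ] (Fin m → ℂ) :=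
    LinearMap.pi fun a ↦ (K.hermCovector (C.i y) (s a y)) ∘ₗ (E10 C y).subtype
  let D := exteriorPower.alternatingMapLinearEquiv
    ((Matrix.detRowAlternating (n := Fin m) (R := ℂ)).compLinearMap φ)
  have h1 : D (wedge C u y) = 1 := by
    rw [wedge, exteriorPower.alternatingMapLinearEquiv_apply_ιMulti]
    have h3 : (fun j ↦ φ (u j y)) = (1 : Matrix (Fin m) (Fin m) ℂ) := by
      funext j a
      change K.hermCovector (C.i y) (s a y) (u j y) = _
      rw [hs.hermCovector_u hy, Matrix.one_apply]
      simp only [eq_comm]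
    exact (congrArg Matrix.det h3).trans Matrix.det_one
  have h2 := congrArg D h
  simpa [h1] using h2

theorem frameForm_apply [T2Space X] {y : Y} (hy : y ∈ N) (v : TangentSpace 𝓘(ℝ, F) y) :
    frameForm C s y v = ∑ a, (K.g (C.i y) (s a y) (pullConn C (s a) y v) +
      Complex.I * K.om (C.i y) (s a y) (pullConn C (s a) y v)) := by
  rw [frameForm, LinearMap.sum_apply]
  refine Finset.sum_congr rfl fun a _ ↦ ?_
  rw [LinearMap.comp_apply, pullConnC_holPart (hs.smooth y hy a).diffAlongAt]
  exact KaehlerStructure.hermCovector_holPart _ _ _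

/-- In the frame `u_1 ∧ ⋯ ∧ u_m`, the connection on `det 𝓔^{1,0}` is `d + η`, in whichever frame
`s'` of `𝓔^{1,0}` the covariant derivative is computed: if `s' = A u` then
`s'_1 ∧ ⋯ ∧ s'_m = det A • u_1 ∧ ⋯ ∧ u_m`, and the derivative of `det A` is given by Jacobi's
formula. -/
theorem hasDetCovDerivAt_eq [T2Space X] {y : Y} (hy : y ∈ N) {σ : ∀ y : Y, detE10 C m y} {f : Y → ℂ}
    (hσ : ∀ᶠ y' in 𝓝 y, σ y' = f y' • wedge C u y') {v : TangentSpace 𝓘(ℝ, F) y}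
    {τ : detE10 C m y} (h : HasDetCovDerivAt C σ y v τ) :
    τ = (mvfderiv 𝓘(ℝ, F) f y v + f y * frameForm C s y v) • wedge C u y := by
  obtain ⟨N', s', h, hyN', hs', hh, hσ', rfl⟩ := h
  have hN := hs.isOpen.mem_nhds hy
  have hN' := hs'.isOpen.mem_nhds hyN'
  have hsa (a : Fin m) : DiffAlongAt C (s a) y := (hs.smooth y hy a).diffAlongAt
  have hZ (j : Fin m) : DiffAlongAtC C (fun y ↦ (s' j y : ℂ ⊗[ℝ] TangentSpace 𝓘(ℝ, E) (C.i y))) y :=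
    ⟨((hs'.smooth_re j).contMDiffAt hN').mdifferentiableAt (by simp),
      ((hs'.smooth_im j).contMDiffAt hN').mdifferentiableAt (by simp)⟩
  let A : Y → Matrix (Fin m) (Fin m) ℂ :=
    fun y ↦ Matrix.of fun j a ↦ K.hermCovector (C.i y) (s a y) (s' j y)
  have hA (j a : Fin m) : MDifferentiableAt 𝓘(ℝ, F) 𝓘(ℝ, ℂ) (fun y ↦ A y j a) y :=
    mdifferentiableAt_hermCovector (hsa a) (hZ j)
  obtain ⟨hdet, hdet'⟩ := mvfderiv_det hA v
  let M : Matrix (Fin m) (Fin m) ℂ := Matrix.of fun a b ↦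
    K.hermCovector (C.i y) (s b y) (pullConnC C (fun y ↦ K.holPart (C.i y) (s a y)) y v)
  have hM : M.trace = frameForm C s y v := by
    rw [frameForm, LinearMap.sum_apply]
    rfl
  -- the two local expressions of `σ` agree
  have hf : f =ᶠ[𝓝 y] fun y ↦ h y * (A y).det := by
    filter_upwards [hσ, hN, hN'] with y' h1 h2 h3
    refine hs.smul_wedge_injective h2 ?_
    rw [← h1, hσ' y' h3, hs.wedge_eq h2 s', smul_smul]
  -- the covariant derivatives of the frame `s'`
  have hconn (j : Fin m) : connE10 C (s' j) y v =
      ∑ a, (mvfderiv 𝓘(ℝ, F) (fun y ↦ A y j a) y v + (A y * M) j a) • u a y := by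
    have h1 : ∀ᶠ y' in 𝓝 y, (s' j y' : ℂ ⊗[ℝ] TangentSpace 𝓘(ℝ, E) (C.i y')) =
        ∑ a, A y' j a • K.holPart (C.i y') (s a y') := by
      filter_upwards [hN] with y' h2
      rw [hs.eq_sum h2 (s' j y'), Submodule.coe_sum]
      refine Finset.sum_congr rfl fun a _ ↦ ?_
      rw [Submodule.coe_smul, hs.coe_u y' h2]
      rfl
    rw [connE10, LinearMap.comp_apply, pullConnC_congr C h1,
      pullConnC_sum _ fun a _ ↦ (hsa a).holPart.smul (hA j a)]
    rw [LinearMap.restrictScalars_apply, hs.projE10_eq hy]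
    refine Finset.sum_congr rfl fun b _ ↦ ?_
    congr 1
    rw [map_sum]
    have h2 (a : Fin m) : K.hermCovector (C.i y) (s b y)
        (pullConnC C (fun y ↦ A y j a • K.holPart (C.i y) (s a y)) y v) =
        mvfderiv 𝓘(ℝ, F) (fun y ↦ A y j a) y v * (if b = a then 1 else 0) + A y j a * M a b := by
      rw [pullConnC_smul (hA j a) (hsa a).holPart, map_add, map_smul, map_smul, smul_eq_mul,
        smul_eq_mul, ← hs.hermCovector_u hy b a, hs.coe_u y hy]
      rfl
    simp only [h2, Finset.sum_add_distrib, Matrix.mul_apply]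
    simp
  have hwedge (j : Fin m) (r : Fin m → ℂ) : exteriorPower.ιMulti ℂ m
      (Function.update (fun l ↦ s' l y) j (∑ a, r a • u a y)) =
      ((A y).updateRow j r).det • wedge C u y := by
    rw [wedge, ← ιMulti_sum_smul]
    congr 1
    funext l
    by_cases hl : l = j
    · subst hl
      simp
    · rw [Function.update_of_ne hl, Matrix.updateRow_ne hl]
      exact hs.eq_sum hy _
  have hsum : ∑ j, exteriorPower.ιMulti ℂ m
      (Function.update (fun l ↦ s' l y) j (connE10 C (s' j) y v)) =
      (mvfderiv 𝓘(ℝ, F) (fun y ↦ (A y).det) y v + frameForm C s y v * (A y).det) • wedge C u y := by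
    have h1 (j : Fin m) := hwedge j
      (fun a ↦ mvfderiv 𝓘(ℝ, F) (fun y ↦ A y j a) y v + (A y * M) j a)
    have h2 : ∑ j, ((A y).updateRow j (fun a ↦ mvfderiv 𝓘(ℝ, F) (fun y ↦ A y j a) y v +
        (A y * M) j a)).det =
        mvfderiv 𝓘(ℝ, F) (fun y ↦ (A y).det) y v + frameForm C s y v * (A y).det := by
      rw [hdet', ← hM, ← sum_det_updateRow_mul]
      refine Eq.trans (Finset.sum_congr rfl fun j _ ↦ ?_) Finset.sum_add_distrib
      exact Matrix.det_updateRow_add (A y) j (fun a ↦ mvfderiv 𝓘(ℝ, F) (fun y ↦ A y j a) y v)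
        ((A y * M) j)
    rw [← h2, Finset.sum_smul]
    exact Finset.sum_congr rfl fun j _ ↦ by rw [hconn, h1]
  have h1 : f y = h y * (A y).det := hf.self_of_nhds
  have h2 : mvfderiv 𝓘(ℝ, F) f y v = h y * mvfderiv 𝓘(ℝ, F) (fun y ↦ (A y).det) y v +
      mvfderiv 𝓘(ℝ, F) h y v * (A y).det :=
    (congrArg (fun L : TangentSpace 𝓘(ℝ, F) y →L[ℝ] ℂ ↦ L v) (mvfderiv_congr hf)).trans
      (mvfderiv_mul_complex hh hdet v)
  have h3 : wedge C s' y = (A y).det • wedge C u y := hs.wedge_eq hy s'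
  rw [hsum, h3, smul_smul, smul_smul, ← add_smul, h1, h2]
  congr 1
  ring

/-- The value of `detConn` in a leaf frame. It is a choice among the `τ` with `HasDetCovDerivAt`;
the frame provides one, and `hasDetCovDerivAt_eq` shows that there is no other. -/
theorem detConn_eq [T2Space X] {y : Y} (hy : y ∈ N) {σ : ∀ y : Y, detE10 C m y} {f : Y → ℂ}
    (hf : MDifferentiableAt 𝓘(ℝ, F) 𝓘(ℝ, ℂ) f y)
    (hσ : ∀ᶠ y' in 𝓝 y, σ y' = f y' • wedge C u y') (v : TangentSpace 𝓘(ℝ, F) y) :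
    detConn C σ y v = (mvfderiv 𝓘(ℝ, F) f y v + f y * frameForm C s y v) • wedge C u y := by
  have hex : ∃ τ, HasDetCovDerivAt C σ y v τ := by
    obtain ⟨N', h1, h2, h3⟩ := mem_nhds_iff.1 (Filter.inter_mem hσ (hs.isOpen.mem_nhds hy))
    exact ⟨_, N', u, f, h3, (hs.mono (fun y h ↦ (h1 h).2) h2).isFrameE10, hf,
      fun y h ↦ (h1 h).1, rfl⟩
  rw [detConn, dif_pos hex]
  exact hs.hasDetCovDerivAt_eq hy hσ hex.choose_spec

end IsLeafFrame

end

section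

variable {E : Type*} [NormedAddCommGroup E] [NormedSpace ℝ E] [FiniteDimensional ℝ E]
  [CompleteSpace E]
  {X : Type*} [TopologicalSpace X] [ChartedSpace E X] [IsManifold 𝓘(ℝ, E) ∞ X]
  {F : Type*} [NormedAddCommGroup F] [NormedSpace ℝ F] [FiniteDimensional ℝ F]
  {Y : Type*} [TopologicalSpace Y] [ChartedSpace F Y] [IsManifold 𝓘(ℝ, F) ∞ Y]
  {G : Type*} [NormedAddCommGroup G] [NormedSpace ℝ G]
  {K : KaehlerStructure E X} {C : CoisotropicEmbedding F Y K}

/-! ### Curvature of `det 𝓔^{1,0}` -/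

theorem contMDiffAt_det {m : ℕ} {A : Y → Matrix (Fin m) (Fin m) ℂ} {y : Y}
    (h : ∀ j a, ContMDiffAt 𝓘(ℝ, F) 𝓘(ℝ, ℂ) ∞ (fun y ↦ A y j a) y) :
    ContMDiffAt 𝓘(ℝ, F) 𝓘(ℝ, ℂ) ∞ (fun y ↦ (A y).det) y := by
  let D : ContinuousMultilinearMap ℂ (fun _ : Fin m ↦ (Fin m → ℂ)) ℂ :=
    { toMultilinearMap := (Matrix.detRowAlternating (n := Fin m) (R := ℂ)).toMultilinearMap
      cont := by
        change Continuous fun A : Matrix (Fin m) (Fin m) ℂ ↦ A.det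
        exact continuous_id.matrix_det }
  let A' : Y → Fin m → Fin m → ℂ := A
  have hA : ContMDiffAt 𝓘(ℝ, F) 𝓘(ℝ, Fin m → Fin m → ℂ) ∞ A' y :=
    contMDiffAt_pi_space.2 fun j ↦ contMDiffAt_pi_space.2 fun a ↦ h j a
  exact (D.contDiff.restrict_scalars ℝ).contMDiff.contMDiffAt.comp y hA

theorem mdifferentiableAt_eventually {f : Y → G} {y : Y} (hf : ContMDiffAt 𝓘(ℝ, F) 𝓘(ℝ, G) ∞ f y) :
    ∀ᶠ y' in 𝓝 y, MDifferentiableAt 𝓘(ℝ, F) 𝓘(ℝ, G) f y' := by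
  have := (contMDiffAt_iff_contMDiffAt_nhds (n := 1) (by simp)).1 (hf.of_le (m := 1) (by norm_cast))
  filter_upwards [this] with y' h' using h'.mdifferentiableAt (by simp)

namespace IsLeafFrame

variable {m : ℕ} {N : Set Y} {s : Fin m → ∀ y : Y, TangentSpace 𝓘(ℝ, E) (C.i y)}
    {u : Fin m → ∀ y : Y, E10 C y} (hs : IsLeafFrame C N s u)
include hs

/-- A smooth section of `det 𝓔^{1,0}` is a smooth multiple of `u_1 ∧ ⋯ ∧ u_m`. -/
theorem exists_smooth_coefficient {y : Y} (hy : y ∈ N) {σ : ∀ y : Y, detE10 C m y}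
    (hσ : SmoothDetSectionNear C σ y) : ∃ f : Y → ℂ, ContMDiffAt 𝓘(ℝ, F) 𝓘(ℝ, ℂ) ∞ f y ∧
      ∀ᶠ y' in 𝓝 y, σ y' = f y' • wedge C u y' := by
  obtain ⟨N', s', h, hyN', hs', hh, hσ⟩ := hσ
  have hN := hs.isOpen.mem_nhds hy
  have hN' := hs'.isOpen.mem_nhds hyN'
  have hdet := contMDiffAt_det (F := F) (y := y)
    (A := fun y ↦ Matrix.of fun j a ↦ K.hermCovector (C.i y) (s a y) (s' j y)) fun j a ↦
    contMDiffAt_hermCovector (hs.smooth y hy a) ((hs'.smooth_re j).contMDiffAt hN')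
      ((hs'.smooth_im j).contMDiffAt hN')
  have hmul : ContDiff ℝ ∞ (fun p : ℂ × ℂ ↦ p.1 * p.2) := contDiff_fst.mul contDiff_snd
  refine ⟨_, hmul.contMDiff.contMDiffAt.comp y ((hh.contMDiffAt hN').prodMk_space hdet), ?_⟩
  filter_upwards [hN, hN'] with y' h1 h2
  rw [hσ y' h2, hs.wedge_eq h1 s', smul_smul]
  rfl

variable [T2Space X]

theorem contMDiffAt_frameForm {y : Y} (hy : y ∈ N) {V : ∀ y : Y, TangentSpace 𝓘(ℝ, F) y}
    (hV : ContMDiffAt 𝓘(ℝ, F) (𝓘(ℝ, F).prod 𝓘(ℝ, F)) ∞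
      (fun y ↦ (⟨y, V y⟩ : TangentBundle 𝓘(ℝ, F) Y)) y) :
    ContMDiffAt 𝓘(ℝ, F) 𝓘(ℝ, ℂ) ∞ (fun y ↦ frameForm C s y (V y)) y := by
  have h : ContMDiffAt 𝓘(ℝ, F) 𝓘(ℝ, ℂ) ∞ (fun y ↦ ∑ a, (
      (K.g (C.i y) (s a y) (pullConn C (s a) y (V y)) : ℂ) +
      Complex.I * K.om (C.i y) (s a y) (pullConn C (s a) y (V y)))) y := by
    refine ContMDiffAt.sum fun a _ ↦ ?_
    have h1 := hs.smooth y hy a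
    exact contMDiffAt_ofReal_add (h1.om (h1.pullConn hV).J) (h1.om (h1.pullConn hV))
  refine h.congr_of_eventuallyEq ?_
  filter_upwards [hs.isOpen.mem_nhds hy] with y' hy'
  exact hs.frameForm_apply hy' _

theorem detConn_eventually {y : Y} (hy : y ∈ N) {σ : ∀ y : Y, detE10 C m y} {f : Y → ℂ}
    (hf : ContMDiffAt 𝓘(ℝ, F) 𝓘(ℝ, ℂ) ∞ f y)
    (hσ : ∀ᶠ y' in 𝓝 y, σ y' = f y' • wedge C u y') (W : ∀ y : Y, TangentSpace 𝓘(ℝ, F) y) :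
    ∀ᶠ y' in 𝓝 y, detConn C σ y' (W y') =
      (mvfderiv 𝓘(ℝ, F) f y' (W y') + f y' * frameForm C s y' (W y')) • wedge C u y' := by
  filter_upwards [hs.isOpen.mem_nhds hy, hσ.eventually_nhds, mdifferentiableAt_eventually hf]
    with y' h1 h2 h3
  exact hs.detConn_eq h1 h3 h2 _

/-- The curvature of the line bundle `det 𝓔^{1,0}` is `dη`: with `σ = f • u_1 ∧ ⋯ ∧ u_m`, the second
derivatives of `f` cancel against `df([V, W])` and the terms quadratic in `η` commute. -/
theorem detCurv_eq {y : Y} (hy : y ∈ N) {V W : ∀ y : Y, TangentSpace 𝓘(ℝ, F) y}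
    {σ : ∀ y : Y, detE10 C m y} (hV : SmoothVectorFieldNear V y) (hW : SmoothVectorFieldNear W y)
    (hσ : SmoothDetSectionNear C σ y) :
    detCurv C V W σ y =
      (mvfderiv 𝓘(ℝ, F) (fun y' ↦ frameForm C s y' (W y')) y (V y) -
        mvfderiv 𝓘(ℝ, F) (fun y' ↦ frameForm C s y' (V y')) y (W y) -
        frameForm C s y (VectorField.mlieBracket 𝓘(ℝ, F) V W y)) • σ y := by
  obtain ⟨f, hf, hσ⟩ := hs.exists_smooth_coefficient hy hσ
  have hf' : MDifferentiableAt 𝓘(ℝ, F) 𝓘(ℝ, ℂ) f y := hf.mdifferentiableAt (by simp)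
  have key {V W : ∀ y : Y, TangentSpace 𝓘(ℝ, F) y} (hW : SmoothVectorFieldNear W y) :
      detConn C (fun y ↦ detConn C σ y (W y)) y (V y) =
      (mvfderiv 𝓘(ℝ, F) (fun y' ↦ mvfderiv 𝓘(ℝ, F) f y' (W y')) y (V y) +
        (f y * mvfderiv 𝓘(ℝ, F) (fun y' ↦ frameForm C s y' (W y')) y (V y) +
          mvfderiv 𝓘(ℝ, F) f y (V y) * frameForm C s y (W y)) +
        (mvfderiv 𝓘(ℝ, F) f y (W y) + f y * frameForm C s y (W y)) * frameForm C s y (V y)) •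
          wedge C u y := by
    have h1 : MDifferentiableAt 𝓘(ℝ, F) 𝓘(ℝ, ℂ) (fun y' ↦ mvfderiv 𝓘(ℝ, F) f y' (W y')) y :=
      (contMDiffAt_mvfderiv_apply hf hW.self_of_nhds).mdifferentiableAt (by simp)
    have h2 : MDifferentiableAt 𝓘(ℝ, F) 𝓘(ℝ, ℂ) (fun y' ↦ frameForm C s y' (W y')) y :=
      (hs.contMDiffAt_frameForm hy hW.self_of_nhds).mdifferentiableAt (by simp)
    have h3 : MDifferentiableAt 𝓘(ℝ, F) 𝓘(ℝ, ℂ) (fun y' ↦ f y' * frameForm C s y' (W y')) y :=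
      (hf'.hasMFDerivAt.mul' h2.hasMFDerivAt).mdifferentiableAt
    rw [hs.detConn_eq hy (h1.add h3) (hs.detConn_eventually hy hf hσ W)]
    congr 2
    rw [← mvfderiv_mul_complex hf' h2]
    have h4 := mvfderiv_add h1 h3
    exact congrArg (fun L : TangentSpace 𝓘(ℝ, F) y →L[ℝ] ℂ ↦ L (V y)) h4
  have hc := mvfderiv_mvfderiv_apply_sub hf hV.self_of_nhds hW.self_of_nhds
  have hmod {M : Type _} [AddCommGroup M] [Module ℂ M] {a b c d e : ℂ} (w : M)
      (h : a - b - c = d * e) : a • w - b • w - c • w = d • e • w := by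
    rw [← sub_smul, ← sub_smul, h, mul_smul]
  rw [detCurv, key hW, key hV, hs.detConn_eq hy hf' hσ, hσ.self_of_nhds]
  refine hmod _ ?_
  rw [← hc]
  ring

end IsLeafFrame

/-! ### Adapted frames -/

theorem contMDiffAt_J {Z : ∀ x : X, TangentSpace 𝓘(ℝ, E) x} {x : X}
    (hZ : ContMDiffAt 𝓘(ℝ, E) (𝓘(ℝ, E).prod 𝓘(ℝ, E)) ∞
      (fun x ↦ (⟨x, Z x⟩ : TangentBundle 𝓘(ℝ, E) X)) x) :
    ContMDiffAt 𝓘(ℝ, E) (𝓘(ℝ, E).prod 𝓘(ℝ, E)) ∞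
      (fun x ↦ (⟨x, K.J x (Z x)⟩ : TangentBundle 𝓘(ℝ, E) X)) x :=
  ContMDiffAt.clm_bundle_apply (E₁ := (TangentSpace 𝓘(ℝ, E) : X → Type _))
    (E₂ := (TangentSpace 𝓘(ℝ, E) : X → Type _))
    (b := id) (ϕ := fun x ↦ K.J x) (n := ∞) (IM := 𝓘(ℝ, E)) (IB := 𝓘(ℝ, E))
    (K.smooth_J.contMDiffAt (x := x)) hZ

theorem contMDiffAt_const_smul {Z : ∀ x : X, TangentSpace 𝓘(ℝ, E) x} {x : X} (c : ℝ)
    (hZ : ContMDiffAt 𝓘(ℝ, E) (𝓘(ℝ, E).prod 𝓘(ℝ, E)) ∞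
      (fun x ↦ (⟨x, Z x⟩ : TangentBundle 𝓘(ℝ, E) X)) x) :
    ContMDiffAt 𝓘(ℝ, E) (𝓘(ℝ, E).prod 𝓘(ℝ, E)) ∞
      (fun x ↦ (⟨x, c • Z x⟩ : TangentBundle 𝓘(ℝ, E) X)) x :=
  ContMDiffAt.const_smul_section hZ

/-- For a vector field `e_j` on `X`, the connection of `i^*TX ⊗ ℂ` on `u_j ∘ i` is the one of
`TX ⊗ ℂ` on `u_j`. -/
theorem pullConnC_holPart_comp [T2Space X] {ι : Type*} {e : ι → ∀ x : X, TangentSpace 𝓘(ℝ, E) x}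
    {j : ι} {y : Y} (h : ContMDiffAt 𝓘(ℝ, E) (𝓘(ℝ, E).prod 𝓘(ℝ, E)) ∞
      (fun x ↦ (⟨x, e j x⟩ : TangentBundle 𝓘(ℝ, E) X)) (C.i y)) (v : TangentSpace 𝓘(ℝ, F) y) :
    pullConnC C (fun y ↦ K.holPart (C.i y) (e j (C.i y))) y v =
      K.connC (K.u e j) (C.i y) (di C y v) := by
  rw [pullConnC_apply]
  have hr (x : X) : reV (K.u e j x) = (1 / 2 : ℝ) • e j x :=
    KaehlerStructure.reV_holPart x _
  have hi (x : X) : imV (K.u e j x) = (-1 / 2 : ℝ) • K.J x (e j x) :=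
    KaehlerStructure.imV_holPart x _
  have h2 : pullConn C (fun y ↦ reV (K.holPart (C.i y) (e j (C.i y)))) y v =
      K.conn (fun x ↦ reV (K.u e j x)) (C.i y) (di C y v) := by
    refine pullConn_comp (Z := fun x ↦ reV (K.u e j x)) ?_ v
    simp only [hr]
    exact (contMDiffAt_const_smul _ h).mdifferentiableAt (by simp)
  have h3 : pullConn C (fun y ↦ imV (K.holPart (C.i y) (e j (C.i y)))) y v =
      K.conn (fun x ↦ imV (K.u e j x)) (C.i y) (di C y v) := by
    refine pullConn_comp (Z := fun x ↦ imV (K.u e j x)) ?_ v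
    simp only [hi]
    exact (contMDiffAt_const_smul _ (contMDiffAt_J h)).mdifferentiableAt (by simp)
  rw [h2, h3]
  rfl

namespace IsAdaptedFrame

variable {k m : ℕ} {U : Set X} {e : Fin k ⊕ Fin m → ∀ x : X, TangentSpace 𝓘(ℝ, E) x}
  (he : IsAdaptedFrame C U e)
include he

theorem contMDiffAt {x : X} (hx : x ∈ U) (j : Fin k ⊕ Fin m) :
    ContMDiffAt 𝓘(ℝ, E) (𝓘(ℝ, E).prod 𝓘(ℝ, E)) ∞
      (fun x ↦ (⟨x, e j x⟩ : TangentBundle 𝓘(ℝ, E) X)) x :=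
  (he.smooth j).contMDiffAt (he.isOpen.mem_nhds hx)

theorem isLeafFrame : IsLeafFrame C (C.i ⁻¹' U) (fun α y ↦ e (Sum.inr α) (C.i y)) he.uSection where
  isOpen := he.isOpen.preimage (contMDiff_i C).continuous
  smooth y hy α := smoothAlongAt_comp (he.contMDiffAt hy _)
  basis y hy := ⟨fun a b ↦ by rw [he.orthonormal_e _ hy]; simp, he.span_null y hy⟩
  coe_u y hy α := by
    rw [IsAdaptedFrame.uSection, dif_pos (show C.i y ∈ U from hy)]
    rfl

/-- The connection form of the leaf frame is the pull-back of `ω^α_α`. -/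
theorem frameForm_eq [T2Space X] {y : Y} (hy : C.i y ∈ U) (v : TangentSpace 𝓘(ℝ, F) y) :
    frameForm C (fun (α : Fin m) y ↦ e (Sum.inr α) (C.i y)) y v =
      connTrace K e (C.i y) (di C y v) := by
  rw [frameForm, connTrace, LinearMap.sum_apply, LinearMap.sum_apply]
  refine Finset.sum_congr rfl fun α _ ↦ ?_
  have h := he.contMDiffAt hy (Sum.inr α)
  rw [LinearMap.comp_apply, pullConnC_holPart_comp h]
  rfl

theorem detConn_wedge [T2Space X] {y : Y} (hy : C.i y ∈ U) (v : TangentSpace 𝓘(ℝ, F) y) :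
    detConn C (wedge C he.uSection) y v =
      connTrace K e (C.i y) (di C y v) • wedge C he.uSection y := by
  have h0 : mvfderiv 𝓘(ℝ, F) (fun _ : Y ↦ (1 : ℂ)) y v = 0 := by
    rw [mvfderiv_const]; rfl
  rw [he.isLeafFrame.detConn_eq (f := fun _ ↦ 1) hy mdifferentiableAt_const
    (Filter.Eventually.of_forall fun y' ↦ (one_smul ℂ _).symm), h0, zero_add, one_mul,
    he.frameForm_eq hy]

end IsAdaptedFrame

end

/-! ### Traces -/

/-- The trace of a bilinear map with respect to an inner product `B`, computed in an arbitrary basis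
with its Gram matrix, is the sum over an orthonormal family that spans. -/
theorem sum_gram_inv_smul {V T : Type*} [AddCommGroup V] [Module ℝ V] [AddCommGroup T] [Module ℝ T]
    {d m : ℕ} (B : LinearMap.BilinForm ℝ V) (b : Module.Basis (Fin d) ℝ V) (e : Fin m → V)
    (horth : ∀ i j, B (e i) (e j) = if i = j then 1 else 0)
    (hspan : Submodule.span ℝ (Set.range e) = ⊤) (S : V →ₗ[ℝ] V →ₗ[ℝ] T) :
    ∑ p, ∑ q, (Matrix.of fun p q ↦ B (b p) (b q))⁻¹ p q • S (b p) (b q) = ∑ a, S (e a) (e a) := by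
  let P : Matrix (Fin d) (Fin m) ℝ := Matrix.of fun p a ↦ B (e a) (b p)
  let Q : Matrix (Fin m) (Fin d) ℝ := Matrix.of fun a p ↦ b.repr (e a) p
  have hexp (x : V) : x = ∑ a, B (e a) x • e a := by
    have hx : x ∈ Submodule.span ℝ (Set.range e) := hspan ▸ Submodule.mem_top
    obtain ⟨c, rfl⟩ := (Submodule.mem_span_range_iff_exists_fun ℝ).1 hx
    refine Finset.sum_congr rfl fun a _ ↦ ?_
    simp [horth]
  have hb (p : Fin d) : b p = ∑ a, P p a • e a := hexp (b p)
  have he (a : Fin m) : e a = ∑ p, Q a p • b p := (b.sum_repr (e a)).symm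
  have hQP : Q * P = 1 := by
    ext a c
    rw [Matrix.mul_apply, Matrix.one_apply]
    have h := congrArg (fun x ↦ B (e c) x) (he a)
    simp only [map_sum, map_smul, smul_eq_mul, horth] at h
    refine h.symm.trans ?_
    simp only [eq_comm]
  have hPQ : P * Q = 1 := by
    ext p q
    rw [Matrix.mul_apply, Matrix.one_apply]
    have h := congrArg (fun x ↦ b.repr x q) (hb p)
    simp only [map_sum, map_smul, Module.Basis.repr_self, Finsupp.coe_finsetSum, Finset.sum_apply,
      Finsupp.smul_apply, smul_eq_mul, Finsupp.single_apply] at h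
    exact h.symm
  have hG : (Matrix.of fun p q ↦ B (b p) (b q)) = P * P.transpose := by
    ext p q
    rw [Matrix.mul_apply, Matrix.of_apply, hb p]
    simp only [map_sum, map_smul, LinearMap.sum_apply, LinearMap.smul_apply, smul_eq_mul]
    rfl
  have hinv : (Matrix.of fun p q ↦ B (b p) (b q))⁻¹ = Q.transpose * Q := by
    refine Matrix.inv_eq_right_inv ?_
    rw [hG, Matrix.mul_assoc, ← Matrix.mul_assoc P.transpose, ← Matrix.transpose_mul, hQP,
      Matrix.transpose_one, Matrix.one_mul, hPQ]
  rw [hinv]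
  have hS (a : Fin m) : S (e a) (e a) = ∑ p, ∑ q, (Q a p * Q a q) • S (b p) (b q) := by
    conv_lhs => rw [he a]
    simp only [map_sum, map_smul, LinearMap.sum_apply, LinearMap.smul_apply, Finset.smul_sum,
      smul_smul]
    rw [Finset.sum_comm]
    simp only [mul_comm]
  simp only [hS, Matrix.mul_apply, Matrix.transpose_apply, Finset.sum_smul]
  exact (Finset.sum_congr rfl fun p _ ↦ Finset.sum_comm).trans Finset.sum_comm

section

variable {E : Type*} [NormedAddCommGroup E] [NormedSpace ℝ E] [FiniteDimensional ℝ E]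
  [CompleteSpace E]
  {X : Type*} [TopologicalSpace X] [ChartedSpace E X] [IsManifold 𝓘(ℝ, E) ∞ X]
  {F : Type*} [NormedAddCommGroup F] [NormedSpace ℝ F] [FiniteDimensional ℝ F]
  {Y : Type*} [TopologicalSpace Y] [ChartedSpace F Y] [IsManifold 𝓘(ℝ, F) ∞ Y]
  {G : Type*} [NormedAddCommGroup G] [NormedSpace ℝ G]
  {K : KaehlerStructure E X} {C : CoisotropicEmbedding F Y K}
  [T2Space X]

/-! ### Integrability of `T𝓕` -/

theorem contMDiffAt_extend (y : Y) (w : TangentSpace 𝓘(ℝ, F) y) :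
    ContMDiffAt 𝓘(ℝ, F) (𝓘(ℝ, F).prod 𝓘(ℝ, F)) ∞
      (fun y' ↦ (⟨y', FiberBundle.extend F w y'⟩ : TangentBundle 𝓘(ℝ, F) Y)) y :=
  FiberBundle.contMDiffAt_extend 𝓘(ℝ, F) F w

theorem mvfderiv_eq_zero_of_const {f : Y → G} {y : Y} {c : G} (h : ∀ᶠ y' in 𝓝 y, f y' = c)
    (v : TangentSpace 𝓘(ℝ, F) y) : mvfderiv 𝓘(ℝ, F) f y v = 0 := by
  have h1 : mvfderiv 𝓘(ℝ, F) f y = mvfderiv 𝓘(ℝ, F) (fun _ ↦ c) y := mvfderiv_congr h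
  rw [h1, mvfderiv_const]
  rfl

/-- The null distribution is involutive: for sections `V`, `W` and any `Z`, the parallelism of `ω`
and the vanishing of the torsion express `ω(Z, [V, W])` through derivatives of
`ω(Z, V) = ω(Z, W) = ω(V, W) = 0`. -/
theorem mlieBracket_mem_nullSpace {V W : ∀ y : Y, TangentSpace 𝓘(ℝ, F) y} {y : Y}
    (hV : ContMDiffAt 𝓘(ℝ, F) (𝓘(ℝ, F).prod 𝓘(ℝ, F)) ∞
      (fun y ↦ (⟨y, V y⟩ : TangentBundle 𝓘(ℝ, F) Y)) y)
    (hW : ContMDiffAt 𝓘(ℝ, F) (𝓘(ℝ, F).prod 𝓘(ℝ, F)) ∞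
      (fun y ↦ (⟨y, W y⟩ : TangentBundle 𝓘(ℝ, F) Y)) y)
    (hV' : ∀ᶠ y' in 𝓝 y, V y' ∈ nullSpace C y') (hW' : ∀ᶠ y' in 𝓝 y, W y' ∈ nullSpace C y') :
    VectorField.mlieBracket 𝓘(ℝ, F) V W y ∈ nullSpace C y := by
  intro w
  let Z : ∀ y : Y, TangentSpace 𝓘(ℝ, F) y := FiberBundle.extend F w
  have hZ : ContMDiffAt 𝓘(ℝ, F) (𝓘(ℝ, F).prod 𝓘(ℝ, F)) ∞
      (fun y ↦ (⟨y, Z y⟩ : TangentBundle 𝓘(ℝ, F) Y)) y := contMDiffAt_extend y w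
  have hZw : Z y = w := FiberBundle.extend_apply_self F w
  have dV := (smoothAlongAt_di (C := C) hV).diffAlongAt
  have dW := (smoothAlongAt_di (C := C) hW).diffAlongAt
  have dZ := (smoothAlongAt_di (C := C) hZ).diffAlongAt
  have e1 := mvfderiv_om dZ dW (V y)
  have e2 := mvfderiv_om dZ dV (W y)
  have e3 := mvfderiv_om dV dW (Z y)
  rw [mvfderiv_eq_zero_of_const (c := 0) (hW'.mono fun y' h ↦ h (Z y'))] at e1
  rw [mvfderiv_eq_zero_of_const (c := 0) (hV'.mono fun y' h ↦ h (Z y'))] at e2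
  rw [mvfderiv_eq_zero_of_const (c := 0) (hW'.mono fun y' h ↦ h (V y'))] at e3
  have t1 := pullConn_di_sub (C := C) hV hW
  have t2 := pullConn_di_sub (C := C) hV hZ
  have t3 := pullConn_di_sub (C := C) hW hZ
  have n2 := hW'.self_of_nhds (VectorField.mlieBracket 𝓘(ℝ, F) V Z y)
  have n3 := hV'.self_of_nhds (VectorField.mlieBracket 𝓘(ℝ, F) W Z y)
  rw [← t2, map_sub, sub_apply] at n2
  rw [← t3, map_sub, sub_apply] at n3
  rw [← t1, map_sub, ← hZw]
  have c1 := KaehlerStructure.om_comm (K := K) (C.i y) (di C y (V y))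
    (pullConn C (fun y ↦ di C y (W y)) y (Z y))
  linarith

/-- On smooth sections of `T𝓕` the leafwise bracket is the Lie bracket; the junk value of
`leafBracket` is not taken. -/
theorem coe_leafBracket {V W : ∀ y : Y, nullSpace C y} {y : Y}
    (hV : ContMDiffAt 𝓘(ℝ, F) (𝓘(ℝ, F).prod 𝓘(ℝ, F)) ∞
      (fun y ↦ (⟨y, V y⟩ : TangentBundle 𝓘(ℝ, F) Y)) y)
    (hW : ContMDiffAt 𝓘(ℝ, F) (𝓘(ℝ, F).prod 𝓘(ℝ, F)) ∞
      (fun y ↦ (⟨y, W y⟩ : TangentBundle 𝓘(ℝ, F) Y)) y) :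
    (leafBracket C V W y : TangentSpace 𝓘(ℝ, F) y) =
      VectorField.mlieBracket 𝓘(ℝ, F) (fun y ↦ (V y : TangentSpace 𝓘(ℝ, F) y))
        (fun y ↦ (W y : TangentSpace 𝓘(ℝ, F) y)) y := by
  rw [leafBracket, dif_pos (mlieBracket_mem_nullSpace hV hW (Filter.Eventually.of_forall fun y ↦ (V y).2)
    (Filter.Eventually.of_forall fun y ↦ (W y).2))]

/-! ### The second fundamental form -/

variable (C) in
/-- The component of a vector of `T_{i(y)} X` normal to `Y`. -/
def normalPart (y : Y) : TangentSpace 𝓘(ℝ, E) (C.i y) →ₗ[ℝ] TangentSpace 𝓘(ℝ, E) (C.i y) :=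
  LinearMap.id - (LinearMap.range (di C y)).subtype ∘ₗ
    K.orthProj (C.i y) (LinearMap.range (di C y))

theorem normalPart_di (y : Y) (v : TangentSpace 𝓘(ℝ, F) y) : normalPart C y (di C y v) = 0 :=
  sub_eq_zero.2 (orthProj_of_mem (K := K) (C.i y) (LinearMap.mem_range_self _ v)).symm

theorem om_normalPart (y : Y) (w : TangentSpace 𝓘(ℝ, E) (C.i y)) {v : TangentSpace 𝓘(ℝ, F) y}
    (hv : v ∈ nullSpace C y) :
    K.om (C.i y) (normalPart C y w) (di C y v) = K.om (C.i y) w (di C y v) := by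
  have h : K.om (C.i y) (K.orthProj (C.i y) (LinearMap.range (di C y)) w).1 (di C y v) = 0 :=
    om_eq_zero_of_mem y (K.orthProj (C.i y) (LinearMap.range (di C y)) w).2 ⟨v, hv, rfl⟩
  change K.om (C.i y) (w - (K.orthProj (C.i y) (LinearMap.range (di C y)) w).1) (di C y v) = _
  rw [map_sub, sub_apply, h, sub_zero]

theorem normalPart_pullConn_comm {V W : ∀ y : Y, TangentSpace 𝓘(ℝ, F) y} {y : Y}
    (hV : ContMDiffAt 𝓘(ℝ, F) (𝓘(ℝ, F).prod 𝓘(ℝ, F)) ∞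
      (fun y ↦ (⟨y, V y⟩ : TangentBundle 𝓘(ℝ, F) Y)) y)
    (hW : ContMDiffAt 𝓘(ℝ, F) (𝓘(ℝ, F).prod 𝓘(ℝ, F)) ∞
      (fun y ↦ (⟨y, W y⟩ : TangentBundle 𝓘(ℝ, F) Y)) y) :
    normalPart C y (pullConn C (fun y ↦ di C y (W y)) y (V y)) =
      normalPart C y (pullConn C (fun y ↦ di C y (V y)) y (W y)) := by
  rw [← sub_eq_zero, ← map_sub, pullConn_di_sub hV hW, normalPart_di]

/-- The second fundamental form may be computed with any extension `W`. -/
theorem secondFF_eq {W : ∀ y : Y, TangentSpace 𝓘(ℝ, F) y} {y : Y}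
    (hW : ContMDiffAt 𝓘(ℝ, F) (𝓘(ℝ, F).prod 𝓘(ℝ, F)) ∞
      (fun y ↦ (⟨y, W y⟩ : TangentBundle 𝓘(ℝ, F) Y)) y) (v : TangentSpace 𝓘(ℝ, F) y) :
    secondFF C y v (W y) = normalPart C y (pullConn C (fun y ↦ di C y (W y)) y v) := by
  have h1 := normalPart_pullConn_comm (C := C) (contMDiffAt_extend y v) hW
  have h2 := normalPart_pullConn_comm (C := C) (contMDiffAt_extend y v) (contMDiffAt_extend y (W y))
  rw [FiberBundle.extend_apply_self] at h1 h2
  rw [FiberBundle.extend_apply_self] at h2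
  rw [h1, ← h2]
  rfl

theorem secondFF_comm (y : Y) (v w : TangentSpace 𝓘(ℝ, F) y) :
    secondFF C y v w = secondFF C y w v := by
  have h := normalPart_pullConn_comm (C := C) (contMDiffAt_extend y v) (contMDiffAt_extend y w)
  rw [FiberBundle.extend_apply_self, FiberBundle.extend_apply_self] at h
  exact h

variable (C) in
/-- The second fundamental form as a bilinear map. -/
def secondFFBilin (y : Y) :
    TangentSpace 𝓘(ℝ, F) y →ₗ[ℝ] TangentSpace 𝓘(ℝ, F) y →ₗ[ℝ] TangentSpace 𝓘(ℝ, E) (C.i y) :=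
  have h1 (v v' w) : secondFF C y (v + v') w = secondFF C y v w + secondFF C y v' w :=
    map_add (normalPart C y ∘ₗ pullConn C (fun y' ↦ di C y' (FiberBundle.extend F w y')) y) v v'
  have h2 (c : ℝ) (v w) : secondFF C y (c • v) w = c • secondFF C y v w :=
    map_smul (normalPart C y ∘ₗ pullConn C (fun y' ↦ di C y' (FiberBundle.extend F w y')) y) c v
  LinearMap.mk₂ ℝ (secondFF C y) h1 h2
    (fun v w w' ↦ by rw [secondFF_comm, h1, secondFF_comm y w, secondFF_comm y w'])
    (fun c v w ↦ by rw [secondFF_comm, h2, secondFF_comm])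

namespace IsLeafFrame

variable {m : ℕ} {N : Set Y} {s : Fin m → ∀ y : Y, TangentSpace 𝓘(ℝ, E) (C.i y)}
    {u : Fin m → ∀ y : Y, E10 C y} (hs : IsLeafFrame C N s u)
include hs

/-- The vector fields on `Y` which make up a leaf frame. -/
theorem exists_fields : ∃ e : Fin m → ∀ y : Y, TangentSpace 𝓘(ℝ, F) y,
    (∀ y ∈ N, ∀ a, e a y ∈ nullSpace C y ∧ di C y (e a y) = s a y) ∧
    ∀ y ∈ N, ∀ a, ContMDiffAt 𝓘(ℝ, F) (𝓘(ℝ, F).prod 𝓘(ℝ, F)) ∞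
      (fun y ↦ (⟨y, e a y⟩ : TangentBundle 𝓘(ℝ, F) Y)) y := by
  have h (a : Fin m) (y : Y) : ∃ v : TangentSpace 𝓘(ℝ, F) y,
      y ∈ N → v ∈ nullSpace C y ∧ di C y v = s a y := by
    by_cases hy : y ∈ N
    · obtain ⟨v, h1, h2⟩ := (hs.basis y hy).mem a
      exact ⟨v, fun _ ↦ ⟨h1, h2⟩⟩
    · exact ⟨0, fun h ↦ absurd h hy⟩
  choose e he using h
  refine ⟨e, fun y hy a ↦ he a y hy, fun y hy a ↦
    contMDiffAt_of_smoothAlongAt_di (C := C) (V := e a) ?_⟩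
  refine (hs.smooth y hy a).congr ?_
  filter_upwards [hs.isOpen.mem_nhds hy] with y' hy' using (he a y' hy').2.symm

/-- The leafwise mean curvature form in a leaf frame. In `α(v) = ∑ ω(S(s_a, s_a), v)` the
second fundamental form may be replaced by `∇_{s_a} s_a`, since `v` is `ω`-orthogonal to `TY`. If `t`
extends `v` to a section of `T𝓕`, then `ω(s_a, t) = 0` gives
`ω(∇_{s_a} s_a, t) = -ω(s_a, ∇_{s_a} t)`, and there `∇_{s_a} t` may be replaced by `∇_v s_a`, since
the difference `[s_a, t]` is tangent to `Y`. -/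
theorem meanCurvForm_eq {y : Y} (hy : y ∈ N) {v : TangentSpace 𝓘(ℝ, F) y} (hv : v ∈ nullSpace C y) :
    meanCurvForm C y v = -∑ a, K.om (C.i y) (s a y) (pullConn C (s a) y v) := by
  obtain ⟨e, he, hse⟩ := hs.exists_fields
  have hN := hs.isOpen.mem_nhds hy
  -- `v` extends to a combination `t` of the frame with constant coefficients
  have hv' : di C y v ∈ Submodule.span ℝ (Set.range fun a ↦ s a y) := by
    rw [(hs.basis y hy).span]
    exact ⟨v, hv, rfl⟩
  obtain ⟨c, hc⟩ := (Submodule.mem_span_range_iff_exists_fun ℝ).1 hv'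
  let t : ∀ y : Y, TangentSpace 𝓘(ℝ, E) (C.i y) := fun y ↦ ∑ b, c b • s b y
  let V : ∀ y : Y, TangentSpace 𝓘(ℝ, F) y := fun y ↦ ∑ b, c b • e b y
  have hVt : ∀ y ∈ N, di C y (V y) = t y := fun y hy ↦ by
    simp only [V, t, map_sum, map_smul, (he y hy _).2]
  have ht : SmoothAlongAt C t y :=
    SmoothAlongAt.sum fun b _ ↦ (hs.smooth y hy b).smul contMDiffAt_const
  have hVy : V y = v := di_injective C y ((hVt y hy).trans hc)
  have hVs : ContMDiffAt 𝓘(ℝ, F) (𝓘(ℝ, F).prod 𝓘(ℝ, F)) ∞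
      (fun y ↦ (⟨y, V y⟩ : TangentBundle 𝓘(ℝ, F) Y)) y := by
    refine contMDiffAt_of_smoothAlongAt_di (ht.congr ?_)
    filter_upwards [hN] with y' hy' using (hVt y' hy').symm
  have hH : leafMeanCurvVector C y = ∑ a, secondFF C y (e a y) (e a y) := by
    let B : LinearMap.BilinForm ℝ (nullSpace C y) :=
      (K.g (C.i y)).compl₁₂ (di C y ∘ₗ (nullSpace C y).subtype) (di C y ∘ₗ (nullSpace C y).subtype)
    let S := (secondFFBilin C y).compl₁₂ (nullSpace C y).subtype (nullSpace C y).subtype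
    let e' : Fin m → nullSpace C y := fun a ↦ ⟨e a y, (he y hy a).1⟩
    refine sum_gram_inv_smul B (Module.finBasis ℝ (nullSpace C y)) e' (fun a b ↦ ?_) ?_ S
    · change K.g (C.i y) (di C y (e a y)) (di C y (e b y)) = _
      rw [(he y hy a).2, (he y hy b).2]
      exact (hs.basis y hy).orthonormal a b
    · refine eq_top_iff.2 fun w _ ↦ ?_
      have hw : di C y w ∈ Submodule.span ℝ (Set.range fun a ↦ s a y) := by
        rw [(hs.basis y hy).span]
        exact ⟨w, w.2, rfl⟩
      obtain ⟨c, hc⟩ := (Submodule.mem_span_range_iff_exists_fun ℝ).1 hw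
      refine (Submodule.mem_span_range_iff_exists_fun ℝ).2 ⟨c, ?_⟩
      refine Subtype.ext (di_injective C y ?_)
      rw [← hc, Submodule.coe_sum, map_sum]
      refine Finset.sum_congr rfl fun a _ ↦ ?_
      rw [Submodule.coe_smul, map_smul, (he y hy a).2]
  rw [meanCurvForm, LinearMap.comp_apply, hH]
  change K.om (C.i y) (∑ a, secondFF C y (e a y) (e a y)) (di C y v) = _
  rw [map_sum, sum_apply, ← Finset.sum_neg_distrib]
  refine Finset.sum_congr rfl fun a _ ↦ ?_
  have hcongr : ∀ᶠ y' in 𝓝 y, di C y' (e a y') = s a y' := by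
    filter_upwards [hN] with y' hy' using (he y' hy' a).2
  have hcongr' : ∀ᶠ y' in 𝓝 y, di C y' (V y') = t y' := by
    filter_upwards [hN] with y' hy' using hVt y' hy'
  rw [secondFF_eq (hse y hy a), om_normalPart y _ hv, pullConn_congr C hcongr]
  have h1 := mvfderiv_om (hs.smooth y hy a).diffAlongAt ht.diffAlongAt (e a y)
  rw [mvfderiv_eq_zero_of_const (c := 0)] at h1
  · have h2 := pullConn_di_sub (C := C) (hse y hy a) hVs
    rw [pullConn_congr C hcongr, pullConn_congr C hcongr', hVy] at h2
    have h3 := om_di_di y (he y hy a).1 (VectorField.mlieBracket 𝓘(ℝ, F) (e a) V y)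
    rw [← h2, (he y hy a).2, KaehlerStructure.om_comm, map_sub] at h3
    have h4 : t y = di C y v := hc
    rw [h4] at h1
    linarith
  · filter_upwards [hN] with y' hy'
    simp only [t, map_sum, map_smul, (hs.basis y' hy').om_eq_zero, smul_zero, Finset.sum_const_zero]

/-- Along the leaves, the connection form of a leaf frame is `-√-1 α`. The real part
`∑ g(s_a, ∇ s_a)` vanishes, as `s_a` has constant length. -/
theorem frameForm_eq_meanCurvForm {y : Y} (hy : y ∈ N) {v : TangentSpace 𝓘(ℝ, F) y}
    (hv : v ∈ nullSpace C y) :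
    frameForm C s y v = -Complex.I * (meanCurvForm C y v : ℂ) := by
  have hg (a : Fin m) : K.g (C.i y) (s a y) (pullConn C (s a) y v) = 0 := by
    have hd := (hs.smooth y hy a).diffAlongAt
    have h1 := mvfderiv_om hd hd.J v
    rw [mvfderiv_eq_zero_of_const (c := 1), pullConn_J hd, K.symm] at h1
    · rw [KaehlerStructure.g_apply]
      linarith
    · filter_upwards [hs.isOpen.mem_nhds hy] with y' hy'
      exact ((hs.basis y' hy').orthonormal a a).trans (if_pos rfl)
  rw [hs.frameForm_apply hy, hs.meanCurvForm_eq hy hv]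
  push_cast
  rw [neg_mul_neg, Finset.mul_sum]
  refine Finset.sum_congr rfl fun a _ ↦ ?_
  rw [hg]
  simp

end IsLeafFrame

end

/-! ### Existence of leaf frames -/

/-- Expansion in an orthonormal family of the right cardinality. -/
theorem eq_sum_of_orthonormal {V : Type*} [AddCommGroup V] [Module ℝ V] [FiniteDimensional ℝ V]
    {n : ℕ} (B : LinearMap.BilinForm ℝ V) {e : Fin n → V}
    (horth : ∀ i j, B (e i) (e j) = if i = j then 1 else 0) {p : Submodule ℝ V}
    (he : ∀ a, e a ∈ p) (hp : Module.finrank ℝ p = n) {x : V} (hx : x ∈ p) :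
    x = ∑ a, B (e a) x • e a := by
  have hli : LinearIndependent ℝ e := by
    refine Fintype.linearIndependent_iff.2 fun c hc a ↦ ?_
    have h := congrArg (B (e a)) hc
    simpa [horth] using h
  have hspan : Submodule.span ℝ (Set.range e) = p := by
    refine Submodule.eq_of_le_of_finrank_eq (Submodule.span_le.2 ?_) ?_
    · rintro _ ⟨a, rfl⟩
      exact he a
    · rw [finrank_span_eq_card hli, hp, Fintype.card_fin]
  obtain ⟨c, rfl⟩ := (Submodule.mem_span_range_iff_exists_fun ℝ).1 (hspan ▸ hx)
  refine Finset.sum_congr rfl fun a _ ↦ ?_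
  simp [horth]

section

variable {E : Type*} [NormedAddCommGroup E] [NormedSpace ℝ E] [FiniteDimensional ℝ E]
  [CompleteSpace E]
  {X : Type*} [TopologicalSpace X] [ChartedSpace E X] [IsManifold 𝓘(ℝ, E) ∞ X]
  {F : Type*} [NormedAddCommGroup F] [NormedSpace ℝ F] [FiniteDimensional ℝ F]
  {Y : Type*} [TopologicalSpace Y] [ChartedSpace F Y] [IsManifold 𝓘(ℝ, F) ∞ Y]
  {G : Type*} [NormedAddCommGroup G] [NormedSpace ℝ G]
  {K : KaehlerStructure E X} {C : CoisotropicEmbedding F Y K}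

theorem eventually_contMDiffAt_extend (x : X) (v : TangentSpace 𝓘(ℝ, E) x) :
    ∀ᶠ x' in 𝓝 x, ContMDiffAt 𝓘(ℝ, E) (𝓘(ℝ, E).prod 𝓘(ℝ, E)) ∞
      (fun x' ↦ (⟨x', FiberBundle.extend E v x'⟩ : TangentBundle 𝓘(ℝ, E) X)) x' := by
  filter_upwards [(trivializationAt_snd_extend x v).eventually_nhds,
    (trivializationAt E (TangentSpace 𝓘(ℝ, E)) x).open_baseSet.mem_nhds
      (FiberBundle.mem_baseSet_trivializationAt E _ x)] with x' h1 h2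
  rw [Bundle.Trivialization.contMDiffAt_section_iff
    (e := trivializationAt E (TangentSpace 𝓘(ℝ, E)) x) h2]
  exact contMDiffAt_const.congr_of_eventuallyEq h1

theorem SmoothAlongAt.g {s s' : ∀ y : Y, TangentSpace 𝓘(ℝ, E) (C.i y)} {y : Y}
    (hs : SmoothAlongAt C s y) (hs' : SmoothAlongAt C s' y) :
    ContMDiffAt 𝓘(ℝ, F) 𝓘(ℝ, ℝ) ∞ (fun y ↦ K.g (C.i y) (s y) (s' y)) y := hs.om hs'.J

theorem SmoothAlongAt.normalize {s : ∀ y : Y, TangentSpace 𝓘(ℝ, E) (C.i y)} {y : Y}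
    (hs : SmoothAlongAt C s y) (h : s y ≠ 0) :
    SmoothAlongAt C (fun y ↦ (√(K.g (C.i y) (s y) (s y)))⁻¹ • s y) y := by
  have hpos : 0 < K.g (C.i y) (s y) (s y) := K.pos _ _ h
  refine SmoothAlongAt.smul ?_ hs
  have h1 : ContDiffAt ℝ ∞ (fun r : ℝ ↦ (√r)⁻¹) (K.g (C.i y) (s y) (s y)) :=
    (Real.contDiffAt_sqrt hpos.ne').inv (Real.sqrt_ne_zero'.2 hpos)
  exact ContMDiffAt.comp (g := fun r : ℝ ↦ (√r)⁻¹) y h1.contMDiffAt (hs.g hs)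

/-- One step of the Gram-Schmidt process, for sections of `i^*TX`. -/
theorem exists_orthonormal_step {n : ℕ} {t : ℕ → ∀ y : Y, TangentSpace 𝓘(ℝ, E) (C.i y)} {y : Y}
    (ht : ∀ᶠ y' in 𝓝 y, ∀ a < n, SmoothAlongAt C (t a) y')
    (horth : ∀ᶠ y' in 𝓝 y, ∀ a < n, ∀ b < n,
      K.g (C.i y') (t a y') (t b y') = if a = b then 1 else 0)
    {s : ∀ y : Y, TangentSpace 𝓘(ℝ, E) (C.i y)} (hs : ∀ᶠ y' in 𝓝 y, SmoothAlongAt C s y')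
    (hsy : s y ∉ Submodule.span ℝ ((fun a ↦ t a y) '' Finset.range n)) :
    ∃ t' : ∀ y : Y, TangentSpace 𝓘(ℝ, E) (C.i y), (∀ᶠ y' in 𝓝 y, SmoothAlongAt C t' y') ∧
      (∀ᶠ y' in 𝓝 y, K.g (C.i y') (t' y') (t' y') = 1 ∧
        ∀ a < n, K.g (C.i y') (t a y') (t' y') = 0) ∧
      ∀ (y' : Y) (W : Submodule ℝ (TangentSpace 𝓘(ℝ, E) (C.i y'))), s y' ∈ W →
        (∀ a < n, t a y' ∈ W) → t' y' ∈ W := by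
  let r : ∀ y : Y, TangentSpace 𝓘(ℝ, E) (C.i y) := fun y ↦
    s y + ∑ a ∈ Finset.range n, (-K.g (C.i y) (t a y) (s y)) • t a y
  have hr : ∀ᶠ y' in 𝓝 y, SmoothAlongAt C r y' := by
    filter_upwards [ht, hs] with y' h1 h2
    refine h2.add (SmoothAlongAt.sum fun a ha ↦ ?_)
    have h3 := h1 a (Finset.mem_range.1 ha)
    exact (h3.smul (h3.g h2).neg)
  have hry : r y ≠ 0 := by
    intro h
    refine hsy ?_
    have h1 : s y = ∑ a ∈ Finset.range n, K.g (C.i y) (t a y) (s y) • t a y := by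
      simp only [r, neg_smul, Finset.sum_neg_distrib] at h
      exact add_neg_eq_zero.1 h
    rw [h1]
    exact sum_mem fun a ha ↦ Submodule.smul_mem _ _ (Submodule.subset_span ⟨a, ha, rfl⟩)
  have hr0 : ∀ᶠ y' in 𝓝 y, r y' ≠ 0 := by
    have hcont := (hr.self_of_nhds.g hr.self_of_nhds).continuousAt
    filter_upwards [hcont.eventually (lt_mem_nhds (K.pos _ _ hry))] with y' h h0
    rw [h0] at h
    simp at h
  refine ⟨fun y ↦ (√(K.g (C.i y) (r y) (r y)))⁻¹ • r y, ?_, ?_, ?_⟩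
  · filter_upwards [hr, hr0] with y' h1 h2 using h1.normalize h2
  · filter_upwards [hr0, horth] with y' h1 h2
    have hpos : 0 < K.g (C.i y') (r y') (r y') := K.pos _ _ h1
    constructor
    · simp only [map_smul, LinearMap.smul_apply, smul_eq_mul]
      rw [← mul_assoc, ← mul_inv, Real.mul_self_sqrt hpos.le, inv_mul_cancel₀ hpos.ne']
    · intro a ha
      have h3 : K.g (C.i y') (t a y') (r y') = 0 := by
        simp only [r, map_add, map_sum, map_smul, smul_eq_mul]
        rw [Finset.sum_eq_single a]
        · rw [h2 a ha a ha, if_pos rfl]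
          ring
        · intro b hb hba
          rw [h2 a ha b (Finset.mem_range.1 hb), if_neg hba.symm, mul_zero]
        · exact fun h ↦ absurd (Finset.mem_range.2 ha) h
      rw [map_smul, h3, smul_zero]
  · intro y' W h1 h2
    exact Submodule.smul_mem _ _ (add_mem h1 (sum_mem fun a ha ↦
      Submodule.smul_mem _ _ (h2 a (Finset.mem_range.1 ha))))

theorem exists_notMem_span_image {V : Type*} [AddCommGroup V] [Module ℝ V] [FiniteDimensional ℝ V]
    (p : Submodule ℝ V) {n : ℕ} (h : n < Module.finrank ℝ p) (t : ℕ → V) :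
    ∃ v ∈ p, v ∉ Submodule.span ℝ (t '' Finset.range n) := by
  classical
  by_contra! hp
  have h1 : p ≤ Submodule.span ℝ (((Finset.range n).image t : Finset V) : Set V) := by
    rw [Finset.coe_image]
    exact hp
  have h2 := Submodule.finrank_mono h1
  have h3 := finrank_span_finset_le_card (R := ℝ) ((Finset.range n).image t)
  have h4 := Finset.card_image_le (s := Finset.range n) (f := t)
  rw [Finset.card_range] at h4
  exact absurd h (not_lt.2 (h2.trans (h3.trans h4)))

variable (C) in
theorem finrank_range_di (y : Y) :
    Module.finrank ℝ (LinearMap.range (di C y)) = Module.finrank ℝ F :=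
  LinearMap.finrank_range_of_inj (di_injective C y)

variable (C) in
/-- Near each point of `Y` there is a smooth orthonormal frame of `i^*TX` whose first vectors
are tangent to `Y`. -/
theorem exists_orthonormal_frame (y : Y) (n : ℕ) (hn : n ≤ Module.finrank ℝ E) :
    ∃ t : ℕ → ∀ y : Y, TangentSpace 𝓘(ℝ, E) (C.i y),
      (∀ᶠ y' in 𝓝 y, ∀ a < n, SmoothAlongAt C (t a) y') ∧
      (∀ᶠ y' in 𝓝 y, ∀ a < n, ∀ b < n,
        K.g (C.i y') (t a y') (t b y') = if a = b then 1 else 0) ∧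
      ∀ y' : Y, ∀ a < n, a < Module.finrank ℝ F → t a y' ∈ LinearMap.range (di C y') := by
  induction n with
  | zero => exact ⟨fun _ _ ↦ 0, by simp, by simp, by simp⟩
  | succ n ih =>
    obtain ⟨t, ht, horth, hrange⟩ := ih (by omega)
    obtain ⟨s, hs, hsy, hsr⟩ : ∃ s : ∀ y : Y, TangentSpace 𝓘(ℝ, E) (C.i y),
        (∀ᶠ y' in 𝓝 y, SmoothAlongAt C s y') ∧
        s y ∉ Submodule.span ℝ ((fun a ↦ t a y) '' Finset.range n) ∧
        (n < Module.finrank ℝ F → ∀ y', s y' ∈ LinearMap.range (di C y')) := by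
      by_cases hnF : n < Module.finrank ℝ F
      · obtain ⟨_, ⟨v, rfl⟩, hv⟩ := exists_notMem_span_image (LinearMap.range (di C y))
          (by rwa [finrank_range_di]) (fun a ↦ t a y)
        refine ⟨fun y' ↦ di C y' (FiberBundle.extend F v y'), ?_, ?_, fun _ y' ↦ ⟨_, rfl⟩⟩
        · filter_upwards [eventually_contMDiffAt_extend y v] with y' h using smoothAlongAt_di h
        · beta_reduce
          rwa [FiberBundle.extend_apply_self]
      · obtain ⟨v, -, hv⟩ := exists_notMem_span_image (⊤ : Submodule ℝ (TangentSpace 𝓘(ℝ, E) (C.i y)))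
          (n := n) (by rw [finrank_top]; exact hn) (fun a ↦ t a y)
        refine ⟨fun y' ↦ FiberBundle.extend E v (C.i y'), ?_, ?_, fun h ↦ absurd h hnF⟩
        · filter_upwards [(contMDiff_i C).continuous.continuousAt.eventually
            (eventually_contMDiffAt_extend (C.i y) v)] with y' h using smoothAlongAt_comp h
        · beta_reduce
          rwa [FiberBundle.extend_apply_self]
    obtain ⟨t', h1, h2, h3⟩ := exists_orthonormal_step ht horth hs hsy
    refine ⟨Function.update t n t', ?_, ?_, ?_⟩
    · filter_upwards [ht, h1] with y' ht h1 a ha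
      rcases Nat.lt_succ_iff_lt_or_eq.1 ha with ha | rfl
      · rw [Function.update_of_ne ha.ne]
        exact ht a ha
      · rw [Function.update_self]
        exact h1
    · filter_upwards [horth, h2] with y' horth h2 a ha b hb
      rcases Nat.lt_succ_iff_lt_or_eq.1 ha with ha | rfl
      · rw [Function.update_of_ne ha.ne]
        rcases Nat.lt_succ_iff_lt_or_eq.1 hb with hb | rfl
        · rw [Function.update_of_ne hb.ne]
          exact horth a ha b hb
        · rw [Function.update_self, h2.2 a ha, if_neg ha.ne]
      · rw [Function.update_self]
        rcases Nat.lt_succ_iff_lt_or_eq.1 hb with hb | rfl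
        · rw [Function.update_of_ne hb.ne, KaehlerStructure.g_comm, h2.2 b hb, if_neg hb.ne']
        · rw [Function.update_self, h2.1, if_pos rfl]
    · intro y' a ha haF
      rcases Nat.lt_succ_iff_lt_or_eq.1 ha with ha | rfl
      · rw [Function.update_of_ne ha.ne]
        exact hrange y' a ha haF
      · rw [Function.update_self]
        exact h3 y' _ (hsr haF y') fun b hb ↦ hrange y' b hb (hb.trans haF)

/-- If the first vectors of an orthonormal frame span `TY`, then `J` maps the remaining ones to
an orthonormal frame of `T𝓕 = (TY)^ω = J (TY)^⊥`. -/
theorem isLeafBasis_J {m : ℕ} (hm : Module.finrank ℝ E = Module.finrank ℝ F + m) {y : Y}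
    {t : ℕ → TangentSpace 𝓘(ℝ, E) (C.i y)}
    (horth : ∀ a < Module.finrank ℝ E, ∀ b < Module.finrank ℝ E,
        K.g (C.i y) (t a) (t b) = if a = b then 1 else 0)
    (hrange : ∀ a < Module.finrank ℝ F, t a ∈ LinearMap.range (di C y)) :
    IsLeafBasis C y (fun a : Fin m ↦ K.J (C.i y) (t (Module.finrank ℝ F + a))) := by
  have htan {w : TangentSpace 𝓘(ℝ, E) (C.i y)} (hw : w ∈ LinearMap.range (di C y)) :=
    eq_sum_of_orthonormal (K.g (C.i y)) (e := fun a : Fin (Module.finrank ℝ F) ↦ t a)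
      (fun a b ↦ by rw [horth a (by omega) b (by omega)]; simp [Fin.ext_iff])
      (fun a ↦ hrange a a.2) (finrank_range_di C y) hw
  have hall (w : TangentSpace 𝓘(ℝ, E) (C.i y)) :=
    eq_sum_of_orthonormal (K.g (C.i y)) (e := fun a : Fin (Module.finrank ℝ E) ↦ t a)
      (fun a b ↦ by rw [horth a a.2 b b.2]; simp [Fin.ext_iff])
      (p := ⊤) (fun a ↦ trivial) (finrank_top ℝ _) (x := w) trivial
  have hnormal (a : Fin m) {w : TangentSpace 𝓘(ℝ, E) (C.i y)} (hw : w ∈ LinearMap.range (di C y)) :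
      K.g (C.i y) w (t (Module.finrank ℝ F + a)) = 0 := by
    rw [htan hw, map_sum, LinearMap.sum_apply]
    refine Finset.sum_eq_zero fun b _ ↦ ?_
    rw [map_smul, LinearMap.smul_apply, horth b (by omega) _ (by omega), if_neg (by omega), smul_zero]
  refine ⟨fun a b ↦ ?_, le_antisymm (Submodule.span_le.2 ?_) ?_⟩
  · rw [KaehlerStructure.g_J_J, horth _ (by omega) _ (by omega)]
    simp [Fin.ext_iff]
  · rintro _ ⟨a, rfl⟩
    have h (v : TangentSpace 𝓘(ℝ, F) y) :
        K.om (C.i y) (di C y v) (K.J (C.i y) (t (Module.finrank ℝ F + a))) = 0 :=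
      hnormal a (LinearMap.mem_range_self _ v)
    obtain ⟨v, hv⟩ := C.coisotropic y _ h
    refine ⟨v, fun w ↦ ?_, hv⟩
    have hv' : di C y v = K.J (C.i y) (t (Module.finrank ℝ F + a)) := hv
    rw [hv']
    exact h w
  · rintro _ ⟨v, hv, rfl⟩
    have h1 := hall (K.J (C.i y) (di C y v))
    have h2 : di C y v = ∑ a : Fin (Module.finrank ℝ E),
        (-K.g (C.i y) (t a) (K.J (C.i y) (di C y v))) • K.J (C.i y) (t a) := by
      have h3 := congrArg (fun w ↦ -K.J (C.i y) w) h1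
      simpa [K.J_sq, map_sum] using h3
    rw [h2]
    refine sum_mem fun a _ ↦ ?_
    by_cases ha : (a : ℕ) < Module.finrank ℝ F
    · rw [KaehlerStructure.g_J_right, om_eq_zero_of_mem y (hrange a ha) ⟨v, hv, rfl⟩]
      simp
    · refine Submodule.smul_mem _ _ (Submodule.subset_span ⟨⟨a - Module.finrank ℝ F, by omega⟩, ?_⟩)
      have : Module.finrank ℝ F + ((a : ℕ) - Module.finrank ℝ F) = a := by omega
      simp [this]

variable (C) in
/-- Leaf frames exist near every point of `Y`. -/
theorem exists_isLeafFrame {m : ℕ} (hm : Module.finrank ℝ E = Module.finrank ℝ F + m) (y : Y) :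
    ∃ (N : Set Y) (s : Fin m → ∀ y : Y, TangentSpace 𝓘(ℝ, E) (C.i y)) (u : Fin m → ∀ y : Y, E10 C y),
      y ∈ N ∧ IsLeafFrame C N s u := by
  classical
  obtain ⟨t, h1, h2, h3⟩ := exists_orthonormal_frame C y _ le_rfl
  obtain ⟨N, hN, hNo, hy⟩ := mem_nhds_iff.1 (h1.and h2)
  let s : Fin m → ∀ y : Y, TangentSpace 𝓘(ℝ, E) (C.i y) :=
    fun a y ↦ K.J (C.i y) (t (Module.finrank ℝ F + a) y)
  have hb : ∀ y' ∈ N, IsLeafBasis C y' (fun a ↦ s a y') := fun y' hy' ↦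
    isLeafBasis_J (t := fun a ↦ t a y') hm (hN hy').2 fun a ha ↦ h3 y' a (by omega) ha
  refine ⟨N, s, fun a y ↦ if h : y ∈ N then ⟨K.holPart (C.i y) (s a y), (hb y h).holPart_mem a⟩ else 0,
    hy, hNo, fun y' hy' a ↦ ((hN hy').1 _ (by omega)).J, hb, fun y' hy' a ↦ ?_⟩
  rw [dif_pos hy']

end

section

variable {E : Type*} [NormedAddCommGroup E] [NormedSpace ℝ E] [FiniteDimensional ℝ E]
  [CompleteSpace E]
  {X : Type*} [TopologicalSpace X] [ChartedSpace E X] [IsManifold 𝓘(ℝ, E) ∞ X]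
  {F : Type*} [NormedAddCommGroup F] [NormedSpace ℝ F] [FiniteDimensional ℝ F]
  {Y : Type*} [TopologicalSpace Y] [ChartedSpace F Y] [IsManifold 𝓘(ℝ, F) ∞ Y]
  {G : Type*} [NormedAddCommGroup G] [NormedSpace ℝ G]
  {K : KaehlerStructure E X} {C : CoisotropicEmbedding F Y K}
  [T2Space X]

/-! ### The exterior derivative of the trace of the connection forms -/

variable (K) in
/-- `X` as a coisotropic submanifold of itself. The calculus of sections of `i^*TX` for this
embedding is the calculus of vector fields on `X`. -/
def idEmbedding : CoisotropicEmbedding E X K where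
  i := id
  embedding := .id
  coisotropic x w _ := ⟨w, by rw [mfderiv_id]; rfl⟩

theorem di_idEmbedding (x : X) (v : TangentSpace 𝓘(ℝ, E) x) : di (idEmbedding K) x v = v := by
  change mfderiv 𝓘(ℝ, E) 𝓘(ℝ, E) id x v = v
  rw [mfderiv_id]
  rfl

/-- The coordinates of a tangent vector at `x'` in the chart at `x` give its expansion in the
coordinate frame. -/
theorem extend_trivializationAt_snd {x x' : X}
    (hx : x' ∈ (trivializationAt E (TangentSpace 𝓘(ℝ, E)) x).baseSet)
    (w : TangentSpace 𝓘(ℝ, E) x') (v : TangentSpace 𝓘(ℝ, E) x)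
    (hv : (trivializationAt E (TangentSpace 𝓘(ℝ, E)) x (⟨x', w⟩ : TangentBundle 𝓘(ℝ, E) X)).2 = v) :
    FiberBundle.extend E v x' = w := by
  have h : (trivializationAt E (TangentSpace 𝓘(ℝ, E)) x (⟨x, v⟩ : TangentBundle 𝓘(ℝ, E) X)).2 = v := by
    rw [trivializationAt_snd_eq_mvfderiv (mem_chart_source E x), mvfderiv_extChartAt_self]
  simp only [FiberBundle.extend]
  rw [h, ← hv, ← Bundle.Trivialization.symmL_apply (R := ℝ) _ hx]
  have := (trivializationAt E (TangentSpace 𝓘(ℝ, E)) x).symmL_continuousLinearMapAt (R := ℝ) hx w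
  rwa [Bundle.Trivialization.continuousLinearMapAt_apply, Bundle.Trivialization.linearMapAt_apply,
    if_pos hx] at this

/-- The coordinate frame around `x`: near `x`, the vector with coordinates `∑ c_j b_j` is
`∑ c_j ∂_j`. -/
theorem extend_sum {ι : Type*} [Fintype ι] (x : X) (b : ι → TangentSpace 𝓘(ℝ, E) x) :
    ∀ᶠ x' in 𝓝 x, ∀ c : ι → ℝ, FiberBundle.extend E (∑ j, c j • b j) x' =
      ∑ j, c j • FiberBundle.extend E (b j) x' := by
  have hx := FiberBundle.mem_baseSet_trivializationAt E (TangentSpace 𝓘(ℝ, E)) x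
  filter_upwards [(trivializationAt E (TangentSpace 𝓘(ℝ, E)) x).open_baseSet.mem_nhds hx] with x' hx' c
  have h (v : TangentSpace 𝓘(ℝ, E) x) : FiberBundle.extend E v x' =
      (trivializationAt E (TangentSpace 𝓘(ℝ, E)) x).symmL ℝ x'
        ((trivializationAt E (TangentSpace 𝓘(ℝ, E)) x).continuousLinearMapAt ℝ x v) := by
    rw [Bundle.Trivialization.continuousLinearMapAt_apply, Bundle.Trivialization.linearMapAt_apply,
      if_pos hx, Bundle.Trivialization.symmL_apply _ hx']
    rfl
  simp only [h, map_sum, map_smul]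

theorem mdifferentiableAt_sum {ι : Type*} (t : Finset ι) {f : ι → Y → G} {y : Y}
    (hf : ∀ j ∈ t, MDifferentiableAt 𝓘(ℝ, F) 𝓘(ℝ, G) (f j) y) :
    MDifferentiableAt 𝓘(ℝ, F) 𝓘(ℝ, G) (fun y ↦ ∑ j ∈ t, f j y) y := by
  classical
  induction t using Finset.induction_on with
  | empty => simpa using mdifferentiableAt_const
  | insert a t ha ih =>
    simp only [Finset.sum_insert ha]
    exact (hf a (Finset.mem_insert_self a t)).add (ih fun j hj ↦ hf j (Finset.mem_insert_of_mem hj))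

theorem mvfderiv_sum {ι : Type*} (t : Finset ι) {f : ι → Y → G} {y : Y}
    (hf : ∀ j ∈ t, MDifferentiableAt 𝓘(ℝ, F) 𝓘(ℝ, G) (f j) y) (v : TangentSpace 𝓘(ℝ, F) y) :
    mvfderiv 𝓘(ℝ, F) (fun y ↦ ∑ j ∈ t, f j y) y v = ∑ j ∈ t, mvfderiv 𝓘(ℝ, F) (f j) y v := by
  classical
  induction t using Finset.induction_on with
  | empty =>
    simpa using mvfderiv_eq_zero_of_const (c := (0 : G)) (Filter.Eventually.of_forall fun _ ↦ rfl) v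
  | insert a t ha ih =>
    have ht : ∀ j ∈ t, MDifferentiableAt 𝓘(ℝ, F) 𝓘(ℝ, G) (f j) y :=
      fun j hj ↦ hf j (Finset.mem_insert_of_mem hj)
    simp only [Finset.sum_insert ha]
    rw [mvfderiv_fun_add (hf a (Finset.mem_insert_self a t)) (mdifferentiableAt_sum t ht),
      add_apply, ih ht]

/-- Pulling back along `i` commutes with the exterior derivative of one-forms. In coordinates
`θ = ∑ P_j dx_j`; the derivatives of the components of `di(V)` and `di(W)` add up to `di([V, W])`, and
the derivatives of `P_j` give `dθ`. The hypothesis is that the `P_j` are differentiable. -/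
theorem dOneForm_di {θ : ∀ x : X, TangentSpace 𝓘(ℝ, E) x →ₗ[ℝ] ℂ} {y : Y}
    (hθ : ∀ v : TangentSpace 𝓘(ℝ, E) (C.i y), MDifferentiableAt 𝓘(ℝ, E) 𝓘(ℝ, ℂ)
      (fun x ↦ θ x (FiberBundle.extend E v x)) (C.i y))
    {V W : ∀ y : Y, TangentSpace 𝓘(ℝ, F) y}
    (hV : ContMDiffAt 𝓘(ℝ, F) (𝓘(ℝ, F).prod 𝓘(ℝ, F)) ∞
      (fun y ↦ (⟨y, V y⟩ : TangentBundle 𝓘(ℝ, F) Y)) y)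
    (hW : ContMDiffAt 𝓘(ℝ, F) (𝓘(ℝ, F).prod 𝓘(ℝ, F)) ∞
      (fun y ↦ (⟨y, W y⟩ : TangentBundle 𝓘(ℝ, F) Y)) y) :
    mvfderiv 𝓘(ℝ, F) (fun y' ↦ θ (C.i y') (di C y' (W y'))) y (V y) -
      mvfderiv 𝓘(ℝ, F) (fun y' ↦ θ (C.i y') (di C y' (V y'))) y (W y) -
      θ (C.i y) (di C y (VectorField.mlieBracket 𝓘(ℝ, F) V W y)) =
      dOneForm θ (C.i y) (di C y (V y)) (di C y (W y)) := by
  let b : Module.Basis (Fin (Module.finrank ℝ E)) ℝ E := Module.finBasis ℝ E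
  let P : Fin (Module.finrank ℝ E) → X → ℂ :=
    fun j x ↦ θ x (FiberBundle.extend E (show TangentSpace 𝓘(ℝ, E) (C.i y) from b j) x)
  have hP (j) : MDifferentiableAt 𝓘(ℝ, E) 𝓘(ℝ, ℂ) (P j) (C.i y) := hθ _
  let A : Fin (Module.finrank ℝ E) → E →L[ℝ] ℝ := fun j ↦ (b.coord j).toContinuousLinearMap
  -- `θ` in coordinates
  have hθv : ∀ᶠ x in 𝓝 (C.i y), ∀ v : TangentSpace 𝓘(ℝ, E) (C.i y),
      θ x (FiberBundle.extend E v x) = ∑ j, (A j v : ℂ) * P j x := by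
    filter_upwards [extend_sum (C.i y) fun j ↦ (show TangentSpace 𝓘(ℝ, E) (C.i y) from b j)] with x hx v
    have h1 : v = ∑ j, A j v • (show TangentSpace 𝓘(ℝ, E) (C.i y) from b j) := (b.sum_repr v).symm
    conv_lhs => rw [h1, hx]
    simp only [map_sum, map_smul, Complex.real_smul]
    rfl
  have hd (v w : TangentSpace 𝓘(ℝ, E) (C.i y)) :
      mvfderiv 𝓘(ℝ, E) (fun x ↦ θ x (FiberBundle.extend E w x)) (C.i y) v =
        ∑ j, (A j w : ℂ) * mvfderiv 𝓘(ℝ, E) (P j) (C.i y) v := by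
    have h1 (j) : MDifferentiableAt 𝓘(ℝ, E) 𝓘(ℝ, ℂ) (fun x ↦ (A j w : ℂ) * P j x) (C.i y) :=
      (mdifferentiableAt_const.hasMFDerivAt.mul' (hP j).hasMFDerivAt).mdifferentiableAt
    rw [mvfderiv_congr (hθv.mono fun x hx ↦ hx w), mvfderiv_sum _ fun j _ ↦ h1 j]
    refine Finset.sum_congr rfl fun j _ ↦ ?_
    rw [mvfderiv_mul_complex (f := fun _ ↦ (A j w : ℂ)) mdifferentiableAt_const (hP j),
      mvfderiv_eq_zero_of_const (c := (A j w : ℂ)) (Filter.Eventually.of_forall fun _ ↦ rfl), zero_mul,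
      add_zero]
  let τ : (∀ y : Y, TangentSpace 𝓘(ℝ, F) y) → Y → E := fun W y' ↦
    (trivializationAt E (TangentSpace 𝓘(ℝ, E)) (C.i y)
      (⟨C.i y', di C y' (W y')⟩ : TangentBundle 𝓘(ℝ, E) X)).2
  have hτ (v : TangentSpace 𝓘(ℝ, E) (C.i y)) : (trivializationAt E (TangentSpace 𝓘(ℝ, E)) (C.i y)
      (⟨C.i y, v⟩ : TangentBundle 𝓘(ℝ, E) X)).2 = v := by
    rw [trivializationAt_snd_eq_mvfderiv (mem_chart_source E _), mvfderiv_extChartAt_self]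
  have hexp (W : ∀ y : Y, TangentSpace 𝓘(ℝ, F) y) :
      (fun y' ↦ θ (C.i y') (di C y' (W y'))) =ᶠ[𝓝 y] fun y' ↦ ∑ j, (A j (τ W y') : ℂ) * P j (C.i y') := by
    filter_upwards [(contMDiff_i C).continuous.continuousAt.eventually hθv,
      eventually_mem_baseSet C y] with y' h1 h2
    refine Eq.trans ?_ (h1 (τ W y'))
    rw [extend_trivializationAt_snd h2 (di C y' (W y')) (τ W y') rfl]
  have hdτ {V W : ∀ y : Y, TangentSpace 𝓘(ℝ, F) y}
      (hW : ContMDiffAt 𝓘(ℝ, F) (𝓘(ℝ, F).prod 𝓘(ℝ, F)) ∞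
        (fun y ↦ (⟨y, W y⟩ : TangentBundle 𝓘(ℝ, F) Y)) y) :
      mvfderiv 𝓘(ℝ, F) (fun y' ↦ θ (C.i y') (di C y' (W y'))) y (V y) =
        ∑ j, ((A j (mvfderiv 𝓘(ℝ, F) (τ W) y (V y)) : ℂ) * P j (C.i y) +
          (A j (di C y (W y)) : ℂ) * mvfderiv 𝓘(ℝ, E) (P j) (C.i y) (di C y (V y))) := by
    have h0 : MDifferentiableAt 𝓘(ℝ, F) 𝓘(ℝ, E) (τ W) y :=
      (smoothAlongAt_iff.1 (smoothAlongAt_di (C := C) hW)).mdifferentiableAt (by simp)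
    have h1 (j) : MDifferentiableAt 𝓘(ℝ, F) 𝓘(ℝ, ℂ) (fun y' ↦ (A j (τ W y') : ℂ)) y :=
      (Complex.ofRealCLM.comp (A j)).mdifferentiableAt.comp y h0
    have h2 (j) : MDifferentiableAt 𝓘(ℝ, F) 𝓘(ℝ, ℂ) (fun y' ↦ P j (C.i y')) y :=
      (hP j).comp y (mdifferentiableAt_i C y)
    have h3 (j) : MDifferentiableAt 𝓘(ℝ, F) 𝓘(ℝ, ℂ)
        (fun y' ↦ (A j (τ W y') : ℂ) * P j (C.i y')) y :=
      ((h1 j).hasMFDerivAt.mul' (h2 j).hasMFDerivAt).mdifferentiableAt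
    have h4 : τ W y = di C y (W y) := hτ _
    rw [mvfderiv_congr (hexp W), mvfderiv_sum _ fun j _ ↦ h3 j]
    refine Finset.sum_congr rfl fun j _ ↦ ?_
    have h5 : mvfderiv 𝓘(ℝ, F) (fun y' ↦ (A j (τ W y') : ℂ)) y (V y) =
        (A j (mvfderiv 𝓘(ℝ, F) (τ W) y (V y)) : ℂ) :=
      mvfderiv_clm_comp (Complex.ofRealCLM.comp (A j)) h0 _
    have h6 : mvfderiv 𝓘(ℝ, F) (fun y' ↦ P j (C.i y')) y (V y) =
        mvfderiv 𝓘(ℝ, E) (P j) (C.i y) (di C y (V y)) :=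
      mvfderiv_comp_apply' (hP j) (mdifferentiableAt_i C y) _
    rw [mvfderiv_mul_complex (h1 j) (h2 j), h5, h6, h4, add_comm]
  have hbr := mvfderiv_di_sub (C := C) hV hW
  rw [hτ] at hbr
  have hθ0 := hθv.self_of_nhds
  have hθbr : θ (C.i y) (di C y (VectorField.mlieBracket 𝓘(ℝ, F) V W y)) = ∑ j,
      ((A j (mvfderiv 𝓘(ℝ, F) (τ W) y (V y)) : ℂ) * P j (C.i y) -
        (A j (mvfderiv 𝓘(ℝ, F) (τ V) y (W y)) : ℂ) * P j (C.i y)) := by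
    have h1 := hθ0 (di C y (VectorField.mlieBracket 𝓘(ℝ, F) V W y))
    rw [FiberBundle.extend_apply_self] at h1
    rw [h1]
    refine Finset.sum_congr rfl fun j _ ↦ ?_
    rw [← sub_mul, ← Complex.ofReal_sub]
    congr 2
    exact (congrArg (A j) hbr.symm).trans (map_sub (A j) _ _)
  rw [hdτ hW, hdτ hV, hθbr, dOneForm, mlieBracket_extend, map_zero, sub_zero, hd, hd,
    ← Finset.sum_sub_distrib, ← Finset.sum_sub_distrib, ← Finset.sum_sub_distrib]
  refine Finset.sum_congr rfl fun j _ ↦ ?_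
  ring

namespace IsAdaptedFrame

variable {k m : ℕ} {U : Set X} {e : Fin k ⊕ Fin m → ∀ x : X, TangentSpace 𝓘(ℝ, E) x}
  (he : IsAdaptedFrame C U e)
include he

/-- The formula for the connection form of a leaf frame, on `X` in place of `Y`. -/
theorem connTrace_apply {x : X} (hx : x ∈ U) (w : TangentSpace 𝓘(ℝ, E) x) :
    connTrace K e x w = ∑ α : Fin m,
      (K.g x (e (Sum.inr α) x) (pullConn (idEmbedding K) (e (Sum.inr α)) x w) +
        Complex.I * K.om x (e (Sum.inr α) x) (pullConn (idEmbedding K) (e (Sum.inr α)) x w)) := by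
  rw [connTrace, LinearMap.sum_apply]
  refine Finset.sum_congr rfl fun α _ ↦ ?_
  have h := he.contMDiffAt hx (Sum.inr α)
  have h1 := pullConnC_holPart_comp (C := idEmbedding K) (y := x) h w
  have h2 := pullConnC_holPart (C := idEmbedding K) (y := x)
    (smoothAlongAt_comp (C := idEmbedding K) (y := x) h).diffAlongAt w
  have h3 : di (idEmbedding K) x w = w := di_idEmbedding x w
  have h4 : K.connC (K.u e (Sum.inr α)) x w =
      K.holPart x (pullConn (idEmbedding K) (e (Sum.inr α)) x w) := by
    refine Eq.trans ?_ (h1.symm.trans h2)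
    exact congrArg (K.connC (K.u e (Sum.inr α)) x) h3.symm
  change K.hermCovector x (e (Sum.inr α) x) (K.connC (K.u e (Sum.inr α)) x w) = _
  rw [h4]
  exact KaehlerStructure.hermCovector_holPart _ _ _

/-- The components of `ω^α_α` in a coordinate frame are differentiable on `U`. -/
theorem mdifferentiableAt_connTrace {x : X} (hx : x ∈ U) (v : TangentSpace 𝓘(ℝ, E) x) :
    MDifferentiableAt 𝓘(ℝ, E) 𝓘(ℝ, ℂ) (fun x ↦ connTrace K e x (FiberBundle.extend E v x)) x := by
  have h : ContMDiffAt 𝓘(ℝ, E) 𝓘(ℝ, ℂ) ∞ (fun x' ↦ ∑ α : Fin m,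
      ((K.g x' (e (Sum.inr α) x') (pullConn (idEmbedding K) (e (Sum.inr α)) x'
        (FiberBundle.extend E v x')) : ℂ) +
        Complex.I * K.om x' (e (Sum.inr α) x') (pullConn (idEmbedding K) (e (Sum.inr α)) x'
          (FiberBundle.extend E v x')))) x := by
    refine ContMDiffAt.sum fun α _ ↦ ?_
    have h1 : SmoothAlongAt (idEmbedding K) (e (Sum.inr α)) x :=
      smoothAlongAt_comp (C := idEmbedding K) (y := x) (he.contMDiffAt hx (Sum.inr α))
    have h2 := h1.pullConn (contMDiffAt_extend x v)
    exact contMDiffAt_ofReal_add (h1.om h2.J) (h1.om h2)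
  refine (h.congr_of_eventuallyEq ?_).mdifferentiableAt (by simp)
  filter_upwards [he.isOpen.mem_nhds hx] with x' hx'
  exact he.connTrace_apply hx' _

theorem detCurv_eq {y : Y} (hy : C.i y ∈ U) {V W : ∀ y : Y, TangentSpace 𝓘(ℝ, F) y}
    {σ : ∀ y : Y, detE10 C m y} (hV : SmoothVectorFieldNear V y) (hW : SmoothVectorFieldNear W y)
    (hσ : SmoothDetSectionNear C σ y) :
    detCurv C V W σ y = dOneForm (connTrace K e) (C.i y) (di C y (V y)) (di C y (W y)) • σ y := by
  have hη (W : ∀ y : Y, TangentSpace 𝓘(ℝ, F) y) :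
      (fun y' ↦ frameForm C (fun (α : Fin m) y ↦ e (Sum.inr α) (C.i y)) y' (W y')) =ᶠ[𝓝 y]
        fun y' ↦ connTrace K e (C.i y') (di C y' (W y')) := by
    filter_upwards [(he.isOpen.preimage (contMDiff_i C).continuous).mem_nhds hy] with y' hy'
    exact he.frameForm_eq hy' _
  rw [he.isLeafFrame.detCurv_eq hy hV hW hσ, mvfderiv_congr (hη V), mvfderiv_congr (hη W),
    he.frameForm_eq hy, ← dOneForm_di (fun v ↦ he.mdifferentiableAt_connTrace hy v)
      hV.self_of_nhds hW.self_of_nhds]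

theorem leafConn_wedge {y : Y} (hy : C.i y ∈ U) (v : nullSpace C y) :
    leafConn C (wedge C he.uSection) y v =
      (-Complex.I * (leafMeanCurvForm C y v : ℂ)) • wedge C he.uSection y := by
  rw [leafConn, he.detConn_wedge hy, ← he.frameForm_eq hy,
    he.isLeafFrame.frameForm_eq_meanCurvForm hy v.2]
  rfl

end IsAdaptedFrame

/-- The leafwise curvature, computed in a local leaf frame. -/
theorem leafCurv_eq {m : ℕ} (hm : Module.finrank ℝ E = Module.finrank ℝ F + m) {y : Y}
    {V W : ∀ y : Y, nullSpace C y} {σ : ∀ y : Y, detE10 C m y}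
    (hV : SmoothVectorFieldNear (fun y ↦ (V y : TangentSpace 𝓘(ℝ, F) y)) y)
    (hW : SmoothVectorFieldNear (fun y ↦ (W y : TangentSpace 𝓘(ℝ, F) y)) y)
    (hσ : SmoothDetSectionNear C σ y) :
    leafCurv C V W σ y = (-Complex.I * (dLeaf C (leafMeanCurvForm C) V W y : ℂ)) • σ y := by
  obtain ⟨N, s, u, hy, hs⟩ := exists_isLeafFrame C hm y
  have hbr := coe_leafBracket hV.self_of_nhds hW.self_of_nhds
  have h1 : leafCurv C V W σ y = detCurv C (fun y ↦ (V y : TangentSpace 𝓘(ℝ, F) y))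
      (fun y ↦ (W y : TangentSpace 𝓘(ℝ, F) y)) σ y := by
    rw [detCurv, ← hbr]
    rfl
  have hη {V W : ∀ y : Y, nullSpace C y}
      (hW : SmoothVectorFieldNear (fun y ↦ (W y : TangentSpace 𝓘(ℝ, F) y)) y) :
      mvfderiv 𝓘(ℝ, F) (fun y' ↦ frameForm C s y' (W y')) y (V y : TangentSpace 𝓘(ℝ, F) y) =
        -Complex.I * (mvfderiv 𝓘(ℝ, F) (fun y' ↦ leafMeanCurvForm C y' (W y')) y
          (V y : TangentSpace 𝓘(ℝ, F) y) : ℝ) := by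
    have h2 : ∀ᶠ y' in 𝓝 y, frameForm C s y' (W y') =
        -Complex.I * (leafMeanCurvForm C y' (W y') : ℂ) := by
      filter_upwards [hs.isOpen.mem_nhds hy] with y' hy'
      exact hs.frameForm_eq_meanCurvForm hy' (W y').2
    have h3 : MDifferentiableAt 𝓘(ℝ, F) 𝓘(ℝ, ℝ) (fun y' ↦ leafMeanCurvForm C y' (W y')) y := by
      refine (mdifferentiableAt_neg_im ((hs.contMDiffAt_frameForm hy
        hW.self_of_nhds).mdifferentiableAt (by simp))).congr_of_eventuallyEq ?_
      filter_upwards [h2] with y' h2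
      rw [h2]
      simp
    rw [mvfderiv_congr h2]
    exact mvfderiv_clm_comp ((-Complex.I) • Complex.ofRealCLM) h3 _
  rw [h1, hs.detCurv_eq hy hV hW hσ, hη hW, hη hV, ← hbr,
    hs.frameForm_eq_meanCurvForm hy (leafBracket C V W y).2, dLeaf]
  congr 1
  change _ - _ - -Complex.I * (leafMeanCurvForm C y (leafBracket C V W y) : ℂ) = _
  push_cast
  ring

end

end CoisotropicKaehler

end

theorem proposition5p6 (k m : ℕ)
    {X : Type*} [TopologicalSpace X] [ChartedSpace (EuclideanSpace ℝ (Fin (2 * (k + m)))) X]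
    [IsManifold 𝓘(ℝ, EuclideanSpace ℝ (Fin (2 * (k + m)))) ∞ X] [T2Space X]
    {Y : Type*} [TopologicalSpace Y] [ChartedSpace (EuclideanSpace ℝ (Fin (2 * k + m))) Y]
    [IsManifold 𝓘(ℝ, EuclideanSpace ℝ (Fin (2 * k + m))) ∞ Y]
    (K : KaehlerStructure (EuclideanSpace ℝ (Fin (2 * (k + m)))) X)
    (C : CoisotropicEmbedding (EuclideanSpace ℝ (Fin (2 * k + m))) Y K) :
    (∀ (U : Set X)
        (e : Fin k ⊕ Fin m → ∀ x : X,
          TangentSpace 𝓘(ℝ, EuclideanSpace ℝ (Fin (2 * (k + m)))) x)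
        (he : IsAdaptedFrame C U e) (y : Y), C.i y ∈ U →
      (∀ v : TangentSpace 𝓘(ℝ, EuclideanSpace ℝ (Fin (2 * k + m))) y,
        detConn C (wedge C he.uSection) y v =
          connTrace K e (C.i y) (di C y v) • wedge C he.uSection y) ∧
      (∀ v : nullSpace C y,
        leafConn C (wedge C he.uSection) y v =
          (-Complex.I * (leafMeanCurvForm C y v : ℂ)) • wedge C he.uSection y) ∧
      (∀ (V W : ∀ y : Y, TangentSpace 𝓘(ℝ, EuclideanSpace ℝ (Fin (2 * k + m))) y)
          (σ : ∀ y : Y, detE10 C m y),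
        SmoothVectorFieldNear V y → SmoothVectorFieldNear W y → SmoothDetSectionNear C σ y →
        detCurv C V W σ y =
          dOneForm (connTrace K e) (C.i y) (di C y (V y)) (di C y (W y)) • σ y)) ∧
    (∀ (y : Y) (V W : ∀ y : Y, nullSpace C y) (σ : ∀ y : Y, detE10 C m y),
      SmoothVectorFieldNear
        (fun y ↦ (V y : TangentSpace 𝓘(ℝ, EuclideanSpace ℝ (Fin (2 * k + m))) y)) y →
      SmoothVectorFieldNear
        (fun y ↦ (W y : TangentSpace 𝓘(ℝ, EuclideanSpace ℝ (Fin (2 * k + m))) y)) y →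
      SmoothDetSectionNear C σ y →
      leafCurv C V W σ y =
        (-Complex.I * (dLeaf C (leafMeanCurvForm C) V W y : ℂ)) • σ y) := by
  refine ⟨fun U e he y hy ↦ ⟨he.detConn_wedge hy, he.leafConn_wedge hy, fun V W σ hV hW hσ ↦
    he.detCurv_eq hy hV hW hσ⟩, fun y V W σ hV hW hσ ↦ leafCurv_eq ?_ hV hW hσ⟩
  rw [finrank_euclideanSpace_fin, finrank_euclideanSpace_fin]
  ring
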